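/- **Theorem (digital quantum simulation of the time-dependent Dirac equation with the $2k$-th order product formula).** Let $\alpha^i=\sigma^1\otimes\sigma^i$ $(i=1,2,3)$ and $\beta=\sigma^3\otimes \mathbb 1_2$ be the Dirac matrices, and consider on the periodic cell $[-\Omega/2,\Omega/2)^3$ of side $\Omega>0$ the equation $i\,\partial_t\psi=H\psi$ with $$H=\boldsymbol\alpha\cdot(-i\nabla+e\boldsymbol A)+\beta m-e\phi ,$$ where $m,e\in\mathbb R$ and the real potentials $\phi$ and $\boldsymbol A=(A_1,A_2,A_3)$ are time-independent, continuous and $\Omega$-periodic; put $\|\phi\|_{\max}=\sup_x|\phi(x)|$, $\|\boldsymbol A\|_{\max}=\sup_x|\boldsymbol A(x)|$ (Euclidean length). *Discretization.* For $n=2^q$ let the register consist of two spinor qubits and $q$ qubits for each coordinate; its basis states are labelled by a spinor index $a$ and $p\in([-n/2,n/2)\cap\mathbb Z)^3$. A spinor field $f$ is encoded by the amplitudes $(\Omega/n)^{3/2}f_a(r_p)$, $r_p=p\,\Omega/n$, and a register state $v$ represents the spinor field $x\mapsto\Omega^{-3/2}\sum_p (\mathcal F v)_{p}\,e^{ik_p\cdot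 x}$, $k_p=2\pi p/\Omega$, where $\mathcal F$ is the unitary discrete Fourier transform in position. On the register let $$H_1=\mathcal F^\dagger\,(\boldsymbol\alpha\cdot k_p)\,\mathcal F,\qquad H_2=\beta m,\qquad H_3=-e\,\phi(r_p),\qquad H_4=e\,\boldsymbol\alpha\cdot\boldsymbol A(r_p).$$ *Product formula.* Let $U_2(t)=e^{-i\frac t2H_1}e^{-i\frac t2H_2}e^{-i\frac t2H_3}e^{-i\frac t2H_4}\,e^{-i\frac t2H_4}e^{-i\frac t2H_3}e^{-i\frac t2H_2}e^{-i\frac t2H_1}$ and, for $k\ge2$, $U_{2k}(t)=U_{2k-2}(u_kt)^2\,U_{2k-2}((1-4u_k)t)\,U_{2k-2}(u_kt)^2$ with $u_k=1/(4-4^{1/(2k-1)})$. *Solutions.* For $\rho>0$ and $M$, let $\mathcal S_{\rho,M}(T)$ be the set of solutions $\psi$ of the Dirac equation for all times between $0$ and $T$ with $\|\psi(0)\|_{L^2(\mathrm{cell})}=1$ which are spatially differentiable, periodic and analytic uniformly in time: at each such time $\psi(t,x)=\sum_{p\in\mathbb Z^3}c_p(t)e^{2\pi i p\cdot x/\Omega}$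 with all four components of $c_p(t)$ bounded by $Me^{-\rho(|p_1|+|p_2|+|p_3|)}$. *Claim.* Fix $\Omega,\rho,\kappa>0$ and $m,e,M\in\mathbb R$. There are $C>0$ and $a\in\mathbb N$, depending only on these six numbers, such that the following holds for all $\phi,\boldsymbol A$ as above with $V:=\|\phi\|_{\max}+\|\boldsymbol A\|_{\max}\ge\kappa$, all integers $k\ge1$, all $T\in\mathbb R$ with $|T|\ge\kappa$ and all $0<\varepsilon\le1/\kappa$. There are $q\ge0$, $r\ge1$ and circuits $W_j(s)$ $(j=1,\dots,4,\ s\in\mathbb R)$ of one-qubit and two-qubit gates on the register such that 1. $n=2^q\le C\log(2+|T|/\varepsilon)$; 2. $W_j(s)$ implements $e^{-isH_j}$ and has at most $C\log^a(2+|T|/\varepsilon)$ gates; $W_2(s)$ has at most one gate; 3. the circuit $\mathcal C$ obtained from the product formula $[U_{2k}(T/r)]^r$ by replacing each factor $e^{-isH_j}$ by $W_j(s)$ has at most $C\,g\,\log^a(2+g)$ gates, where $$g=5^{2k}\,\frac{(\|\phi\|_{\max}+\|\boldsymbol A\|_{\max})^{1+1/2k}\,|T|^{1+1/2k}}{\varepsilon^{1/2k}}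 ,$$ that is, its gate complexity is $\widetilde{\mathcal O}(g)$; 4. the operator of $\mathcal C$ is within $\varepsilon$, in operator norm, of $e^{-iT(H_1+H_2+H_3+H_4)}$; 5. for every $\psi\in\mathcal S_{\rho,M}(T)$, applying $\mathcal C$ to the normalized encoding of $\psi(0)$ gives a normalized state whose $\ell^2$-distance to the encoding of $\psi(T)$ is at most $\varepsilon$, and the spinor field that it represents is within $\varepsilon$ of $\psi(T)$ in $L^2(\mathrm{cell})$. -/

import Mathlib

open Complex

noncomputable section

namespace DiracSim

/-! ## The Dirac equation in a periodic box -/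

/-- Points of space. -/
abbrev Space : Type := Fin 3 → ℝ

/-- Spinor labels: `ℂ⁴ = ℂ² ⊗ ℂ²`, the first factor separates large and small components. -/
abbrev SpinIdx : Type := Fin 2 × Fin 2

/-- The Pauli matrices `σ¹, σ², σ³` (indexed by `0, 1, 2`). -/
def pauli : Fin 3 → Matrix (Fin 2) (Fin 2) ℂ :=
  ![!![0, 1; 1, 0], !![0, -I; I, 0], !![1, 0; 0, -1]]

/-- `αⁱ = σ¹ ⊗ σⁱ`. -/
def diracAlpha (i : Fin 3) : Matrix SpinIdx SpinIdx ℂ :=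
  Matrix.kroneckerMap (fun x y => x * y) (pauli 0) (pauli i)

/-- `β = σ³ ⊗ 1`. -/
def diracBeta : Matrix SpinIdx SpinIdx ℂ :=
  Matrix.kroneckerMap (fun x y => x * y) (pauli 2) (1 : Matrix (Fin 2) (Fin 2) ℂ)

/-- The Dirac Hamiltonian `H = α · (-i∇ + e A) + β m - e φ` applied to a spinor field. -/
def diracHamiltonian (m e : ℝ) (φ : Space → ℝ) (A : Space → Fin 3 → ℝ)
    (ψ : Space → SpinIdx → ℂ) (x : Space) : SpinIdx → ℂ :=
  (∑ i, (diracAlpha i).mulVec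
      ((-I) • fderiv ℝ ψ x (Pi.single i 1) + ((e * A x i : ℝ) : ℂ) • ψ x))
    + (m : ℂ) • diracBeta.mulVec (ψ x) - ((e * φ x : ℝ) : ℂ) • ψ x

/-- The cubic cell of side length `Ω`, centred at the origin. -/
def cell (Ω : ℝ) : Set Space :=
  Set.univ.pi fun _ => Set.Ico (-(Ω / 2)) (Ω / 2)

/-- The plane wave `exp (i k_p · x)` with wave vector `k_p = 2π p / Ω`. -/
def planeWave (Ω : ℝ) (p : Fin 3 → ℤ) (x : Space) : ℂ :=
  exp (I * ((∑ i, 2 * Real.pi * (p i : ℝ) / Ω * x i : ℝ) : ℂ))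

/-- The `L²` norm over the cell of a spinor field. -/
def cellNorm (Ω : ℝ) (f : Space → SpinIdx → ℂ) : ℝ :=
  Real.sqrt (∫ x in cell Ω, ∑ a, ‖f x a‖ ^ 2)

/-- `f` is a real-analytic `Ω`-periodic spinor field whose Fourier coefficients decay
exponentially with rate `ρ` and constant `M`. -/
def AnalyticPeriodic (Ω ρ M : ℝ) (f : Space → SpinIdx → ℂ) : Prop :=
  ∃ c : (Fin 3 → ℤ) → SpinIdx → ℂ,
    (∀ p a, ‖c p a‖ ≤ M * Real.exp (-(ρ * ∑ i, |(p i : ℝ)|))) ∧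
    ∀ x, HasSum (fun p => planeWave Ω p x • c p) (f x)

/-- `ψ` is a normalized solution of `i ∂ψ/∂t = H ψ` for times between `0` and `T`, in the periodic
cell of side `Ω`, spatially analytic at these times with constants `ρ, M`. -/
structure IsDiracSolution (Ω m e : ℝ) (φ : Space → ℝ) (A : Space → Fin 3 → ℝ) (ρ M T : ℝ)
    (ψ : ℝ → Space → SpinIdx → ℂ) : Prop where
  analytic : ∀ t ∈ Set.uIcc 0 T, AnalyticPeriodic Ω ρ M (ψ t)
  differentiable : ∀ t ∈ Set.uIcc 0 T, Differentiable ℝ (ψ t)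
  equation : ∀ t ∈ Set.uIcc 0 T, ∀ x,
    HasDerivWithinAt (fun s => ψ s x) ((-I) • diracHamiltonian m e φ A (ψ t) x)
      (Set.uIcc 0 T) t
  normalized : cellNorm Ω (ψ 0) = 1

/-- `Ω`-periodicity in each coordinate. -/
def Periodic3 {β : Type} (Ω : ℝ) (f : Space → β) : Prop :=
  ∀ (x : Space) (i : Fin 3), f (x + Pi.single i Ω) = f x

/-- `‖φ‖_max`. -/
def scalarMax (φ : Space → ℝ) : ℝ := ⨆ x, |φ x|

/-- `‖A‖_max`, the maximal Euclidean length of the vector potential. -/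
def vectorMax (A : Space → Fin 3 → ℝ) : ℝ := ⨆ x, Real.sqrt (∑ i, A x i ^ 2)

/-! ## Registers, gates and circuits -/

/-- Two spinor qubits, and `q` qubits for each of the three coordinates (`n = 2 ^ q`). -/
abbrev Qubit (q : ℕ) : Type := Fin 2 ⊕ (Fin 3 × Fin q)

/-- Computational basis labels. -/
abbrev Reg (q : ℕ) : Type := Qubit q → Fin 2

/-- Pure (not necessarily normalized) states of the register. -/
abbrev QState (q : ℕ) : Type := EuclideanSpace ℂ (Reg q)

/-- The action of a matrix on a state. -/
def act {q : ℕ} (U : Matrix (Reg q) (Reg q) ℂ) (v : QState q) : QState q :=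
  WithLp.toLp 2 (U.mulVec v.ofLp)

/-- One-qubit and two-qubit gates. -/
inductive Gate (q : ℕ) : Type
  | one (i : Qubit q) (U : Matrix.unitaryGroup (Fin 2) ℂ) : Gate q
  | two (i j : Qubit q) (hij : i ≠ j) (U : Matrix.unitaryGroup (Fin 2 × Fin 2) ℂ) : Gate q

open Classical in
/-- The matrix of a gate on the whole register (identity on the other qubits). -/
def Gate.matrix {q : ℕ} : Gate q → Matrix (Reg q) (Reg q) ℂ
  | .one i U => fun b b' =>
      if ∀ l, l ≠ i → b l = b' l then (U : Matrix (Fin 2) (Fin 2) ℂ) (b i) (b' i) else 0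
  | .two i j _ U => fun b b' =>
      if ∀ l, l ≠ i → l ≠ j → b l = b' l then
        (U : Matrix (Fin 2 × Fin 2) (Fin 2 × Fin 2) ℂ) (b i, b j) (b' i, b' j) else 0

/-- A circuit is a word of gates; the rightmost gate acts first. Its gate count is
`FreeMonoid.length`. -/
abbrev Circuit (q : ℕ) : Type := FreeMonoid (Gate q)

/-- The unitary matrix of a circuit. -/
def circuitMatrix {q : ℕ} (c : Circuit q) : Matrix (Reg q) (Reg q) ℂ :=
  FreeMonoid.lift Gate.matrix c

/-! ## Space discretization -/

/-- The spinor label stored in a basis state. -/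
def spin {q : ℕ} (b : Reg q) : SpinIdx := (b (Sum.inl 0), b (Sum.inl 1))

/-- The integers `p ∈ [-n/2, n/2)³` stored in a basis state. -/
def gridIdx {q : ℕ} (b : Reg q) (i : Fin 3) : ℤ :=
  (∑ j : Fin q, ((b (Sum.inr (i, j)) : ℕ) : ℤ) * 2 ^ (j : ℕ)) - ((2 ^ q / 2 : ℕ) : ℤ)

/-- The position grid point `r_p = p Ω / n`. -/
def node (Ω : ℝ) {q : ℕ} (b : Reg q) : Space :=
  fun i => (gridIdx b i : ℝ) * Ω / 2 ^ q

/-- The momentum grid point `k_p = 2π p / Ω`. -/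
def waveVec (Ω : ℝ) {q : ℕ} (b : Reg q) (i : Fin 3) : ℝ :=
  2 * Real.pi * (gridIdx b i : ℝ) / Ω

/-- The three-dimensional discrete Fourier transform from the position grid (columns) to the
momentum grid (rows), acting trivially on the spinor. -/
def fourierMatrix (q : ℕ) : Matrix (Reg q) (Reg q) ℂ := fun b b' =>
  if spin b = spin b' then
    ((((Real.sqrt (2 ^ q)) ^ 3)⁻¹ : ℝ) : ℂ) *
      exp (-(I * ((2 * Real.pi * (∑ i, (gridIdx b i : ℝ) * (gridIdx b' i : ℝ)) / 2 ^ q : ℝ) : ℂ)))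
  else 0

/-- A position- (or momentum-) dependent matrix acting on the spinor. -/
def localMatrix {q : ℕ} (D : Reg q → Matrix SpinIdx SpinIdx ℂ) : Matrix (Reg q) (Reg q) ℂ :=
  fun b b' => if gridIdx b = gridIdx b' then D b (spin b) (spin b') else 0

/-- The four parts of the Dirac Hamiltonian on the grid: the kinetic term
`H₁ = -i α · ∇` (diagonal in momentum), the mass term `H₂ = β m`, the scalar potential
`H₃ = -e φ` and the vector potential `H₄ = e α · A`. -/
def hamTerm (Ω m e : ℝ) (φ : Space → ℝ) (A : Space → Fin 3 → ℝ) (q : ℕ) :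
    Fin 4 → Matrix (Reg q) (Reg q) ℂ :=
  ![(fourierMatrix q).conjTranspose *
      localMatrix (fun b => ∑ i, (waveVec Ω b i : ℂ) • diracAlpha i) * fourierMatrix q,
    localMatrix (fun _ => (m : ℂ) • diracBeta),
    localMatrix (fun b => ((-(e * φ (node Ω b)) : ℝ) : ℂ) • 1),
    localMatrix (fun b => ∑ i, ((e * A (node Ω b) i : ℝ) : ℂ) • diracAlpha i)]

/-- `exp (-i t H)` for a matrix `H`. -/
def propagator {q : ℕ} (H : Matrix (Reg q) (Reg q) ℂ) (t : ℝ) : Matrix (Reg q) (Reg q) ℂ :=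
  NormedSpace.exp ((-(I * (t : ℂ))) • H)

/-- The amplitudes `(Ω / n)^{3/2} ψ(r_p)` that encode a spinor field on the register. -/
def sampleState (Ω : ℝ) (q : ℕ) (f : Space → SpinIdx → ℂ) : QState q :=
  WithLp.toLp 2 fun b => (((Real.sqrt (Ω / 2 ^ q)) ^ 3 : ℝ) : ℂ) * f (node Ω b) (spin b)

/-- The normalized register state that encodes a spinor field. -/
def initialState (Ω : ℝ) (q : ℕ) (f : Space → SpinIdx → ℂ) : QState q :=
  ((‖sampleState Ω q f‖⁻¹ : ℝ) : ℂ) • sampleState Ω q f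

open Classical in
/-- The spinor field represented by a register state: the trigonometric polynomial with wave
vectors on the momentum grid that takes the values `(n / Ω)^{3/2} v_p` at the grid points. -/
def interpolant (Ω : ℝ) {q : ℕ} (v : QState q) (x : Space) : SpinIdx → ℂ := fun a =>
  ((((Real.sqrt Ω) ^ 3)⁻¹ : ℝ) : ℂ) *
    ∑ b : Reg q, if spin b = a then (act (fourierMatrix q) v) b * planeWave Ω (gridIdx b) x else 0

/-! ## Product formulas -/

/-- Suzuki's coefficient `u_k = 1 / (4 - 4^{1/(2k-1)})`. -/
def suzukiCoeff (k : ℕ) : ℝ := 1 / (4 - (4 : ℝ) ^ (1 / (2 * (k : ℝ) - 1)))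

/-- The product formula `U_{2k}(t)` (with `k` as the natural-number argument) built from
`E j t`, which stands for `exp (-i t H_j)`. It is defined in any monoid, so that it makes sense both
for matrices and for circuits. -/
def suzuki {G : Type} [Monoid G] (E : Fin 4 → ℝ → G) : ℕ → ℝ → G
  | 0, _ => 1
  | 1, t => E 0 (t / 2) * E 1 (t / 2) * E 2 (t / 2) * E 3 (t / 2) *
      (E 3 (t / 2) * E 2 (t / 2) * E 1 (t / 2) * E 0 (t / 2))
  | k + 2, t =>
      suzuki E (k + 1) (suzukiCoeff (k + 2) * t) ^ 2 *
        suzuki E (k + 1) ((1 - 4 * suzukiCoeff (k + 2)) * t) *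
        suzuki E (k + 1) (suzukiCoeff (k + 2) * t) ^ 2

/-- `g = 5^{2k} V^{1+1/2k} |T|^{1+1/2k} / ε^{1/2k}`. -/
def costScale (k : ℕ) (V T ε : ℝ) : ℝ :=
  5 ^ (2 * k) * V ^ (1 + 1 / (2 * (k : ℝ))) * |T| ^ (1 + 1 / (2 * (k : ℝ))) /
    ε ^ (1 / (2 * (k : ℝ)))

end DiracSim

end

noncomputable section

namespace DiracSim

set_option linter.unusedSectionVars false

/-! ## Product formulas in a monoid -/

section Monoid

variable {G G' : Type} [Monoid G] [Monoid G']

/-! A solution that is analytic uniformly in time has a Fourier tail of order `exp(-ρn/4)` beyond a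
grid of `n` points per direction, so `n = O(log(2 + |T|/ε))` suffices. The register then has
dimension `4n³`, which is polylogarithmic in `|T|/ε`. Consequently every evolution generated by a
Hermitian matrix may be synthesized exactly at a cost polynomial in the dimension
(`implementable_propagator`), and the norm of the kinetic term, of order `n/Ω`, contributes only a
logarithm to the number of time steps.

The order of Suzuki's formula is proved with formal power series in the time. Series with constant
term 1 that first differ in degree `m` have additive first discrepancies under multiplication,
scaled by `t^m` under `X ↦ tX`. Suzuki's coefficient cancels the odd degree `2k+3`, and
time-reversal symmetry excludes a first discrepancy in an even degree (`agreeBelow_suzuki`).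
Majorization of all coefficients by those of an exponential turns this into the explicit local error
of `norm_suzuki_sub_exp_le`; by unitarity, the errors of the `r` steps add.

For the discretization, the mass and potential terms act pointwise and commute with sampling, and
the discrete kinetic term is exact on plane waves whose momentum lies on the grid. Sampled solutions
therefore solve the discrete equation up to an exponentially small source
(`norm_kinetic_consistency_le`), and Duhamel's principle bounds the deviation
(`IsDiracSolution.norm_propagator_sub_le`). Trigonometric interpolation is an isometry into `L²`
(`cellNorm_interpolant`), which carries the estimates back to fields and shows that the samples have
almost unit norm.

Constants must not depend on `k`. The recursion stretches the total absolute time by at most `3` per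
level and multiplies the number of factors by `5`, and `15^k` fits below `5^{2k+2}`
(`steps_mul_le`). Moreover `log(2 + |T|/ε)` is bounded by a constant times `log²(2 + g)` uniformly
in `k` (`exists_log_le`), because `k` itself is logarithmic in `g`. -/

theorem map_suzuki (f : G →* G') (E : Fin 4 → ℝ → G) (k : ℕ) (t : ℝ) :
    f (suzuki E k t) = suzuki (fun j s => f (E j s)) k t := by
  induction k using Nat.strong_induction_on generalizing t with
  | _ k ih =>
    match k with
    | 0 => simp [suzuki]
    | 1 => simp [suzuki]
    | k + 2 => simp [suzuki, ih (k + 1) (by omega)]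

theorem suzuki_comp_mul (E : Fin 4 → ℝ → G) (s : ℝ) (k : ℕ) (t : ℝ) :
    suzuki (fun j x => E j (s * x)) k t = suzuki E k (s * t) := by
  induction k using Nat.strong_induction_on generalizing t with
  | _ k ih =>
    match k with
    | 0 => simp [suzuki]
    | 1 => simp only [suzuki, mul_div_assoc]
    | k + 2 => simp only [suzuki, ih (k + 1) (by omega), mul_left_comm]

/-- Each formula is a palindrome, so against its time reversal the factors cancel pairwise from the
middle outwards. This symmetry is what later rules out first errors of even degree. -/
theorem suzuki_mul_suzuki_neg (E : Fin 4 → ℝ → G) (hE : ∀ j t, E j t * E j (-t) = 1) (k : ℕ)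
    (t : ℝ) : suzuki E k t * suzuki E k (-t) = 1 := by
  have cancel : ∀ j t x, E j t * (E j (-t) * x) = x := fun j t x => by
    rw [← mul_assoc, hE, one_mul]
  induction k using Nat.strong_induction_on generalizing t with
  | _ k ih =>
    match k with
    | 0 => simp [suzuki]
    | 1 => simp only [suzuki, neg_div, mul_assoc, cancel, hE]
    | k + 2 =>
      have h := ih (k + 1) (by omega)
      have c : ∀ t x, suzuki E (k + 1) t * (suzuki E (k + 1) (-t) * x) = x := fun t x => by
        rw [← mul_assoc, h, one_mul]
      simp only [suzuki, mul_neg, mul_assoc, pow_two, c, h]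

/-- Eight exponentials at the lowest level and five copies per level of the recursion; the index `k
+ 1` avoids the degenerate empty formula at `0`. -/
theorem length_suzuki_le {α : Type} (E : Fin 4 → ℝ → FreeMonoid α) (L : ℕ)
    (hE : ∀ j t, (E j t).length ≤ L) (k : ℕ) (t : ℝ) :
    (suzuki E (k + 1) t).length ≤ 8 * 5 ^ k * L := by
  induction k generalizing t with
  | zero =>
    simp only [suzuki, FreeMonoid.length_mul]
    have h := fun j => hE j (t / 2)
    have := h 0; have := h 1; have := h 2; have := h 3
    omega
  | succ k ih =>
    simp only [suzuki, FreeMonoid.length_mul, pow_two]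
    have h1 := ih (suzukiCoeff (k + 2) * t)
    have h2 := ih ((1 - 4 * suzukiCoeff (k + 2)) * t)
    rw [pow_succ]
    nlinarith

end Monoid

/-! ### Suzuki's coefficients -/

theorem suzukiCoeff_bounds (k : ℕ) : 0 < suzukiCoeff (k + 2) ∧ suzukiCoeff (k + 2) ≤ 1 / 2 ∧
    1 / 4 ≤ suzukiCoeff (k + 2) := by
  -- The exponent is `1/(2k+3)`. Bounding it by `1/2` already places the denominator `4 - w` between
  -- `2` and `4`.
  have h1 : (4 : ℝ) ^ (1 / (2 * ((k + 2 : ℕ) : ℝ) - 1)) ≤ 2 := by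
    have h2 : (2 : ℝ) = 4 ^ (1 / 2 : ℝ) := by
      rw [show (4 : ℝ) = 2 ^ (2 : ℝ) by norm_num, ← Real.rpow_mul (by norm_num)]; norm_num
    conv_rhs => rw [h2]
    apply Real.rpow_le_rpow_of_exponent_le (by norm_num)
    apply one_div_le_one_div_of_le (by norm_num)
    push_cast
    have : (0 : ℝ) ≤ k := k.cast_nonneg
    linarith
  have h0 : 0 < (4 : ℝ) ^ (1 / (2 * ((k + 2 : ℕ) : ℝ) - 1)) := by positivity
  unfold suzukiCoeff
  refine ⟨by apply one_div_pos.2; linarith, ?_, ?_⟩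
  · exact one_div_le_one_div_of_le (by norm_num) (by linarith)
  · exact one_div_le_one_div_of_le (by linarith) (by linarith)

/-- The coefficient is designed for this cancellation: with `w = 4^{1/(2k+3)}` one has `1 - 4u =
-wu`, and the odd power of `-w` is `-4`. -/
theorem suzukiCoeff_pow (k : ℕ) :
    4 * suzukiCoeff (k + 2) ^ (2 * k + 3) + (1 - 4 * suzukiCoeff (k + 2)) ^ (2 * k + 3) = 0 := by
  obtain ⟨h0, h1, h2⟩ := suzukiCoeff_bounds k
  set w := (4 : ℝ) ^ (1 / (2 * ((k + 2 : ℕ) : ℝ) - 1)) with hw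
  have hu : suzukiCoeff (k + 2) = 1 / (4 - w) := rfl
  have hne : 4 - w ≠ 0 := by
    rintro h; rw [hu, h] at h0; simp at h0
  have hwp : w ^ (2 * k + 3) = 4 := by
    rw [hw, ← Real.rpow_natCast, ← Real.rpow_mul (by norm_num)]
    have : (2 * ((k + 2 : ℕ) : ℝ) - 1) = ((2 * k + 3 : ℕ) : ℝ) := by push_cast; ring
    rw [this, one_div_mul_cancel (by positivity), Real.rpow_one]
  have h3 : 1 - 4 * suzukiCoeff (k + 2) = - (w * suzukiCoeff (k + 2)) := by
    rw [hu]; field_simp; ring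
  rw [h3, Odd.neg_pow ⟨k + 1, by ring⟩, mul_pow, hwp]
  ring

/-! ## Formal power series with coefficients in a normed algebra -/

section FormalSeries

open PowerSeries Finset

/-- The binomial theorem divided by `n!`. It gives both the exponential law for formal series and
the additivity of the radii of exponential majorants. -/
theorem sum_antidiagonal_pow_div_factorial {K : Type} [Field K] [CharZero K] (x y : K) (n : ℕ) :
    ∑ p ∈ antidiagonal n, (x ^ p.1 * (p.1.factorial : K)⁻¹) * (y ^ p.2 * (p.2.factorial : K)⁻¹)
      = (x + y) ^ n * (n.factorial : K)⁻¹ := by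
  rw [(Commute.all x y).add_pow', Finset.sum_mul]
  refine Finset.sum_congr rfl fun p hp => ?_
  obtain rfl := mem_antidiagonal.1 hp
  have h := Nat.add_choose_mul_factorial_mul_factorial p.1 p.2
  have h1 : (p.1.factorial : K) ≠ 0 := by exact_mod_cast p.1.factorial_ne_zero
  have h2 : (p.2.factorial : K) ≠ 0 := by exact_mod_cast p.2.factorial_ne_zero
  have h3 : ((p.1 + p.2).factorial : K) ≠ 0 := by exact_mod_cast (p.1 + p.2).factorial_ne_zero
  rw [nsmul_eq_mul]
  rw [Nat.choose_symm_add]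
  field_simp
  rw [← h]
  push_cast
  ring

variable {𝔸 : Type} [NormedRing 𝔸] [NormedAlgebra ℂ 𝔸]

/-- The power series of `exp (t X Y)` in the formal variable `X`. -/
def expPowerSeries (Y : 𝔸) (t : ℝ) : PowerSeries 𝔸 :=
  PowerSeries.mk fun n => ((t : ℂ) ^ n * (n.factorial : ℂ)⁻¹) • Y ^ n

theorem expPowerSeries_mul (Y : 𝔸) (s t : ℝ) :
    expPowerSeries Y s * expPowerSeries Y t = expPowerSeries Y (s + t) := by
  ext n
  rw [coeff_mul]
  simp only [expPowerSeries, coeff_mk]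
  rw [Complex.ofReal_add, ← sum_antidiagonal_pow_div_factorial, Finset.sum_smul]
  refine Finset.sum_congr rfl fun p hp => ?_
  rw [smul_mul_smul_comm, ← pow_add, mem_antidiagonal.1 hp]

theorem expPowerSeries_zero (Y : 𝔸) : expPowerSeries Y 0 = 1 := by
  ext n
  rw [expPowerSeries, coeff_mk, coeff_one]
  rcases eq_or_ne n 0 with rfl | h <;> simp [*]

theorem expPowerSeries_mul_neg (Y : 𝔸) (t : ℝ) :
    expPowerSeries Y t * expPowerSeries Y (-t) = 1 := by
  rw [expPowerSeries_mul, add_neg_cancel, expPowerSeries_zero]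

/-- Substitution of `t X` for `X`. -/
def dilate (t : ℝ) : PowerSeries 𝔸 →* PowerSeries 𝔸 where
  toFun p := PowerSeries.mk fun n => (t : ℂ) ^ n • coeff n p
  map_one' := by
    ext n
    rw [coeff_mk, coeff_one]
    rcases eq_or_ne n 0 with rfl | h <;> simp [*]
  map_mul' p q := by
    ext n
    rw [coeff_mk, coeff_mul, coeff_mul, Finset.smul_sum]
    refine Finset.sum_congr rfl fun x hx => ?_
    rw [coeff_mk, coeff_mk, smul_mul_smul_comm, ← pow_add, mem_antidiagonal.1 hx]

@[simp]
theorem coeff_dilate (t : ℝ) (p : PowerSeries 𝔸) (n : ℕ) :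
    coeff n (dilate t p) = (t : ℂ) ^ n • coeff n p := by
  simp [dilate]

theorem dilate_expPowerSeries (Y : 𝔸) (s t : ℝ) :
    dilate s (expPowerSeries Y t) = expPowerSeries Y (s * t) := by
  ext n
  rw [coeff_dilate, expPowerSeries, expPowerSeries, coeff_mk, coeff_mk, smul_smul]
  congr 1
  push_cast
  ring

/-- A formula with step `t` is the unit-step formula with `X` replaced by `tX`, so the order needs
to be studied for step `1` only. -/
theorem dilate_suzuki (Y : Fin 4 → 𝔸) (k : ℕ) (t : ℝ) :
    dilate t (suzuki (fun j => expPowerSeries (Y j)) k 1)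
      = suzuki (fun j => expPowerSeries (Y j)) k t := by
  rw [map_suzuki]
  simp only [dilate_expPowerSeries]
  rw [suzuki_comp_mul (fun j => expPowerSeries (Y j)), mul_one]

/-! ### The order of the product formula as agreement of power series -/

/-- `p` and `q` have constant coefficient `1`, agree below degree `m`, and their coefficients of
degree `m` differ by `d`. -/
structure AgreeBelow (m : ℕ) (p q : PowerSeries 𝔸) (d : 𝔸) : Prop where
  left : coeff 0 p = 1
  right : coeff 0 q = 1
  below : ∀ n < m, coeff n p = coeff n q
  at_m : coeff m p = coeff m q + d

/-- Since the constant terms are `1`, a degree-`m` coefficient meets only a constant term of the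
other factor. All other products in degree `m` involve degrees strictly between `0` and `m`, where
the series agree. -/
theorem AgreeBelow.mul {m : ℕ} {p q p' q' : PowerSeries 𝔸} {d d' : 𝔸} (hm : 0 < m)
    (h : AgreeBelow m p q d) (h' : AgreeBelow m p' q' d') :
    AgreeBelow m (p * p') (q * q') (d + d') where
  left := by simp [coeff_mul, h.left, h'.left]
  right := by simp [coeff_mul, h.right, h'.right]
  below n hn := by
    rw [coeff_mul, coeff_mul]
    refine Finset.sum_congr rfl fun x hx => ?_
    have := mem_antidiagonal.1 hx
    rw [h.below _ (by omega), h'.below _ (by omega)]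
  at_m := by
    obtain ⟨m, rfl⟩ : ∃ l, m = l + 1 := ⟨m - 1, by omega⟩
    have key : ∀ a b : PowerSeries 𝔸, coeff 0 a = 1 → coeff 0 b = 1 →
        coeff (m + 1) (a * b) = coeff (m + 1) a + coeff (m + 1) b
          + ∑ x ∈ antidiagonal (m + 1) with x.1 ≠ 0 ∧ x.2 ≠ 0, coeff x.1 a * coeff x.2 b := by
      intro a b ha hb
      have e : (antidiagonal (m + 1)).filter (fun x => x.1 ≠ 0 ∧ x.2 ≠ 0)
          = ((antidiagonal (m + 1)).erase (0, m + 1)).erase (m + 1, 0) := by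
        ext ⟨x, y⟩
        simp only [Finset.mem_filter, HasAntidiagonal.mem_antidiagonal, Finset.mem_erase, Prod.mk.injEq, ne_eq]
        omega
      rw [e, coeff_mul, ← Finset.add_sum_erase _ _ (a := (0, m + 1)) (by simp),
        ← Finset.add_sum_erase _ _ (a := (m + 1, 0)) (by simp)]
      simp only [ha, hb, one_mul, mul_one]
      abel
    rw [key _ _ h.left h'.left, key _ _ h.right h'.right, h.at_m, h'.at_m]
    rw [Finset.sum_congr rfl (g := fun x : ℕ × ℕ => coeff x.1 q * coeff x.2 q')]
    · abel
    · intro x hx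
      rw [Finset.mem_filter, HasAntidiagonal.mem_antidiagonal] at hx
      rw [h.below _ (by omega), h'.below _ (by omega)]

theorem AgreeBelow.dilate {m : ℕ} {p q : PowerSeries 𝔸} {d : 𝔸} (h : AgreeBelow m p q d) (t : ℝ) :
    AgreeBelow m (dilate t p) (dilate t q) ((t : ℂ) ^ m • d) where
  left := by simp [h.left]
  right := by simp [h.right]
  below n hn := by simp [h.below n hn]
  at_m := by simp [h.at_m]

theorem AgreeBelow.succ {m : ℕ} {p q : PowerSeries 𝔸} (h : AgreeBelow m p q 0) :
    AgreeBelow (m + 1) p q (coeff (m + 1) p - coeff (m + 1) q) where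
  left := h.left
  right := h.right
  below n hn := by
    rcases Nat.lt_succ_iff_lt_or_eq.1 hn with hn | rfl
    · exact h.below n hn
    · simpa using h.at_m
  at_m := by abel

/-- Time-reversal symmetric series cannot differ first in an even degree. -/
theorem AgreeBelow.eq_zero_of_symm {m : ℕ} (hm : 0 < m) (hev : Even m) {p q : PowerSeries 𝔸}
    {d : 𝔸} (h : AgreeBelow m p q d) (hp : p * DiracSim.dilate (-1) p = 1)
    (hq : q * DiracSim.dilate (-1) q = 1) : d = 0 := by
  -- The product with the reflected series has discrepancy `d + (-1)^m d = 2d`, while both products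
  -- are equal to `1`.
  have := (h.mul hm (h.dilate (-1))).at_m
  rw [hp, hq] at this
  have h2 : d + d = 0 := by simpa [hev] using this
  have : (2 : ℂ) • d = 0 := by rw [two_smul, h2]
  simpa using this

/-- To first order the ordering of the factors is invisible, and the two half steps of each
generator make a full one. Second-order agreement then comes from symmetry alone. -/
theorem agreeBelow_suzuki_base (Y : Fin 4 → 𝔸) :
    AgreeBelow 1 (suzuki (fun j => expPowerSeries (Y j)) 1 1) (expPowerSeries (∑ j, Y j) 1) 0 := by
  have h : ∀ j, AgreeBelow 1 (expPowerSeries (Y j) (1 / 2)) 1 ((1 / 2 : ℂ) • Y j) := fun j =>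
    { left := by simp [expPowerSeries]
      right := by simp
      below := by simp [expPowerSeries]
      at_m := by simp [expPowerSeries, coeff_one] }
  have h1 := ((((h 0).mul one_pos (h 1)).mul one_pos (h 2)).mul one_pos (h 3)).mul one_pos
    ((((h 3).mul one_pos (h 2)).mul one_pos (h 1)).mul one_pos (h 0))
  refine ⟨h1.left, by simp [expPowerSeries], ?_, ?_⟩
  · simp only [Nat.lt_one_iff, forall_eq]
    exact h1.left.trans (by simp [expPowerSeries])
  · refine h1.at_m.trans ?_
    simp only [mul_one, coeff_one, one_ne_zero, if_false, zero_add, add_zero, expPowerSeries,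
      coeff_mk, Fin.sum_univ_four, pow_one, Nat.factorial_one, Nat.cast_one, inv_one,
      Complex.ofReal_one, one_smul]
    module

/-- Each level of the recursion gains two degrees. Four copies at time `u` and one at time `1 - 4u`
give the discrepancy `(4u^{2k+3} + (1-4u)^{2k+3}) d = 0` in degree `2k+3`; degree `2k+4` is even, so
the discrepancy there vanishes by time-reversal symmetry. The times add up to `1`, so the comparison
series remains the full exponential. -/
theorem agreeBelow_suzuki (Y : Fin 4 → 𝔸) (k : ℕ) :
    ∃ d, AgreeBelow (2 * k + 3) (suzuki (fun j => expPowerSeries (Y j)) (k + 1) 1)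
      (expPowerSeries (∑ j, Y j) 1) d := by
  have hp : ∀ k, suzuki (fun j => expPowerSeries (Y j)) k 1
      * dilate (-1) (suzuki (fun j => expPowerSeries (Y j)) k 1) = 1 := fun k => by
    rw [dilate_suzuki, suzuki_mul_suzuki_neg _ (fun j t => expPowerSeries_mul_neg _ t)]
  have hq : expPowerSeries (∑ j, Y j) 1 * dilate (-1) (expPowerSeries (∑ j, Y j) 1) = 1 := by
    rw [dilate_expPowerSeries, mul_one, expPowerSeries_mul_neg]
  induction k with
  | zero =>
    have h := (agreeBelow_suzuki_base Y).succ
    have h0 := h.eq_zero_of_symm (by norm_num) (by decide) (hp 1) hq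
    rw [h0] at h
    exact ⟨_, h.succ⟩
  | succ k ih =>
    obtain ⟨d, hd⟩ := ih
    have hs : ∀ s : ℝ, AgreeBelow (2 * k + 3) (suzuki (fun j => expPowerSeries (Y j)) (k + 1) s)
        (expPowerSeries (∑ j, Y j) s) ((s : ℂ) ^ (2 * k + 3) • d) := fun s => by
      have := hd.dilate s
      rwa [dilate_suzuki, dilate_expPowerSeries, mul_one] at this
    set u := suzukiCoeff (k + 2) with hu
    have m0 : 0 < 2 * k + 3 := by omega
    have h1 := (((hs u).mul m0 (hs u)).mul m0 (hs (1 - 4 * u))).mul m0 ((hs u).mul m0 (hs u))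
    have e1 : suzuki (fun j => expPowerSeries (Y j)) (k + 1 + 1) 1
        = suzuki (fun j => expPowerSeries (Y j)) (k + 1) u
          * suzuki (fun j => expPowerSeries (Y j)) (k + 1) u
          * suzuki (fun j => expPowerSeries (Y j)) (k + 1) (1 - 4 * u)
          * (suzuki (fun j => expPowerSeries (Y j)) (k + 1) u
          * suzuki (fun j => expPowerSeries (Y j)) (k + 1) u) := by
      simp only [suzuki, mul_one, pow_two, hu]
    have e2 : ((u : ℂ) ^ (2 * k + 3) • d + (u : ℂ) ^ (2 * k + 3) • d
        + ((1 - 4 * u : ℝ) : ℂ) ^ (2 * k + 3) • d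
        + ((u : ℂ) ^ (2 * k + 3) • d + (u : ℂ) ^ (2 * k + 3) • d)) = 0 := by
      have := suzukiCoeff_pow k
      rw [← hu] at this
      have h3 : (4 : ℂ) * (u : ℂ) ^ (2 * k + 3) + ((1 - 4 * u : ℝ) : ℂ) ^ (2 * k + 3) = 0 := by
        exact_mod_cast this
      calc _ = ((4 : ℂ) * (u : ℂ) ^ (2 * k + 3) + ((1 - 4 * u : ℝ) : ℂ) ^ (2 * k + 3)) • d := by
            module
        _ = 0 := by rw [h3, zero_smul]
    rw [← e1, e2] at h1
    simp only [expPowerSeries_mul] at h1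
    rw [show u + u + (1 - 4 * u) + (u + u) = 1 by ring] at h1
    have h2 := h1.succ
    have h0 := h2.eq_zero_of_symm (by omega) ⟨k + 2, by ring⟩ (hp _) hq
    rw [h0] at h2
    exact ⟨_, h2.succ⟩

/-! ### Exponential majorants and the explicit local error -/

/-- The power series `p` converges to `x` at `1` and is dominated by the series of `exp R`. -/
structure ExpMajorized (p : PowerSeries 𝔸) (x : 𝔸) (R : ℝ) : Prop where
  nonneg : 0 ≤ R
  norm_coeff_le : ∀ n, ‖coeff n p‖ ≤ R ^ n * (n.factorial : ℝ)⁻¹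
  hasSum : HasSum (fun n => coeff n p) x

theorem summable_pow_mul_inv_factorial (R : ℝ) :
    Summable fun n : ℕ => R ^ n * (n.factorial : ℝ)⁻¹ :=
  Real.summable_pow_div_factorial R

/-- The coefficient bounds convolve to those of `exp R · exp R' = exp (R + R')`. Absolute
convergence makes the Cauchy product converge to the product of the sums. -/
theorem ExpMajorized.mul [CompleteSpace 𝔸] {p p' : PowerSeries 𝔸} {x x' : 𝔸} {R R' : ℝ}
    (h : ExpMajorized p x R) (h' : ExpMajorized p' x' R') :
    ExpMajorized (p * p') (x * x') (R + R') where
  nonneg := add_nonneg h.nonneg h'.nonneg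
  norm_coeff_le n := by
    rw [coeff_mul, ← sum_antidiagonal_pow_div_factorial]
    refine (norm_sum_le _ _).trans (Finset.sum_le_sum fun y _ => ?_)
    have := h.nonneg
    exact (norm_mul_le _ _).trans
      (mul_le_mul (h.norm_coeff_le _) (h'.norm_coeff_le _) (norm_nonneg _) (by positivity))
  hasSum := by
    have s : Summable fun n => ‖coeff n p‖ := Summable.of_nonneg_of_le (fun _ => norm_nonneg _)
      h.norm_coeff_le (summable_pow_mul_inv_factorial R)
    have s' : Summable fun n => ‖coeff n p'‖ := Summable.of_nonneg_of_le (fun _ => norm_nonneg _)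
      h'.norm_coeff_le (summable_pow_mul_inv_factorial R')
    have e := tsum_mul_tsum_eq_tsum_sum_antidiagonal_of_summable_norm s s'
    rw [h.hasSum.tsum_eq, h'.hasSum.tsum_eq] at e
    simp only [coeff_mul, e]
    exact (summable_norm_sum_mul_antidiagonal_of_summable_norm s s').of_norm.hasSum

theorem ExpMajorized.mono {p : PowerSeries 𝔸} {x : 𝔸} {R R' : ℝ}
    (h : ExpMajorized p x R) (hR : R ≤ R') : ExpMajorized p x R' where
  nonneg := h.nonneg.trans hR
  norm_coeff_le n := (h.norm_coeff_le n).trans (by have := h.nonneg; gcongr)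
  hasSum := h.hasSum

theorem expMajorized_expPowerSeries [CompleteSpace 𝔸] [NormOneClass 𝔸] (Y : 𝔸) (t : ℝ) :
    ExpMajorized (expPowerSeries Y t) (NormedSpace.exp ((t : ℂ) • Y)) (‖Y‖ * |t|) where
  nonneg := by positivity
  norm_coeff_le n := by
    simp only [expPowerSeries, coeff_mk]
    rw [norm_smul, norm_mul, norm_pow, norm_inv, Complex.norm_natCast, Complex.norm_real,
      Real.norm_eq_abs, mul_pow]
    have := norm_pow_le Y n
    calc |t| ^ n * (n.factorial : ℝ)⁻¹ * ‖Y ^ n‖ ≤ |t| ^ n * (n.factorial : ℝ)⁻¹ * ‖Y‖ ^ n := by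
          gcongr
      _ = _ := by ring
  hasSum := by
    have := NormedSpace.exp_series_hasSum_exp' (𝕂 := ℂ) ((t : ℂ) • Y)
    convert this using 2 with n
    simp only [expPowerSeries, coeff_mk, smul_pow, smul_smul]
    rw [mul_comm]

/-- The radius measures the total absolute time spent on each generator. One level of the recursion
multiplies it by `4u + |1 - 4u| = 8u - 1`, which is at most `3` because `u ≤ 1/2`. -/
theorem expMajorized_suzuki [CompleteSpace 𝔸] [NormOneClass 𝔸] (Y : Fin 4 → 𝔸) (k : ℕ) (t : ℝ) :
    ExpMajorized (suzuki (fun j => expPowerSeries (Y j)) (k + 1) t)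
      (suzuki (fun j s => NormedSpace.exp ((s : ℂ) • Y j)) (k + 1) t)
      (3 ^ k * (∑ j, ‖Y j‖) * |t|) := by
  induction k generalizing t with
  | zero =>
    have h := fun j => expMajorized_expPowerSeries (Y j) (t / 2)
    have := (((((h 0).mul (h 1)).mul (h 2)).mul (h 3))).mul
      ((((h 3).mul (h 2)).mul (h 1)).mul (h 0))
    refine this.mono (le_of_eq ?_)
    rw [abs_div, abs_two, Fin.sum_univ_four]
    ring
  | succ k ih =>
    obtain ⟨h0, h1, h2⟩ := suzukiCoeff_bounds k
    set u := suzukiCoeff (k + 2) with hu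
    have a := ih (u * t)
    have := ((a.mul a).mul (ih ((1 - 4 * u) * t))).mul (a.mul a)
    simp only [← pow_two] at this
    refine this.mono ?_
    have hS : 0 ≤ (3 : ℝ) ^ k * ∑ j, ‖Y j‖ := by positivity
    set S := (3 : ℝ) ^ k * ∑ j, ‖Y j‖ with hSd
    rw [abs_mul, abs_mul, abs_of_pos h0, abs_of_nonpos (show 1 - 4 * u ≤ 0 by linarith), pow_succ]
    calc _ = S * |t| * (8 * u - 1) := by ring
      _ ≤ S * |t| * 3 := by
          apply mul_le_mul_of_nonneg_left _ (by positivity); linarith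
      _ = _ := by rw [hSd]; ring

/-- Suzuki's product formula has order `2k` with an explicit error constant. -/
theorem norm_suzuki_sub_exp_le [CompleteSpace 𝔸] [NormOneClass 𝔸] (Y : Fin 4 → 𝔸) (k : ℕ) (t : ℝ)
    (ht : 3 ^ k * (∑ j, ‖Y j‖) * |t| ≤ 1) :
    ‖suzuki (fun j s => NormedSpace.exp ((s : ℂ) • Y j)) (k + 1) t
        - NormedSpace.exp ((t : ℂ) • ∑ j, Y j)‖
      ≤ 6 * (3 ^ k * (∑ j, ‖Y j‖) * |t|) ^ (2 * k + 3) := by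
  set τ := 3 ^ k * (∑ j, ‖Y j‖) * |t| with hτ
  have h1 := expMajorized_suzuki Y k t
  have h2 : ExpMajorized (expPowerSeries (∑ j, Y j) t) (NormedSpace.exp ((t : ℂ) • ∑ j, Y j)) τ := by
    refine (expMajorized_expPowerSeries (∑ j, Y j) t).mono ?_
    have : ‖∑ j, Y j‖ ≤ 3 ^ k * ∑ j, ‖Y j‖ :=
      (norm_sum_le _ _).trans (le_mul_of_one_le_left (by positivity)
        (one_le_pow₀ (by norm_num)))
    rw [hτ]; gcongr
  obtain ⟨d, hd⟩ := agreeBelow_suzuki Y k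
  have hd := hd.dilate t
  rw [dilate_suzuki, dilate_expPowerSeries, mul_one] at hd
  have hs := h1.hasSum.sub h2.hasSum
  have h0 := h1.nonneg
  -- The two expansions agree below degree `2k+3`, so the difference of the operators is a
  -- difference of tails.
  have hz : ∑ i ∈ Finset.range (2 * k + 3),
      (coeff i (suzuki (fun j => expPowerSeries (Y j)) (k + 1) t)
        - coeff i (expPowerSeries (∑ j, Y j) t)) = 0 :=
    Finset.sum_eq_zero fun i hi => by rw [hd.below i (Finset.mem_range.1 hi), sub_self]
  rw [← hasSum_nat_add_iff' (2 * k + 3), hz, sub_zero] at hs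
  have hg : HasSum (fun n : ℕ => 2 * τ ^ (2 * k + 3) * (n.factorial : ℝ)⁻¹)
      (2 * τ ^ (2 * k + 3) * Real.exp 1) := by
    refine HasSum.mul_left _ ?_
    have := NormedSpace.exp_series_hasSum_exp' (𝕂 := ℝ) (1 : ℝ)
    simpa [Real.exp_eq_exp_ℝ] using this
  calc _ ≤ 2 * τ ^ (2 * k + 3) * Real.exp 1 := by
        refine hs.norm_le_of_bounded hg fun n => ?_
        have e1 := h1.norm_coeff_le (n + (2 * k + 3))
        have e2 := h2.norm_coeff_le (n + (2 * k + 3))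
        -- With `τ ≤ 1`, the surplus power `τ^n` is dropped and the larger factorial replaced by
        -- `n!`. The remaining sum is `e ≤ 3`, and the two tails together give the constant `6`.
        have e3 : τ ^ (n + (2 * k + 3)) * (((n + (2 * k + 3)).factorial : ℕ) : ℝ)⁻¹
            ≤ τ ^ (2 * k + 3) * (n.factorial : ℝ)⁻¹ := by
          have f : (n.factorial : ℝ) ≤ ((n + (2 * k + 3)).factorial : ℕ) := by
            exact_mod_cast Nat.factorial_le (by omega)
          have := pow_le_one₀ (n := n) h0 ht
          rw [pow_add]
          have f0 : (0 : ℝ) < n.factorial := by positivity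
          gcongr
          exact mul_le_of_le_one_left (by positivity) this
        refine (norm_sub_le _ _).trans ?_
        linarith
    _ ≤ 2 * τ ^ (2 * k + 3) * 3 := by
        gcongr
        exact Real.exp_one_lt_d9.le.trans (by norm_num)
    _ = _ := by ring

end FormalSeries

/-! ## Exact synthesis of unitaries on the register -/

section Synthesis

open Matrix

variable {q : ℕ}

theorem diagonal_exp_mem_unitary {n : Type} [Fintype n] [DecidableEq n] (f : n → ℝ) :
    diagonal (fun b => exp (I * (f b : ℂ))) ∈ unitaryGroup n ℂ := by
  rw [mem_unitaryGroup_iff, star_eq_conjTranspose, diagonal_conjTranspose, diagonal_mul_diagonal,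
    ← diagonal_one]
  congr 1
  ext b
  rw [Pi.star_apply, RCLike.star_def, ← Complex.exp_conj, ← Complex.exp_add]
  simp

/-- The adjoint gate. -/
def Gate.adj : Gate q → Gate q
  | .one i U => .one i U⁻¹
  | .two i j h U => .two i j h U⁻¹

theorem Gate.matrix_adj (g : Gate q) : g.adj.matrix = g.matrixᴴ := by
  cases g with
  | one i U =>
    ext b b'
    rw [conjTranspose_apply]
    simp only [Gate.adj, Gate.matrix, eq_comm (a := b _)]
    rw [apply_ite star, star_zero]
    rfl
  | two i j h U =>
    ext b b'
    rw [conjTranspose_apply]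
    simp only [Gate.adj, Gate.matrix, eq_comm (a := b _)]
    rw [apply_ite star, star_zero]
    rfl

/-- Reverse the word and take the adjoint of each gate. -/
theorem exists_adjoint_circuit (c : Circuit q) :
    ∃ c' : Circuit q, circuitMatrix c' = (circuitMatrix c)ᴴ ∧ c'.length = c.length := by
  induction c using FreeMonoid.inductionOn' with
  | one => exact ⟨1, by simp [circuitMatrix], rfl⟩
  | of_mul g c ih =>
    obtain ⟨c', h, hl⟩ := ih
    refine ⟨c' * FreeMonoid.of g.adj, ?_, ?_⟩
    · simp only [circuitMatrix, map_mul, FreeMonoid.lift_eval_of, conjTranspose_mul,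
        Gate.matrix_adj] at h ⊢
      rw [h]
    · simp only [FreeMonoid.length_mul, FreeMonoid.length_of, hl]
      omega

/-- `M` is a unitary matrix realized exactly by a circuit of at most `L` gates. -/
def Implementable (L : ℕ) (M : Matrix (Reg q) (Reg q) ℂ) : Prop :=
  M ∈ unitaryGroup (Reg q) ℂ ∧ ∃ c : Circuit q, circuitMatrix c = M ∧ c.length ≤ L

theorem Implementable.mono {L L' : ℕ} {M : Matrix (Reg q) (Reg q) ℂ} (h : Implementable L M)
    (hL : L ≤ L') : Implementable L' M :=
  ⟨h.1, h.2.imp fun _ hc => ⟨hc.1, hc.2.trans hL⟩⟩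

theorem Implementable.mul {L L' : ℕ} {M M' : Matrix (Reg q) (Reg q) ℂ} (h : Implementable L M)
    (h' : Implementable L' M') : Implementable (L + L') (M * M') := by
  obtain ⟨hu, c, hc, hl⟩ := h
  obtain ⟨hu', c', hc', hl'⟩ := h'
  refine ⟨mul_mem hu hu', c * c', ?_, ?_⟩
  · rw [← hc, ← hc', circuitMatrix, map_mul]; rfl
  · rw [FreeMonoid.length_mul]; omega

theorem implementable_one : Implementable 0 (1 : Matrix (Reg q) (Reg q) ℂ) :=
  ⟨one_mem _, 1, by simp [circuitMatrix], le_rfl⟩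

theorem Implementable.conjTranspose {L : ℕ} {M : Matrix (Reg q) (Reg q) ℂ}
    (h : Implementable L M) : Implementable L Mᴴ := by
  obtain ⟨hu, c, hc, hl⟩ := h
  obtain ⟨c', hc', hl'⟩ := exists_adjoint_circuit c
  exact ⟨Unitary.star_mem hu, c', by rw [hc', hc], hl'.le.trans hl⟩

theorem implementable_gate (g : Gate q) (h : g.matrix ∈ unitaryGroup (Reg q) ℂ) :
    Implementable 1 g.matrix :=
  ⟨h, FreeMonoid.of g, by simp [circuitMatrix], le_rfl⟩

/-! ### One-qubit operations controlled by the rest of the register -/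

/-- The agreement of two basis labels away from the qubit `i`. -/
theorem agree_off_iff (i : Qubit q) (b b' : Reg q) :
    (∀ l, l ≠ i → b l = b' l) ↔ b' = Function.update b i (b' i) := by
  constructor
  · intro h
    ext l
    by_cases hl : l = i
    · subst hl; simp
    · simp [hl, h l hl]
  · intro h l hl
    rw [h]; simp [hl]

open Classical in
/-- The one-qubit matrix `u b` applied to the qubit `i`, controlled by the other qubits. -/
def controlled (i : Qubit q) (u : Reg q → Matrix (Fin 2) (Fin 2) ℂ) :
    Matrix (Reg q) (Reg q) ℂ :=
  fun b b' => if ∀ l, l ≠ i → b l = b' l then u b (b i) (b' i) else 0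

open Classical in
theorem sum_agree_off (i : Qubit q) (b : Reg q) (F : Reg q → ℂ) :
    (∑ b', if ∀ l, l ≠ i → b l = b' l then F b' else 0)
      = ∑ s, F (Function.update b i s) := by
  rw [← Finset.sum_filter]
  symm
  refine Finset.sum_bij (fun s _ => Function.update b i s) ?_ ?_ ?_ ?_
  · intro s _
    simp only [Finset.mem_filter, Finset.mem_univ, true_and]
    intro l hl
    simp [hl]
  · intro s _ s' _ h
    simpa using congrFun h i
  · intro b' hb'
    simp only [Finset.mem_filter, Finset.mem_univ, true_and] at hb'
    exact ⟨b' i, Finset.mem_univ _, ((agree_off_iff i b b').1 hb').symm⟩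
  · simp

theorem controlled_mulVec (i : Qubit q) (u : Reg q → Matrix (Fin 2) (Fin 2) ℂ) (v : Reg q → ℂ)
    (b : Reg q) : (controlled i u *ᵥ v) b = ∑ s, u b (b i) s * v (Function.update b i s) := by
  simp only [mulVec, dotProduct, controlled, ite_mul, zero_mul]
  rw [sum_agree_off i b (fun b' => u b (b i) (b' i) * v b')]
  simp

/-- The matrix `u'` has to ignore the qubit `i`, since in the product the right factor is read at
labels in which this qubit has been replaced. -/
theorem controlled_mul (i : Qubit q) (u u' : Reg q → Matrix (Fin 2) (Fin 2) ℂ)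
    (h : ∀ b s, u' (Function.update b i s) = u' b) :
    controlled i u * controlled i u' = controlled i (fun b => u b * u' b) := by
  classical
  ext b b''
  simp only [Matrix.mul_apply, controlled, ite_mul, zero_mul]
  rw [sum_agree_off i b
    (fun b' => u b (b i) (b' i) * if ∀ l, l ≠ i → b' l = b'' l then u' b' (b' i) (b'' i) else 0)]
  have : ∀ s, (∀ l, l ≠ i → Function.update b i s l = b'' l) ↔ ∀ l, l ≠ i → b l = b'' l := by
    intro s
    refine forall₂_congr fun l hl => ?_
    simp [hl]
  simp only [this, h, Function.update_self]
  split_ifs <;> simp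

theorem one_matrix_eq_controlled (i : Qubit q) (U : unitaryGroup (Fin 2) ℂ) :
    (Gate.one i U).matrix = controlled i (fun _ => U) := rfl

theorem controlled_diagonal (i : Qubit q) (u : Reg q → Fin 2 → ℂ) :
    controlled i (fun b => diagonal (u b)) = diagonal (fun b => u b (b i)) := by
  ext b b'
  simp only [controlled, diagonal_apply]
  by_cases h : b = b'
  · subst h; simp
  · rw [if_neg h]
    split_ifs with h1 h2
    · exfalso
      apply h
      rw [(agree_off_iff i b b').1 h1, ← h2]
      simp
    · rfl
    · rfl

theorem one_matrix_mem_unitary (i : Qubit q) (U : unitaryGroup (Fin 2) ℂ) :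
    (Gate.one i U).matrix ∈ unitaryGroup (Reg q) ℂ := by
  rw [mem_unitaryGroup_iff, star_eq_conjTranspose, ← Gate.matrix_adj, Gate.adj,
    one_matrix_eq_controlled, one_matrix_eq_controlled, controlled_mul _ _ _ (fun _ _ => rfl)]
  have : (U : Matrix (Fin 2) (Fin 2) ℂ) * ((U⁻¹ : unitaryGroup (Fin 2) ℂ) : Matrix _ _ ℂ) = 1 := by
    simp
  simp only [this]
  rw [← diagonal_one, controlled_diagonal, diagonal_one]

/-! ### Diagonal unitaries from Walsh functions -/

/-- The diagonal unitary with phases `f`. -/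
def phaseMatrix (f : Reg q → ℝ) : Matrix (Reg q) (Reg q) ℂ :=
  diagonal fun b => exp (I * (f b : ℂ))

theorem phaseMatrix_add (f g : Reg q → ℝ) :
    phaseMatrix (f + g) = phaseMatrix f * phaseMatrix g := by
  simp only [phaseMatrix, diagonal_mul_diagonal, Pi.add_apply, Complex.ofReal_add, mul_add,
    Complex.exp_add]

theorem phaseMatrix_zero : phaseMatrix (0 : Reg q → ℝ) = 1 := by
  simp [phaseMatrix]

theorem phaseMatrix_mem_unitary (f : Reg q → ℝ) : phaseMatrix f ∈ unitaryGroup (Reg q) ℂ :=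
  diagonal_exp_mem_unitary f

theorem implementable_phase_of_qubit (i : Qubit q) (f : Fin 2 → ℝ) :
    Implementable 1 (phaseMatrix fun b : Reg q => f (b i)) := by
  have h := implementable_gate (Gate.one i ⟨_, diagonal_exp_mem_unitary f⟩)
    (one_matrix_mem_unitary i _)
  rw [one_matrix_eq_controlled, controlled_diagonal] at h
  exact h

/-- The controlled-not gate with target the first factor and control the second. -/
def cnot : Matrix (Fin 2 × Fin 2) (Fin 2 × Fin 2) ℂ :=
  fun x y => if x = (y.1 + y.2, y.2) then 1 else 0

theorem cnot_mem_unitary : cnot ∈ unitaryGroup (Fin 2 × Fin 2) ℂ := by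
  rw [mem_unitaryGroup_iff]
  ext ⟨a, b⟩ ⟨c, d⟩
  fin_cases a <;> fin_cases b <;> fin_cases c <;> fin_cases d <;>
    simp [cnot, Matrix.mul_apply, Fintype.sum_prod_type]

/-- The action of the controlled-not gate on basis labels. -/
def cnotLabel (i j : Qubit q) (b : Reg q) : Reg q := Function.update b i (b i + b j)

theorem cnotLabel_cnotLabel {i j : Qubit q} (h : i ≠ j) (b : Reg q) :
    cnotLabel i j (cnotLabel i j b) = b := by
  have : ∀ x y : Fin 2, x + y + y = x := by decide
  ext l
  by_cases hl : l = i
  · subst hl; simp [cnotLabel, h.symm, this]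
  · simp [cnotLabel, hl]

theorem cnot_matrix_apply {i j : Qubit q} (h : i ≠ j) (b b' : Reg q) :
    (Gate.two i j h ⟨cnot, cnot_mem_unitary⟩).matrix b b'
      = if b' = cnotLabel i j b then 1 else 0 := by
  have key : (∀ l, l ≠ i → l ≠ j → b l = b' l) ∧ (b i, b j) = (b' i + b' j, b' j)
      ↔ b' = cnotLabel i j b := by
    have h2 : ∀ x y z : Fin 2, x = z + y ↔ z = x + y := by decide
    constructor
    · rintro ⟨h1, h3⟩
      rw [Prod.mk.injEq] at h3
      funext l
      by_cases hl : l = i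
      · subst hl
        simp only [cnotLabel, Function.update_self]
        rw [h3.2, ← h2]; exact h3.1
      · simp only [cnotLabel, ne_eq, hl, not_false_eq_true, Function.update_of_ne]
        by_cases hj : l = j
        · subst hj; exact h3.2.symm
        · exact (h1 l hl hj).symm
    · rintro rfl
      refine ⟨fun l hl _ => by simp [cnotLabel, hl], ?_⟩
      simp [cnotLabel, h.symm, ← h2]
  simp only [Gate.matrix, cnot]
  rw [← ite_and]
  simp only [key]

/-- A controlled-not permutes the basis labels by an involution, and conjugation by a permutation
relabels the diagonal entries. -/
theorem cnot_conj_diagonal {i j : Qubit q} (h : i ≠ j) (d : Reg q → ℂ) :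
    (Gate.two i j h ⟨cnot, cnot_mem_unitary⟩).matrix * diagonal d
      * (Gate.two i j h ⟨cnot, cnot_mem_unitary⟩).matrix
      = diagonal fun b => d (cnotLabel i j b) := by
  ext b b'
  rw [Matrix.mul_apply]
  simp only [Matrix.mul_diagonal, cnot_matrix_apply, diagonal_apply]
  rw [Finset.sum_eq_single (cnotLabel i j b) (fun x _ hx => by simp [hx]) (by simp)]
  simp only [if_true, one_mul, cnotLabel_cnotLabel h, mul_ite, mul_one, mul_zero, eq_comm (a := b')]

theorem cnot_matrix_mem_unitary {i j : Qubit q} (h : i ≠ j) :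
    (Gate.two i j h ⟨cnot, cnot_mem_unitary⟩).matrix ∈ unitaryGroup (Reg q) ℂ := by
  have hs : star (Gate.two i j h ⟨cnot, cnot_mem_unitary⟩).matrix
      = (Gate.two i j h ⟨cnot, cnot_mem_unitary⟩).matrix := by
    ext b b'
    rw [star_apply, cnot_matrix_apply, cnot_matrix_apply]
    have : b = cnotLabel i j b' ↔ b' = cnotLabel i j b := by
      constructor <;> (rintro rfl; rw [cnotLabel_cnotLabel h])
    simp only [this, apply_ite star, star_one, star_zero]
  rw [mem_unitaryGroup_iff, hs]
  simpa using cnot_conj_diagonal h (fun _ => 1)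

/-- The Walsh function of a set of qubits. -/
def walsh (S : Finset (Qubit q)) (b : Reg q) : ℝ := ∏ i ∈ S, (-1 : ℝ) ^ (b i : ℕ)

/-- A Walsh function is the sign of a parity. Controlled-nots gather the parity of the set in one
target qubit, a one-qubit gate applies the phase there, and the same controlled-nots undo the
computation: two gates for each further qubit. -/
theorem implementable_walsh (a : ℝ) (S : Finset (Qubit q)) :
    Implementable (2 * S.card + 1) (phaseMatrix fun b => a * walsh S b) := by
  rcases S.eq_empty_or_nonempty with rfl | ⟨i, hi⟩
  -- The empty set gives a global phase. It is charged to a spinor qubit, which exists even when `q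
  -- = 0`.
  · simpa [walsh] using implementable_phase_of_qubit (Sum.inl 0 : Qubit q) (fun _ => a)
  · obtain ⟨S, hiS, rfl⟩ : ∃ S', i ∉ S' ∧ S = insert i S' :=
      ⟨S.erase i, Finset.notMem_erase i S, (Finset.insert_erase hi).symm⟩
    clear hi
    induction S using Finset.induction_on with
    | empty =>
      refine Implementable.mono (L := 1) ?_ (by simp)
      simpa [walsh] using implementable_phase_of_qubit i (fun s => a * (-1) ^ (s : ℕ))
    | insert j S hj ih =>
      rw [Finset.mem_insert, not_or] at hiS
      obtain ⟨hij, hiS⟩ := hiS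
      have hg := implementable_gate _ (cnot_matrix_mem_unitary hij)
      have h := (hg.mul (ih hiS)).mul hg
      rw [phaseMatrix, cnot_conj_diagonal] at h
      have e : (fun b : Reg q => a * walsh (insert i (insert j S)) b)
          = fun b => a * walsh (insert i S) (cnotLabel i j b) := by
        funext b
        have hsgn : ∀ x y : Fin 2, (-1 : ℝ) ^ ((x + y : Fin 2) : ℕ)
            = (-1) ^ (x : ℕ) * (-1) ^ (y : ℕ) := by
          intro x y; fin_cases x <;> fin_cases y <;> simp
        have h1 : ∏ l ∈ S, (-1 : ℝ) ^ (cnotLabel i j b l : ℕ) = ∏ l ∈ S, (-1 : ℝ) ^ (b l : ℕ) := by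
          refine Finset.prod_congr rfl fun l hl => ?_
          have : l ≠ i := fun h => hiS (h ▸ hl)
          simp [cnotLabel, this]
        have h2 : cnotLabel i j b i = b i + b j := by simp [cnotLabel]
        rw [walsh, walsh, Finset.prod_insert (by simp [hij, hiS]), Finset.prod_insert hj,
          Finset.prod_insert hiS, h1, h2, hsgn]
        ring
      rw [e]
      refine h.mono ?_
      have hi' : i ∉ insert j S := by simp [hij, hiS]
      rw [Finset.card_insert_of_notMem hi', Finset.card_insert_of_notMem hiS,
        Finset.card_insert_of_notMem hj]
      omega

/-- Expanding `∏ᵢ (1 + (-1)^{bᵢ} (-1)^{cᵢ})` over subsets gives the sum; a factor vanishes as soon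
as two bits differ. This is the inversion formula for the Walsh transform. -/
theorem prod_walsh_eq_indicator (b c : Reg q) :
    ∑ S : Finset (Qubit q), walsh S b * walsh S c
      = if b = c then (2 : ℝ) ^ Fintype.card (Qubit q) else 0 := by
  have h : ∑ S : Finset (Qubit q), walsh S b * walsh S c
      = ∏ i : Qubit q, (1 + (-1 : ℝ) ^ (b i : ℕ) * (-1) ^ (c i : ℕ)) := by
    rw [Finset.prod_one_add, Finset.powerset_univ]
    simp only [walsh, Finset.prod_mul_distrib]
  rw [h]
  have h2 : ∀ x y : Fin 2, (1 + (-1 : ℝ) ^ (x : ℕ) * (-1) ^ (y : ℕ)) = if x = y then 2 else 0 := by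
    intro x y; fin_cases x <;> fin_cases y <;> norm_num
  simp only [h2]
  split_ifs with hbc
  · subst hbc; simp
  · obtain ⟨i, hi⟩ := Function.ne_iff.1 hbc
    exact Finset.prod_eq_zero (Finset.mem_univ i) (if_neg hi)

/-- The number of gates used for a diagonal unitary. -/
def phaseCost (q : ℕ) : ℕ := 2 ^ Fintype.card (Qubit q) * (2 * Fintype.card (Qubit q) + 1)

/-- Phase functions add when diagonal unitaries are multiplied, so the Walsh expansion of `f`
factors the unitary into one circuit for each subset of qubits. -/
theorem implementable_phaseMatrix (f : Reg q → ℝ) :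
    Implementable (phaseCost q) (phaseMatrix f) := by
  set Q := Fintype.card (Qubit q) with hQ
  let a : Finset (Qubit q) → ℝ := fun S => (2 ^ Q)⁻¹ * ∑ c, f c * walsh S c
  have hf : f = ∑ S : Finset (Qubit q), fun b => a S * walsh S b := by
    funext b
    rw [Finset.sum_apply]
    simp only [a, mul_assoc, Finset.sum_mul]
    rw [← Finset.mul_sum, Finset.sum_comm]
    simp only [mul_comm (walsh _ _) (walsh _ _), ← Finset.mul_sum, prod_walsh_eq_indicator]
    simp only [mul_ite, mul_zero, Finset.sum_ite_eq, Finset.mem_univ, if_true, ← hQ]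
    field_simp
  have key : ∀ T : Finset (Finset (Qubit q)), Implementable (T.card * (2 * Q + 1))
      (phaseMatrix (∑ S ∈ T, fun b => a S * walsh S b)) := by
    intro T
    induction T using Finset.induction_on with
    | empty => simpa [phaseMatrix_zero] using implementable_one
    | insert S T hS ih =>
      rw [Finset.sum_insert hS, phaseMatrix_add, Finset.card_insert_of_notMem hS]
      refine ((implementable_walsh (a S) S).mul ih).mono ?_
      have : S.card ≤ Q := Finset.card_le_univ S
      nlinarith
  rw [hf]
  refine (key Finset.univ).mono ?_
  rw [Finset.card_univ, Fintype.card_finset, phaseCost]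

/-! ### Plane rotations and state preparation -/

/-- The change of basis that diagonalizes plane rotations. -/
def rotBasis : Matrix (Fin 2) (Fin 2) ℂ := (((Real.sqrt 2)⁻¹ : ℝ) : ℂ) • !![1, 1; I, -I]

theorem rotBasis_conj_diagonal (x y : ℂ) :
    rotBasis * diagonal ![x, y] * rotBasisᴴ
      = (1 / 2 : ℂ) • !![x + y, -(I * (x - y)); I * (x - y), x + y] := by
  have h : (((Real.sqrt 2)⁻¹ : ℝ) : ℂ) * (((Real.sqrt 2)⁻¹ : ℝ) : ℂ) = 1 / 2 := by
    rw [← Complex.ofReal_mul, ← mul_inv, Real.mul_self_sqrt (by norm_num)]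
    norm_num
  rw [rotBasis, conjTranspose_smul, smul_mul_assoc, smul_mul_assoc, mul_smul_comm, smul_smul,
    RCLike.star_def, Complex.conj_ofReal, h]
  congr 1
  ext i j
  simp only [Matrix.mul_apply, Fin.sum_univ_two, conjTranspose_apply]
  fin_cases i <;> fin_cases j <;> simp <;>
    first | ring1 | linear_combination (-x - y) * I_mul_I

theorem rotBasis_mem_unitary : rotBasis ∈ unitaryGroup (Fin 2) ℂ := by
  rw [mem_unitaryGroup_iff, star_eq_conjTranspose]
  have := rotBasis_conj_diagonal 1 1
  have h1 : diagonal ![(1 : ℂ), 1] = 1 := by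
    ext i j; fin_cases i <;> fin_cases j <;> simp
  rw [h1, mul_one] at this
  rw [this]
  ext i j; fin_cases i <;> fin_cases j <;> norm_num

/-- The rotation of the plane by the angle `-θ`. -/
def planeRot (θ : ℝ) : Matrix (Fin 2) (Fin 2) ℂ :=
  !![(Real.cos θ : ℂ), (Real.sin θ : ℂ); -(Real.sin θ : ℂ), (Real.cos θ : ℂ)]

theorem planeRot_eq (θ : ℝ) :
    planeRot θ = rotBasis * diagonal (fun s : Fin 2 => exp (I * ((θ * (-1) ^ (s : ℕ) : ℝ) : ℂ)))
      * rotBasisᴴ := by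
  have h1 : (fun s : Fin 2 => exp (I * ((θ * (-1) ^ (s : ℕ) : ℝ) : ℂ)))
      = ![exp (θ * I), exp (-θ * I)] := by
    funext s; fin_cases s <;> simp [mul_comm]
  rw [h1, rotBasis_conj_diagonal, planeRot, Complex.ofReal_cos, Complex.ofReal_sin, Complex.cos,
    Complex.sin]
  ext i j; fin_cases i <;> fin_cases j <;> simp <;> ring

/-- All plane rotations share the eigenvectors `(1, ±i)/√2`. One fixed gate on the qubit `i` and its
adjoint therefore turn the controlled rotation into a diagonal unitary. -/
theorem implementable_controlled_planeRot (i : Qubit q) (θ : Reg q → ℝ)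
    (hθ : ∀ b s, θ (Function.update b i s) = θ b) :
    Implementable (phaseCost q + 2) (controlled i fun b => planeRot (θ b)) := by
  have hg := implementable_gate _ (one_matrix_mem_unitary i ⟨_, rotBasis_mem_unitary⟩)
  have h := (hg.mul (implementable_phaseMatrix (fun b => θ b * (-1) ^ (b i : ℕ)))).mul
    hg.conjTranspose
  rw [← Gate.matrix_adj, Gate.adj, one_matrix_eq_controlled, one_matrix_eq_controlled, phaseMatrix,
    ← controlled_diagonal i (fun b s => exp (I * ((θ b * (-1) ^ (s : ℕ) : ℝ) : ℂ))),
    controlled_mul _ _ _ (fun b s => by simp only [hθ]), controlled_mul _ _ _ (fun _ _ => rfl)] at h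
  simp only [planeRot_eq]
  exact h.mono (by omega)

theorem cos_arg_mul_add (x y : ℝ) :
    Real.cos (arg ⟨x, y⟩) * x + Real.sin (arg ⟨x, y⟩) * y = Real.sqrt (x ^ 2 + y ^ 2) ∧
      -Real.sin (arg ⟨x, y⟩) * x + Real.cos (arg ⟨x, y⟩) * y = 0 := by
  have hx := Complex.norm_mul_cos_arg ⟨x, y⟩
  have hy := Complex.norm_mul_sin_arg ⟨x, y⟩
  have hn : ‖(⟨x, y⟩ : ℂ)‖ = Real.sqrt (x ^ 2 + y ^ 2) := by
    rw [Complex.norm_def, Complex.normSq_mk, pow_two, pow_two]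
  rw [← hn]
  simp only at hx hy
  generalize arg ⟨x, y⟩ = θ at *
  generalize ‖(⟨x, y⟩ : ℂ)‖ = r at *
  subst hx hy
  have := Real.sin_sq_add_cos_sq θ
  constructor
  · linear_combination r * this
  · ring

/-- The number of gates used to map a vector to a multiple of a basis vector. -/
def prepCost (q : ℕ) : ℕ := phaseCost q + Fintype.card (Qubit q) * (phaseCost q + 2)

theorem exists_implementable_nonneg (v : Reg q → ℂ) :
    ∃ M : Matrix (Reg q) (Reg q) ℂ, Implementable (phaseCost q) M ∧
      M *ᵥ v = fun b => ((‖v b‖ : ℝ) : ℂ) := by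
  refine ⟨_, implementable_phaseMatrix (fun b => -arg (v b)), ?_⟩
  funext b
  rw [phaseMatrix, mulVec_diagonal]
  have h := Complex.norm_mul_exp_arg_mul_I (v b)
  generalize arg (v b) = θ at *
  rw [← h, mul_left_comm, ← Complex.exp_add]
  simp [mul_comm]

/-- Removing phases makes the amplitudes real and nonnegative. For each qubit, a rotation whose
angle is controlled by the other qubits then sends every pair `(x, y)` to `(√(x² + y²), 0)`,
confining the support to labels where that qubit is `0` without enlarging it in the qubits already
treated. -/
theorem exists_implementable_support (v : Reg q → ℂ) (S : Finset (Qubit q)) :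
    ∃ (M : Matrix (Reg q) (Reg q) ℂ) (w : Reg q → ℝ),
      Implementable (phaseCost q + S.card * (phaseCost q + 2)) M ∧
      M *ᵥ v = (fun b => (w b : ℂ)) ∧ ∀ b, w b ≠ 0 → ∀ i ∈ S, b i = 0 := by
  induction S using Finset.induction_on with
  | empty =>
    obtain ⟨M, hM, h⟩ := exists_implementable_nonneg v
    exact ⟨M, _, by simpa using hM, h, by simp⟩
  | insert i S hi ih =>
    obtain ⟨M, w, hM, hw, hS⟩ := ih
    let θ : Reg q → ℝ := fun b =>
      arg ⟨w (Function.update b i 0), w (Function.update b i 1)⟩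
    have hR := implementable_controlled_planeRot i θ (fun b s => by simp [θ])
    refine ⟨_, fun b => if b i = 0 then
      Real.sqrt (w (Function.update b i 0) ^ 2 + w (Function.update b i 1) ^ 2) else 0,
      (hR.mul hM).mono ?_, ?_, ?_⟩
    · rw [Finset.card_insert_of_notMem hi]
      ring_nf; omega
    · rw [← mulVec_mulVec, hw]
      funext b
      rw [controlled_mulVec, Fin.sum_univ_two]
      obtain ⟨h1, h2⟩ := cos_arg_mul_add (w (Function.update b i 0)) (w (Function.update b i 1))
      rcases Fin.exists_fin_two.1 ⟨b i, rfl⟩ with hb | hb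
      · simp only [hb, if_true, ← h1]
        simp [planeRot, θ]
      · simp only [hb, one_ne_zero, if_false, ← h2]
        simp [planeRot, θ]
    · intro b hb l hl
      by_cases hbi : b i = 0
      · rcases Finset.mem_insert.1 hl with rfl | hl
        · exact hbi
        · have hli : l ≠ i := fun h => hi (h ▸ hl)
          simp only [hbi, if_true] at hb
          by_contra hbl
          apply hb
          have : ∀ s, w (Function.update b i s) = 0 := fun s => by
            by_contra h
            have := hS _ h l hl
            rw [Function.update_of_ne hli] at this
            exact hbl this
          simp [this]
      · simp [hbi] at hb

theorem exists_implementable_prep (v : Reg q → ℂ) :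
    ∃ (M : Matrix (Reg q) (Reg q) ℂ) (c : ℂ), Implementable (prepCost q) M ∧
      M *ᵥ v = Pi.single 0 c := by
  obtain ⟨M, w, hM, hw, hS⟩ := exists_implementable_support v Finset.univ
  refine ⟨M, w 0, hM, ?_⟩
  rw [hw]
  funext b
  by_cases hb : b = 0
  · subst hb; simp
  · rw [Pi.single_eq_of_ne hb]
    by_contra h
    exact hb (funext fun i => hS b (by exact_mod_cast h) i (Finset.mem_univ i))

/-- The preparation `M` sends `v` to a unimodular multiple of the basis vector `0`. Conjugating by
`M` the diagonal unitary that puts the phase `θ` on this vector alone puts the phase on `v` alone.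
-/
theorem implementable_rankOne (v : Reg q → ℂ) (hv : star v ⬝ᵥ v = 1) (θ : ℝ) :
    Implementable (2 * prepCost q + phaseCost q)
      (1 + (exp (I * (θ : ℂ)) - 1) • vecMulVec v (star v)) := by
  obtain ⟨M, c, hM, hMv⟩ := exists_implementable_prep v
  have hMM : Mᴴ * M = 1 := (mem_unitaryGroup_iff').1 hM.1
  have hc : c * star c = 1 := by
    have h1 : star (M *ᵥ v) ⬝ᵥ (M *ᵥ v) = 1 := by
      rw [star_mulVec, ← dotProduct_mulVec, mulVec_mulVec, hMM, one_mulVec, hv]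
    rw [hMv] at h1
    simp only [dotProduct, Pi.star_apply] at h1
    rw [Finset.sum_eq_single 0 (by intro b _ hb; simp [hb]) (by simp)] at h1
    simpa [mul_comm] using h1
  have h := (hM.conjTranspose.mul
    (implementable_phaseMatrix (fun b : Reg q => if b = 0 then θ else 0))).mul hM
  have hD : phaseMatrix (fun b : Reg q => if b = 0 then θ else 0)
      = 1 + (exp (I * (θ : ℂ)) - 1) • vecMulVec (M *ᵥ v) (star (M *ᵥ v)) := by
    rw [hMv]
    ext b b'
    simp only [phaseMatrix, diagonal_apply, Matrix.add_apply, Matrix.one_apply, Matrix.smul_apply,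
      vecMulVec_apply, Pi.star_apply, Pi.single_apply, apply_ite star, star_zero, smul_eq_mul]
    by_cases h0 : b = 0
    · subst h0
      by_cases h1 : b' = 0
      · subst h1; simp only [if_true, hc]; ring
      · simp [h1, Ne.symm h1]
    · by_cases h1 : b = b'
      · subst h1; simp [h0]
      · simp [h0, h1]
  have e : Mᴴ * phaseMatrix (fun b : Reg q => if b = 0 then θ else 0) * M
      = 1 + (exp (I * (θ : ℂ)) - 1) • vecMulVec v (star v) := by
    rw [hD, mul_add, add_mul, mul_one, hMM, mul_smul_comm, smul_mul_assoc, star_mulVec,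
      mul_vecMulVec, vecMulVec_mul, mulVec_mulVec, vecMul_vecMul, hMM, one_mulVec, vecMul_one]
  rw [← e]
  exact h.mono (by omega)

/-! ### Synthesis of evolutions from the spectral decomposition -/

theorem propagator_eq_conj {H : Matrix (Reg q) (Reg q) ℂ} (hH : H.IsHermitian) (s : ℝ) :
    propagator H s = (hH.eigenvectorUnitary : Matrix (Reg q) (Reg q) ℂ)
      * phaseMatrix (fun b => -s * hH.eigenvalues b)
      * (hH.eigenvectorUnitary : Matrix (Reg q) (Reg q) ℂ)ᴴ := by
  have hV := mem_unitaryGroup_iff.1 hH.eigenvectorUnitary.2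
  rw [star_eq_conjTranspose] at hV
  have h := hH.spectral_theorem
  rw [Unitary.conjStarAlgAut_apply, star_eq_conjTranspose] at h
  set V := (hH.eigenvectorUnitary : Matrix (Reg q) (Reg q) ℂ)
  rw [← inv_eq_right_inv hV] at h ⊢
  rw [propagator]
  conv_lhs => rw [h]
  rw [← smul_mul_assoc, ← mul_smul_comm, exp_conj _ _ (IsUnit.of_mul_eq_one _ hV), ← diagonal_smul,
    exp_diagonal, phaseMatrix]
  congr 3
  funext b
  rw [Pi.coe_exp, ← Complex.exp_eq_exp_ℂ]
  simp
  ring_nf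

theorem propagator_mem_unitary {H : Matrix (Reg q) (Reg q) ℂ} (hH : H.IsHermitian) (s : ℝ) :
    propagator H s ∈ unitaryGroup (Reg q) ℂ := by
  rw [propagator_eq_conj hH]
  exact mul_mem (mul_mem hH.eigenvectorUnitary.2 (phaseMatrix_mem_unitary _))
    (Unitary.star_mem hH.eigenvectorUnitary.2)

theorem card_reg : Fintype.card (Reg q) = 4 * (2 ^ q) ^ 3 := by
  simp only [Fintype.card_pi, Fintype.card_fin, Finset.prod_const, Finset.card_univ,
    Fintype.card_sum, Fintype.card_prod, pow_add, ← pow_mul]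
  rw [mul_comm 3 q]; norm_num

theorem card_reg_eq_two_pow : Fintype.card (Reg q) = 2 ^ Fintype.card (Qubit q) := by
  simp only [Fintype.card_pi, Fintype.card_fin, Finset.prod_const, Finset.card_univ]

/-- Evolutions generated by Hermitian matrices have exact circuits of polynomial size in the
dimension. -/
theorem implementable_propagator {H : Matrix (Reg q) (Reg q) ℂ} (hH : H.IsHermitian) (s : ℝ) :
    Implementable (19 * (4 * (2 ^ q) ^ 3) ^ 4) (propagator H s) := by
  set V := (hH.eigenvectorUnitary : Matrix (Reg q) (Reg q) ℂ) with hV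
  have hVV : V * Vᴴ = 1 := mem_unitaryGroup_iff.1 hH.eigenvectorUnitary.2
  have hVV' : Vᴴ * V = 1 := mem_unitaryGroup_iff'.1 hH.eigenvectorUnitary.2
  let f : Reg q → ℝ := fun b => -s * hH.eigenvalues b
  -- One eigenvector at a time: switching on the phase of a single eigenvector is a rank-one
  -- modification of the identity, and these commuting factors multiply to the whole evolution.
  have key : ∀ T : Finset (Reg q), Implementable (T.card * (2 * prepCost q + phaseCost q))
      (V * phaseMatrix (fun b => if b ∈ T then f b else 0) * Vᴴ) := by
    intro T
    induction T using Finset.induction_on with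
    | empty =>
      have : (fun b : Reg q => if b ∈ (∅ : Finset (Reg q)) then f b else 0) = 0 := by
        funext b; simp
      rw [this, phaseMatrix_zero, mul_one, hVV, Finset.card_empty, zero_mul]
      exact implementable_one
    | insert b T hb ih =>
      have hv : star (V.col b) ⬝ᵥ V.col b = 1 := by
        have := congrFun (congrFun hVV' b) b
        simpa [Matrix.mul_apply, dotProduct] using this
      have h := (implementable_rankOne (V.col b) hv (f b)).mul ih
      have e1 : (fun c => if c ∈ insert b T then f c else 0)
          = (fun c => if c = b then f b else 0) + fun c => if c ∈ T then f c else 0 := by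
        funext c
        by_cases hc : c = b
        · subst hc; simp [hb]
        · simp [hc]
      have e2 : phaseMatrix (fun c => if c = b then f b else 0)
          = 1 + (exp (I * (f b : ℂ)) - 1) • Matrix.single b b 1 := by
        ext c c'
        simp only [phaseMatrix, diagonal_apply, Matrix.add_apply, Matrix.one_apply,
          Matrix.smul_apply, Matrix.single_apply, smul_eq_mul]
        by_cases h0 : c = b
        · subst h0
          by_cases h1 : c = c'
          · subst h1; simp
          · simp [h1]
        · by_cases h1 : c = c'
          · subst h1; simp [h0, Ne.symm h0]
          · simp [h1, Ne.symm h0]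
      have e3 : V * Matrix.single b b 1 * Vᴴ = vecMulVec (V.col b) (star (V.col b)) := by
        ext c c'
        simp [Matrix.mul_apply, Matrix.single_apply, vecMulVec_apply, ite_and]
      have e4 : V * phaseMatrix (fun c => if c = b then f b else 0) * Vᴴ
          = 1 + (exp (I * (f b : ℂ)) - 1) • vecMulVec (V.col b) (star (V.col b)) := by
        rw [e2, mul_add, add_mul, mul_one, hVV, mul_smul_comm, smul_mul_assoc, e3]
      rw [← e4] at h
      rw [e1, phaseMatrix_add, Finset.card_insert_of_notMem hb]
      have e5 : ∀ X Y : Matrix (Reg q) (Reg q) ℂ, V * (X * Y) * Vᴴ = (V * X * Vᴴ) * (V * Y * Vᴴ) := by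
        intro X Y
        calc V * (X * Y) * Vᴴ = V * X * 1 * Y * Vᴴ := by simp only [mul_assoc, one_mul]
          _ = _ := by rw [← hVV']; simp only [mul_assoc]
      rw [e5]
      exact h.mono (by ring_nf; omega)
  have h := key Finset.univ
  simp only [Finset.mem_univ, if_true, f] at h
  rw [propagator_eq_conj hH]
  refine h.mono ?_
  rw [← card_reg, Finset.card_univ, prepCost, phaseCost]
  -- Bounding the number of qubits by the dimension is wasteful, but the dimension will only be
  -- polylogarithmic.
  have hQ : Fintype.card (Qubit q) ≤ Fintype.card (Reg q) := by
    rw [card_reg_eq_two_pow]; exact Nat.lt_two_pow_self.le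
  have hN : 1 ≤ Fintype.card (Reg q) := Fintype.card_pos
  rw [← card_reg_eq_two_pow]
  generalize Fintype.card (Reg q) = N at *
  generalize Fintype.card (Qubit q) = Q at *
  have h1 : N * (2 * Q + 1) ≤ 3 * N ^ 2 := by nlinarith
  generalize N * (2 * Q + 1) = L at *
  have h2 : Q * (L + 2) ≤ N * (3 * N ^ 2 + 2) := Nat.mul_le_mul hQ (by omega)
  have h3 : L + Q * (L + 2) ≤ 8 * N ^ 3 := by nlinarith [Nat.mul_le_mul hN hN, Nat.pow_pos (n := 2) hN]
  calc N * (2 * (L + Q * (L + 2)) + L) ≤ N * (2 * (8 * N ^ 3) + 3 * N ^ 3) := by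
        apply Nat.mul_le_mul_left
        have : 3 * N ^ 2 ≤ 3 * N ^ 3 := by
          apply Nat.mul_le_mul_left; exact Nat.pow_le_pow_right hN (by norm_num)
        omega
    _ = 19 * N ^ 4 := by ring

end Synthesis

/-! ## The register as spinor times grid -/

section Register

open Matrix

variable {q : ℕ}

/-- The register labels are pairs of a spinor label and binary coded coordinates. -/
def regEquiv (q : ℕ) : Reg q ≃ SpinIdx × (Fin 3 → Fin (2 ^ q)) :=
  (Equiv.sumArrowEquivProdArrow _ _ _).trans <|
    Equiv.prodCongr (finTwoArrowEquiv (Fin 2)) <|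
      (Equiv.curry _ _ _).trans (Equiv.arrowCongr (Equiv.refl _) finFunctionFinEquiv)

theorem regEquiv_fst (b : Reg q) : (regEquiv q b).1 = spin b := rfl

theorem gridIdx_eq (b : Reg q) (i : Fin 3) :
    gridIdx b i = (((regEquiv q b).2 i : ℕ) : ℤ) - ((2 ^ q / 2 : ℕ) : ℤ) := by
  have : (((regEquiv q b).2 i : ℕ)) = ∑ j : Fin q, (b (Sum.inr (i, j)) : ℕ) * 2 ^ (j : ℕ) :=
    finFunctionFinEquiv_apply _
  rw [gridIdx, this]
  push_cast
  rfl

theorem spin_gridIdx_injective {b b' : Reg q} (h : spin b = spin b')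
    (h' : gridIdx b = gridIdx b') : b = b' := by
  apply (regEquiv q).injective
  refine Prod.ext h (funext fun i => Fin.ext ?_)
  have := congrFun h' i
  rw [gridIdx_eq, gridIdx_eq] at this
  omega

theorem gridIdx_bounds (b : Reg q) (i : Fin 3) :
    -((2 ^ q / 2 : ℕ) : ℤ) ≤ gridIdx b i ∧ gridIdx b i < 2 ^ q - ((2 ^ q / 2 : ℕ) : ℤ) := by
  rw [gridIdx_eq]
  have := ((regEquiv q b).2 i).2
  have h : (((regEquiv q b).2 i : ℕ) : ℤ) < 2 ^ q := by exact_mod_cast this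
  omega

theorem abs_gridIdx_le (b : Reg q) (i : Fin 3) : |(gridIdx b i : ℝ)| ≤ 2 ^ q / 2 := by
  have h := gridIdx_bounds b i
  -- For `q = 0` the truncated half `2^0 / 2` is `0`, and the grid consists of the single label `0`.
  have h1 : (2 ^ q : ℤ) = 1 ∨ ((2 ^ q / 2 : ℕ) : ℤ) * 2 = 2 ^ q := by
    cases q with
    | zero => left; rfl
    | succ q => right; rw [pow_succ, Nat.mul_div_cancel _ two_pos]; push_cast; ring
  have h2 : |2 * gridIdx b i| ≤ 2 ^ q := by
    rw [abs_le]
    rcases h1 with h1 | h1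
    · rw [h1] at h ⊢
      cases q with
      | zero => simp at h; omega
      | succ q => simp at h; omega
    · omega
  have h3 : |2 * (gridIdx b i : ℝ)| ≤ 2 ^ q := by exact_mod_cast h2
  rw [abs_mul, abs_two] at h3
  linarith

theorem abs_gridIdx_sub_lt (b b' : Reg q) (i : Fin 3) : |gridIdx b i - gridIdx b' i| < 2 ^ q := by
  have h := gridIdx_bounds b i
  have h' := gridIdx_bounds b' i
  rw [abs_lt]; omega

/-- A momentum that is not on the grid has a large coordinate. -/
theorem two_pow_le_of_not_grid {p : Fin 3 → ℤ} (hp : ∀ b : Reg q, gridIdx b ≠ p) :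
    (2 : ℝ) ^ q ≤ 2 * ∑ i, |(p i : ℝ)| := by
  by_contra hlt
  push Not at hlt
  have hi : ∀ i, 2 * |p i| < 2 ^ q := by
    intro i
    have : |(p i : ℝ)| ≤ ∑ i, |(p i : ℝ)| :=
      Finset.single_le_sum (f := fun i => |(p i : ℝ)|) (fun _ _ => abs_nonneg _) (Finset.mem_univ i)
    have h2 : 2 * |(p i : ℝ)| < 2 ^ q := by linarith
    exact_mod_cast h2
  have hr : ∀ i, 0 ≤ p i + ((2 ^ q / 2 : ℕ) : ℤ) ∧ p i + ((2 ^ q / 2 : ℕ) : ℤ) < 2 ^ q := by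
    intro i
    have := hi i
    push_cast
    have h1 := neg_abs_le (p i)
    have h2 := le_abs_self (p i)
    omega
  let g : Fin 3 → Fin (2 ^ q) := fun i => ⟨(p i + ((2 ^ q / 2 : ℕ) : ℤ)).toNat, by
    have := hr i
    rw [Int.toNat_lt this.1]; push_cast; push_cast at this; exact this.2⟩
  apply hp ((regEquiv q).symm ((0, 0), g))
  funext i
  rw [gridIdx_eq, Equiv.apply_symm_apply]
  simp only [g]
  rw [Int.toNat_of_nonneg (hr i).1]
  ring

/-- Replaces the spinor label. -/
def withSpin (b : Reg q) (a : SpinIdx) : Reg q :=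
  Function.update (Function.update b (Sum.inl 0) a.1) (Sum.inl 1) a.2

@[simp]
theorem spin_withSpin (b : Reg q) (a : SpinIdx) : spin (withSpin b a) = a := by
  simp [spin, withSpin]

@[simp]
theorem gridIdx_withSpin (b : Reg q) (a : SpinIdx) : gridIdx (withSpin b a) = gridIdx b := by
  funext i
  simp [gridIdx, withSpin]

theorem withSpin_spin (b b' : Reg q) (h : gridIdx b = gridIdx b') : withSpin b (spin b') = b' :=
  spin_gridIdx_injective (by simp) (by simp [h])

theorem sum_same_grid {R : Type} [AddCommMonoid R] (b : Reg q) (F : Reg q → R) :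
    (∑ b', if gridIdx b = gridIdx b' then F b' else 0) = ∑ a, F (withSpin b a) := by
  rw [← Finset.sum_filter]
  symm
  refine Finset.sum_bij (fun a _ => withSpin b a) ?_ ?_ ?_ ?_
  · simp
  · intro a _ a' _ h
    simpa using congrArg spin h
  · intro b' hb'
    exact ⟨spin b', Finset.mem_univ _, withSpin_spin b b' (by simpa using hb')⟩
  · simp

theorem sum_same_spin {R : Type} [AddCommMonoid R] (a : SpinIdx) (G : (Fin 3 → ℤ) → R) :
    (∑ b : Reg q, if spin b = a then G (gridIdx b) else 0)
      = ∑ g : Fin 3 → Fin (2 ^ q), G (fun i => ((g i : ℕ) : ℤ) - ((2 ^ q / 2 : ℕ) : ℤ)) := by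
  have h : ∀ b : Reg q, gridIdx b
      = fun i => (((regEquiv q b).2 i : ℕ) : ℤ) - ((2 ^ q / 2 : ℕ) : ℤ) :=
    fun b => funext (gridIdx_eq b)
  simp only [h, ← regEquiv_fst]
  rw [(regEquiv q).sum_comp (fun y => if y.1 = a then
    G (fun i => ((y.2 i : ℕ) : ℤ) - ((2 ^ q / 2 : ℕ) : ℤ)) else 0), Fintype.sum_prod_type]
  rw [Finset.sum_eq_single a (by intro x _ hx; simp [hx]) (by simp)]
  simp

/-! ### Matrices that act on the spinor only -/

theorem localMatrix_mulVec (D : Reg q → Matrix SpinIdx SpinIdx ℂ) (v : Reg q → ℂ) (b : Reg q) :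
    (localMatrix D *ᵥ v) b = ∑ a, D b (spin b) a * v (withSpin b a) := by
  simp only [mulVec, dotProduct, localMatrix, ite_mul, zero_mul]
  rw [sum_same_grid b (fun b' => D b (spin b) (spin b') * v b')]
  simp

theorem localMatrix_const_mul (D D' : Matrix SpinIdx SpinIdx ℂ) :
    (localMatrix fun _ : Reg q => D) * (localMatrix fun _ => D') = localMatrix fun _ => D * D' := by
  ext b b''
  simp only [Matrix.mul_apply, localMatrix, ite_mul, zero_mul]
  rw [sum_same_grid b (fun b' => D (spin b) (spin b')
    * if gridIdx b' = gridIdx b'' then D' (spin b') (spin b'') else 0)]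
  simp only [gridIdx_withSpin, spin_withSpin]
  split_ifs <;> simp

theorem localMatrix_const_one : (localMatrix fun _ : Reg q => (1 : Matrix SpinIdx SpinIdx ℂ)) = 1 := by
  ext b b'
  simp only [localMatrix, Matrix.one_apply]
  by_cases h : b = b'
  · subst h; simp
  · rw [if_neg h]
    split_ifs with h1 h2
    · exact absurd (spin_gridIdx_injective h2 h1) h
    · rfl
    · rfl

theorem localMatrix_conjTranspose (D : Reg q → Matrix SpinIdx SpinIdx ℂ)
    (h : ∀ b b', gridIdx b = gridIdx b' → D b = D b') :
    (localMatrix D)ᴴ = localMatrix fun b => (D b)ᴴ := by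
  ext b b'
  simp only [conjTranspose_apply, localMatrix, eq_comm (a := gridIdx b')]
  split_ifs with h1
  · rw [h b b' h1]
  · simp

/-- Separates the grid-dependent coefficients from the constant spinor matrices, so that each
summand becomes a diagonal matrix times, for the Dirac matrices, a unitary one. -/
theorem localMatrix_sum_smul {ι : Type} [Fintype ι] (f : ι → Reg q → ℂ)
    (D : ι → Matrix SpinIdx SpinIdx ℂ) :
    localMatrix (fun b => ∑ i, f i b • D i)
      = ∑ i, diagonal (f i) * localMatrix fun _ => D i := by
  ext b b'
  simp only [Matrix.sum_apply, diagonal_mul, localMatrix, mul_ite, mul_zero, Matrix.smul_apply,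
    smul_eq_mul]
  split_ifs <;> simp

theorem diracAlpha_isHermitian (i : Fin 3) : (diracAlpha i)ᴴ = diracAlpha i := by
  ext ⟨a, b⟩ ⟨c, d⟩
  fin_cases i <;> fin_cases a <;> fin_cases b <;> fin_cases c <;> fin_cases d <;>
    simp [diracAlpha, pauli]

theorem diracAlpha_mul_self (i : Fin 3) : diracAlpha i * diracAlpha i = 1 := by
  rw [diracAlpha, ← mul_kronecker_mul]
  have : ∀ j, pauli j * pauli j = 1 := by
    intro j
    ext a b
    fin_cases j <;> fin_cases a <;> fin_cases b <;> simp [pauli, Matrix.mul_apply, Fin.sum_univ_two]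
  rw [this, this, one_kronecker_one]

theorem diracBeta_eq_diagonal : diracBeta = diagonal fun a => ((-1) ^ (a.1 : ℕ) : ℂ) := by
  ext ⟨a, b⟩ ⟨c, d⟩
  fin_cases a <;> fin_cases b <;> fin_cases c <;> fin_cases d <;>
    simp [diracBeta, pauli]

theorem localMatrix_diagonal (d : Reg q → SpinIdx → ℂ) :
    localMatrix (fun b => diagonal (d b)) = diagonal fun b => d b (spin b) := by
  ext b b'
  simp only [localMatrix, diagonal_apply]
  by_cases h : b = b'
  · subst h; simp
  · rw [if_neg h]
    split_ifs with h1 h2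
    · exact absurd (spin_gridIdx_injective h2 h1) h
    · rfl
    · rfl

/-! ### The discrete Fourier transform -/

/-- A geometric sum over `n`-th roots of unity. The condition `|d| < n` excludes nonzero multiples
of `n`, that is, aliasing; the shift `h` of the labels produces only a common phase. -/
theorem sum_fin_character {n : ℕ} (hn : 0 < n) (h d : ℤ) (hd : |d| < n) :
    ∑ x : Fin n, exp (I * ((2 * Real.pi * (d * (((x : ℕ) : ℤ) - h : ℤ)) / n : ℝ) : ℂ))
      = if d = 0 then (n : ℂ) else 0 := by
  split_ifs with h0
  · subst h0; simp
  · have hn' : (n : ℂ) ≠ 0 := by exact_mod_cast hn.ne'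
    set ζ : ℂ := exp (2 * Real.pi * I * (d / n)) with hζ
    have hζn : ζ ^ n = 1 := by
      rw [hζ, ← Complex.exp_nat_mul, Complex.exp_eq_one_iff]
      exact ⟨d, by field_simp⟩
    have hζ1 : ζ ≠ 1 := by
      intro h1
      rw [hζ, Complex.exp_eq_one_iff] at h1
      obtain ⟨l, hl⟩ := h1
      have hpi : (2 * Real.pi * I : ℂ) ≠ 0 := by simp [Real.pi_ne_zero]
      have h2 : (d / n : ℂ) = l := mul_left_cancel₀ hpi (by rw [hl]; ring)
      rw [div_eq_iff hn'] at h2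
      have h3 : d = l * n := by exact_mod_cast h2
      have : (n : ℤ) ∣ d := ⟨l, by rw [h3, mul_comm]⟩
      exact h0 (Int.eq_zero_of_abs_lt_dvd this hd)
    have h4 : ∀ x : Fin n, exp (I * ((2 * Real.pi * (d * (((x : ℕ) : ℤ) - h : ℤ)) / n : ℝ) : ℂ))
        = exp (-(2 * Real.pi * I * (d * h / n))) * ζ ^ (x : ℕ) := by
      intro x
      rw [hζ, ← Complex.exp_nat_mul, ← Complex.exp_add]
      congr 1
      push_cast
      field_simp
      ring
    simp only [h4]
    rw [← Finset.mul_sum, Fin.sum_univ_eq_sum_range (fun k => ζ ^ k), geom_sum_eq hζ1, hζn]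
    simp

/-- The character factorizes over the three coordinates. Differences of grid labels satisfy the
bound on `d`. -/
theorem sum_reg_character (a : SpinIdx) (d : Fin 3 → ℤ) (hd : ∀ i, |d i| < 2 ^ q) :
    (∑ b : Reg q, if spin b = a then
        exp (I * ((2 * Real.pi * (∑ i, (d i : ℝ) * (gridIdx b i : ℝ)) / 2 ^ q : ℝ) : ℂ)) else 0)
      = if d = 0 then ((2 : ℂ) ^ q) ^ 3 else 0 := by
  rw [sum_same_spin a (fun g : Fin 3 → ℤ =>
    exp (I * ((2 * Real.pi * (∑ i, (d i : ℝ) * (g i : ℝ)) / 2 ^ q : ℝ) : ℂ)))]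
  have h1 : ∀ g : Fin 3 → Fin (2 ^ q),
      exp (I * ((2 * Real.pi * (∑ i, (d i : ℝ)
        * ((((g i : ℕ) : ℤ) - ((2 ^ q / 2 : ℕ) : ℤ) : ℤ) : ℝ)) / 2 ^ q : ℝ) : ℂ))
      = ∏ i, exp (I * ((2 * Real.pi * (d i * (((g i : ℕ) : ℤ) - ((2 ^ q / 2 : ℕ) : ℤ) : ℤ))
          / ((2 ^ q : ℕ) : ℝ) : ℝ) : ℂ)) := by
    intro g
    rw [← Complex.exp_sum, ← Finset.mul_sum, ← Complex.ofReal_sum, ← Finset.sum_div,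
      ← Finset.mul_sum]
    push_cast
    rfl
  simp only [h1]
  rw [← Fintype.prod_sum (fun (i : Fin 3) (x : Fin (2 ^ q)) =>
    exp (I * ((2 * Real.pi * (d i * (((x : ℕ) : ℤ) - ((2 ^ q / 2 : ℕ) : ℤ) : ℤ))
          / ((2 ^ q : ℕ) : ℝ) : ℝ) : ℂ)))]
  have h2 : ∀ i, _ := fun i => sum_fin_character (n := 2 ^ q) (by positivity)
    ((2 ^ q / 2 : ℕ) : ℤ) (d i) (by exact_mod_cast hd i)
  simp only [h2]
  split_ifs with h0
  · subst h0; simp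
  · obtain ⟨i, hi⟩ := Function.ne_iff.1 h0
    exact Finset.prod_eq_zero (Finset.mem_univ i) (if_neg hi)

theorem fourierMatrix_apply (b b' : Reg q) : fourierMatrix q b b' =
    if spin b = spin b' then ((((Real.sqrt (2 ^ q)) ^ 3)⁻¹ : ℝ) : ℂ) *
      exp (-(I * ((2 * Real.pi * (∑ i, (gridIdx b i : ℝ) * (gridIdx b' i : ℝ)) / 2 ^ q : ℝ) : ℂ)))
    else 0 := rfl

theorem fourierMatrix_mem_unitary (q : ℕ) : fourierMatrix q ∈ unitaryGroup (Reg q) ℂ := by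
  rw [mem_unitaryGroup_iff]
  ext b b''
  have h : ∀ b', fourierMatrix q b b' * star (fourierMatrix q) b' b''
      = (if spin b = spin b'' then ((((2 : ℂ) ^ q) ^ 3)⁻¹) else 0)
        * (if spin b' = spin b then exp (I * ((2 * Real.pi
          * (∑ i, ((gridIdx b'' i - gridIdx b i : ℤ) : ℝ) * (gridIdx b' i : ℝ)) / 2 ^ q : ℝ) : ℂ))
          else 0) := by
    intro b'
    rw [star_apply, fourierMatrix_apply, fourierMatrix_apply]
    by_cases h1 : spin b' = spin b
    · by_cases h2 : spin b = spin b''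
      · rw [if_pos h1, if_pos h2, if_pos h1.symm, if_pos (h2.symm.trans h1.symm), star_mul',
          RCLike.star_def, Complex.conj_ofReal, ← Complex.exp_conj,
          mul_mul_mul_comm, ← Complex.exp_add, ← Complex.ofReal_mul]
        congr 1
        · rw [← mul_inv, ← mul_pow, Real.mul_self_sqrt (by positivity)]
          push_cast; rfl
        · congr 1
          simp only [map_neg, map_mul, Complex.conj_I, Complex.conj_ofReal]
          push_cast
          simp only [sub_mul, Finset.sum_sub_distrib]
          ring
      · rw [if_neg h2, zero_mul, if_pos h1.symm, if_neg (fun h : spin b'' = spin b' => h2 (h1.symm.trans h.symm))]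
        simp
    · rw [if_neg h1, if_neg (fun h => h1 h.symm)]; simp
  rw [Matrix.mul_apply]
  simp only [h]
  rw [← Finset.mul_sum, sum_reg_character _ _ (fun i => abs_gridIdx_sub_lt b'' b i),
    Matrix.one_apply]
  have h0 : ((fun i => gridIdx b'' i - gridIdx b i) = 0) ↔ gridIdx b = gridIdx b'' := by
    simp only [funext_iff, Pi.zero_apply, sub_eq_zero, eq_comm]
  simp only [h0]
  by_cases hb : b = b''
  · subst hb; simp
  · rw [if_neg hb]
    split_ifs with h1 h2
    · exact absurd (spin_gridIdx_injective h1 h2) hb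
    all_goals simp

end Register

/-! ## Hermiticity and norms of the discretized Hamiltonian -/

section HamiltonianTerms

open Matrix
open scoped Matrix.Norms.L2Operator

variable {q : ℕ}

theorem norm_act_le (U : Matrix (Reg q) (Reg q) ℂ) (v : QState q) : ‖act U v‖ ≤ ‖U‖ * ‖v‖ :=
  l2_opNorm_mulVec U v

theorem act_mul (U U' : Matrix (Reg q) (Reg q) ℂ) (v : QState q) :
    act (U * U') v = act U (act U' v) := by
  simp [act, mulVec_mulVec]

theorem act_sub_left (U U' : Matrix (Reg q) (Reg q) ℂ) (v : QState q) :
    act (U - U') v = act U v - act U' v := by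
  simp [act, sub_mulVec]

theorem act_sub (U : Matrix (Reg q) (Reg q) ℂ) (v w : QState q) :
    act U (v - w) = act U v - act U w := by
  simp [act, mulVec_sub]

theorem norm_eq_one_of_unitary {U : Matrix (Reg q) (Reg q) ℂ} (hU : U ∈ unitaryGroup (Reg q) ℂ) :
    ‖U‖ = 1 :=
  CStarRing.norm_of_mem_unitary hU

theorem norm_act_of_unitary {U : Matrix (Reg q) (Reg q) ℂ} (hU : U ∈ unitaryGroup (Reg q) ℂ)
    (v : QState q) : ‖act U v‖ = ‖v‖ := by
  apply le_antisymm
  · simpa [norm_eq_one_of_unitary hU] using norm_act_le U v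
  · have h := norm_act_le (star U) (act U v)
    rw [← act_mul, mem_unitaryGroup_iff'.1 hU, norm_eq_one_of_unitary (Unitary.star_mem hU),
      one_mul] at h
    simpa [act] using h

theorem norm_diagonal_le {d : Reg q → ℂ} {c : ℝ} (hc : 0 ≤ c) (h : ∀ b, ‖d b‖ ≤ c) :
    ‖diagonal d‖ ≤ c := by
  rw [l2_opNorm_diagonal]
  exact (pi_norm_le_iff_of_nonneg hc).2 h

theorem localAlpha_mem_unitary (i : Fin 3) :
    (localMatrix fun _ : Reg q => diracAlpha i) ∈ unitaryGroup (Reg q) ℂ := by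
  rw [mem_unitaryGroup_iff, star_eq_conjTranspose, localMatrix_conjTranspose _ (fun _ _ _ => rfl),
    diracAlpha_isHermitian, localMatrix_const_mul, diracAlpha_mul_self, localMatrix_const_one]

/-- The triangle inequality over three directions, each `diracAlpha i` being unitary. The loss is at
most a constant factor. -/
theorem norm_localMatrix_alpha_le (f : Fin 3 → Reg q → ℂ) {c : ℝ} (hc : 0 ≤ c)
    (h : ∀ i b, ‖f i b‖ ≤ c) : ‖localMatrix fun b => ∑ i, f i b • diracAlpha i‖ ≤ 3 * c := by
  rw [localMatrix_sum_smul]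
  refine (norm_sum_le _ _).trans ?_
  have : ∀ i ∈ Finset.univ,
      ‖diagonal (f i) * localMatrix fun _ : Reg q => diracAlpha i‖ ≤ c := fun i _ => by
    refine (norm_mul_le _ _).trans ?_
    rw [norm_eq_one_of_unitary (localAlpha_mem_unitary i), mul_one]
    exact norm_diagonal_le hc (h i)
  refine (Finset.sum_le_card_nsmul _ _ _ this).trans ?_
  simp

theorem isHermitian_localMatrix_alpha (f : Fin 3 → Reg q → ℝ)
    (h : ∀ i b b', gridIdx b = gridIdx b' → f i b = f i b') :
    (localMatrix fun b => ∑ i, (f i b : ℂ) • diracAlpha i).IsHermitian := by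
  rw [IsHermitian, localMatrix_conjTranspose _ (fun b b' hb => by simp only [h _ b b' hb])]
  congr 1
  funext b
  simp [conjTranspose_sum, conjTranspose_smul, diracAlpha_isHermitian]

variable (Ω m e : ℝ) (φ : Space → ℝ) (A : Space → Fin 3 → ℝ)

theorem hamTerm_zero : hamTerm Ω m e φ A q 0 = (fourierMatrix q)ᴴ *
    localMatrix (fun b => ∑ i, (waveVec Ω b i : ℂ) • diracAlpha i) * fourierMatrix q := rfl

theorem hamTerm_one : hamTerm Ω m e φ A q 1
    = diagonal fun b => ((m * (-1) ^ (b (Sum.inl 0) : ℕ) : ℝ) : ℂ) := by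
  have h : hamTerm Ω m e φ A q 1 = localMatrix (fun _ => (m : ℂ) • diracBeta) := rfl
  rw [h, diracBeta_eq_diagonal]
  simp only [← diagonal_smul]
  rw [localMatrix_diagonal]
  congr 1
  funext b
  simp [spin]

theorem hamTerm_two : hamTerm Ω m e φ A q 2
    = diagonal fun b => ((-(e * φ (node Ω b)) : ℝ) : ℂ) := by
  have h : hamTerm Ω m e φ A q 2 = localMatrix (fun b => ((-(e * φ (node Ω b)) : ℝ) : ℂ) • 1) := rfl
  rw [h]
  simp only [← diagonal_one, ← diagonal_smul]
  rw [localMatrix_diagonal]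
  congr 1
  funext b
  simp

theorem hamTerm_three : hamTerm Ω m e φ A q 3
    = localMatrix (fun b => ∑ i, ((e * A (node Ω b) i : ℝ) : ℂ) • diracAlpha i) := rfl

theorem node_congr {b b' : Reg q} (h : gridIdx b = gridIdx b') : node Ω b = node Ω b' := by
  funext i; simp [node, h]

theorem hamTerm_isHermitian (j : Fin 4) : (hamTerm Ω m e φ A q j).IsHermitian := by
  fin_cases j
  · change (hamTerm Ω m e φ A q 0).IsHermitian
    rw [hamTerm_zero]
    refine isHermitian_conjTranspose_mul_mul _ (isHermitian_localMatrix_alpha _ ?_)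
    intro i b b' h
    simp [waveVec, h]
  · change (hamTerm Ω m e φ A q 1).IsHermitian
    rw [hamTerm_one]
    exact isHermitian_diagonal_of_self_adjoint _ (funext fun b => Complex.conj_ofReal _)
  · change (hamTerm Ω m e φ A q 2).IsHermitian
    rw [hamTerm_two]
    exact isHermitian_diagonal_of_self_adjoint _ (funext fun b => Complex.conj_ofReal _)
  · change (hamTerm Ω m e φ A q 3).IsHermitian
    rw [hamTerm_three]
    refine isHermitian_localMatrix_alpha _ ?_
    intro i b b' h
    rw [node_congr Ω h]

theorem norm_hamTerm_zero_le (hΩ : 0 < Ω) :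
    ‖hamTerm Ω m e φ A q 0‖ ≤ 3 * (Real.pi / Ω * 2 ^ q) := by
  rw [hamTerm_zero]
  refine (norm_mul_le _ _).trans ?_
  rw [norm_eq_one_of_unitary (fourierMatrix_mem_unitary q), mul_one]
  refine (norm_mul_le _ _).trans ?_
  rw [l2_opNorm_conjTranspose, norm_eq_one_of_unitary (fourierMatrix_mem_unitary q), one_mul]
  refine norm_localMatrix_alpha_le _ (by positivity) ?_
  intro i b
  rw [Complex.norm_real, Real.norm_eq_abs, waveVec, abs_div, abs_mul, abs_of_pos hΩ,
    abs_of_pos Real.two_pi_pos]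
  have := abs_gridIdx_le b i
  calc 2 * Real.pi * |(gridIdx b i : ℝ)| / Ω ≤ 2 * Real.pi * (2 ^ q / 2) / Ω := by gcongr
    _ = _ := by ring

theorem norm_hamTerm_one_le : ‖hamTerm Ω m e φ A q 1‖ ≤ |m| := by
  rw [hamTerm_one]
  refine norm_diagonal_le (abs_nonneg m) fun b => ?_
  simp

variable {φ A} in
theorem norm_hamTerm_two_le (hφ : ∀ x, |φ x| ≤ scalarMax φ) :
    ‖hamTerm Ω m e φ A q 2‖ ≤ |e| * scalarMax φ := by
  rw [hamTerm_two]
  have h0 : 0 ≤ scalarMax φ := (abs_nonneg _).trans (hφ 0)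
  refine norm_diagonal_le (by positivity) fun b => ?_
  rw [Complex.norm_real, Real.norm_eq_abs, abs_neg, abs_mul]
  gcongr
  exact hφ _

variable {φ A} in
theorem norm_hamTerm_three_le (hA : ∀ x, Real.sqrt (∑ i, A x i ^ 2) ≤ vectorMax A) :
    ‖hamTerm Ω m e φ A q 3‖ ≤ 3 * (|e| * vectorMax A) := by
  rw [hamTerm_three]
  have h0 : 0 ≤ vectorMax A := (Real.sqrt_nonneg _).trans (hA 0)
  refine norm_localMatrix_alpha_le _ (by positivity) fun i b => ?_
  rw [Complex.norm_real, Real.norm_eq_abs, abs_mul]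
  gcongr
  refine le_trans ?_ (hA (node Ω b))
  refine Real.abs_le_sqrt ?_
  exact Finset.single_le_sum (f := fun i => A (node Ω b) i ^ 2) (fun _ _ => sq_nonneg _)
    (Finset.mem_univ i)

/-- The mass term is implemented by a single gate. -/
theorem implementable_mass (s : ℝ) : Implementable 1 (propagator (hamTerm Ω m e φ A q 1) s) := by
  have h := implementable_phase_of_qubit (Sum.inl 0 : Qubit q)
    (fun x => -(s * (m * (-1) ^ (x : ℕ))))
  convert h using 1
  rw [hamTerm_one, propagator, ← diagonal_smul, exp_diagonal, phaseMatrix]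
  congr 1
  funext b
  rw [Pi.coe_exp, ← Complex.exp_eq_exp_ℂ]
  simp
  ring_nf

end HamiltonianTerms

/-! ### Maxima of periodic functions -/

theorem Periodic3.exists_cube {β : Type} {Ω : ℝ} (hΩ : 0 < Ω) {f : Space → β} (hf : Periodic3 Ω f)
    (x : Space) : ∃ y ∈ Set.Icc (0 : Space) (fun _ => Ω), f y = f x := by
  have hn : ∀ (i : Fin 3) (n : ℤ) (x : Space), f (x + Pi.single i (n * Ω)) = f x := by
    intro i n x
    have hper : Function.Periodic (fun s : ℝ => f (x + Pi.single i s)) Ω := fun s => by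
      simp only [Pi.single_add, ← add_assoc]
      exact hf _ i
    have := hper.int_mul n 0
    simpa using this
  let n : Fin 3 → ℤ := fun i => -⌊x i / Ω⌋
  refine ⟨x + Pi.single 0 (n 0 * Ω) + Pi.single 1 (n 1 * Ω) + Pi.single 2 (n 2 * Ω), ?_, ?_⟩
  · have key : ∀ i, 0 ≤ x i + n i * Ω ∧ x i + n i * Ω ≤ Ω := by
      intro i
      have h1 := Int.floor_le (x i / Ω)
      have h2 := (Int.lt_floor_add_one (x i / Ω)).le
      rw [le_div_iff₀ hΩ] at h1
      rw [div_le_iff₀ hΩ] at h2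
      simp only [n]
      push_cast
      constructor <;> nlinarith
    constructor <;> intro i <;> fin_cases i <;> simp [key]
  · rw [hn, hn, hn]

/-- Periodicity reduces boundedness to a compact cube. Boundedness is essential: the supremum of an
unbounded real family has the default value `0` and would bound nothing. -/
theorem le_ciSup_of_periodic {Ω : ℝ} (hΩ : 0 < Ω) {f : Space → ℝ} (hc : Continuous f)
    (hf : Periodic3 Ω f) (x : Space) : f x ≤ ⨆ x, f x := by
  have hb : BddAbove (f '' Set.Icc (0 : Space) (fun _ => Ω)) :=
    isCompact_Icc.bddAbove_image hc.continuousOn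
  refine le_ciSup (hb.mono ?_) x
  rintro _ ⟨x, rfl⟩
  obtain ⟨y, hy, h⟩ := hf.exists_cube hΩ x
  exact ⟨y, hy, h⟩

theorem abs_le_scalarMax {Ω : ℝ} (hΩ : 0 < Ω) {φ : Space → ℝ} (hc : Continuous φ)
    (hφ : Periodic3 Ω φ) (x : Space) : |φ x| ≤ scalarMax φ :=
  le_ciSup_of_periodic hΩ (f := fun x => |φ x|) (by fun_prop) (fun x i => by simp only [hφ x i]) x

theorem sqrt_le_vectorMax {Ω : ℝ} (hΩ : 0 < Ω) {A : Space → Fin 3 → ℝ} (hc : Continuous A)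
    (hA : Periodic3 Ω A) (x : Space) : Real.sqrt (∑ i, A x i ^ 2) ≤ vectorMax A :=
  le_ciSup_of_periodic hΩ (f := fun x => Real.sqrt (∑ i, A x i ^ 2)) (by fun_prop)
    (fun x i => by simp only [hA x i]) x

/-! ### Product formula error on the register -/

section Trotter

open Matrix
open scoped Matrix.Norms.L2Operator

variable {q : ℕ}

theorem propagator_eq (H : Matrix (Reg q) (Reg q) ℂ) (t : ℝ) :
    propagator H t = NormedSpace.exp ((t : ℂ) • ((-I) • H)) := by
  rw [propagator, smul_smul]
  congr 2
  ring

/-- Product formulas commute with monoid homomorphisms, so the formula may be formed inside the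
unitary group. -/
theorem suzuki_mem_unitary (E : Fin 4 → ℝ → Matrix (Reg q) (Reg q) ℂ)
    (hE : ∀ j t, E j t ∈ unitaryGroup (Reg q) ℂ) (k : ℕ) (t : ℝ) :
    suzuki E k t ∈ unitaryGroup (Reg q) ℂ := by
  have := map_suzuki (unitaryGroup (Reg q) ℂ).subtype (fun j t => ⟨E j t, hE j t⟩) k t
  simp only [Submonoid.coe_subtype] at this
  rw [← this]
  exact Subtype.prop _

theorem propagator_pow (H : Matrix (Reg q) (Reg q) ℂ) (t : ℝ) {r : ℕ} (hr : 0 < r) :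
    propagator H (t / r) ^ r = propagator H t := by
  rw [propagator, ← Matrix.exp_nsmul, propagator, ← Nat.cast_smul_eq_nsmul ℂ, smul_smul]
  congr 2
  have : (r : ℂ) ≠ 0 := by exact_mod_cast hr.ne'
  push_cast
  field_simp

/-- Telescoping; since all powers have norm `1`, each step adds one local error. -/
theorem norm_pow_sub_pow_le {U U' : Matrix (Reg q) (Reg q) ℂ} (hU : U ∈ unitaryGroup (Reg q) ℂ)
    (hU' : U' ∈ unitaryGroup (Reg q) ℂ) (r : ℕ) : ‖U ^ r - U' ^ r‖ ≤ r * ‖U - U'‖ := by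
  induction r with
  | zero => simp
  | succ r ih =>
    have h : U ^ (r + 1) - U' ^ (r + 1) = U ^ r * (U - U') + (U ^ r - U' ^ r) * U' := by
      rw [pow_succ, pow_succ, mul_sub, sub_mul]; abel
    rw [h]
    refine (norm_add_le _ _).trans ?_
    have h1 := norm_mul_le (U ^ r) (U - U')
    have h2 := norm_mul_le (U ^ r - U' ^ r) U'
    rw [norm_eq_one_of_unitary (pow_mem hU r), one_mul] at h1
    rw [norm_eq_one_of_unitary hU', mul_one] at h2
    push_cast
    linarith

/-- The error of `r` steps of the product formula of order `2 (k + 1)`. -/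
theorem norm_suzuki_pow_sub_propagator_le (H : Fin 4 → Matrix (Reg q) (Reg q) ℂ)
    (hH : ∀ j, (H j).IsHermitian) (Λ T : ℝ) (hΛ : ∑ j, ‖H j‖ ≤ Λ) (k : ℕ) {r : ℕ} (hr : 0 < r)
    (hT : 3 ^ k * Λ * |T| ≤ r) :
    ‖suzuki (fun j => propagator (H j)) (k + 1) (T / r) ^ r - propagator (∑ j, H j) T‖
      ≤ r * (6 * (3 ^ k * Λ * |T| / r) ^ (2 * k + 3)) := by
  have hr' : (0 : ℝ) < r := by exact_mod_cast hr
  have hS : (∑ j, H j).IsHermitian := by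
    simp only [IsHermitian, conjTranspose_sum, fun j => (hH j).eq]
  rw [← propagator_pow (∑ j, H j) T hr]
  refine (norm_pow_sub_pow_le
    (suzuki_mem_unitary _ (fun j t => propagator_mem_unitary (hH j) t) _ _)
    (propagator_mem_unitary hS _) r).trans ?_
  refine mul_le_mul_of_nonneg_left ?_ hr'.le
  have h0 : 3 ^ k * (∑ j, ‖(-I) • H j‖) * |T / r| ≤ 3 ^ k * Λ * |T| / r := by
    simp only [norm_smul, norm_neg, Complex.norm_I, one_mul]
    rw [abs_div, abs_of_pos hr', ← mul_div_assoc]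
    gcongr
  have h1 : 3 ^ k * Λ * |T| / r ≤ 1 := (div_le_one hr').2 hT
  have h := norm_suzuki_sub_exp_le (fun j => (-I) • H j) k (T / r) (h0.trans h1)
  simp only [← Finset.smul_sum, ← propagator_eq] at h
  refine h.trans ?_
  gcongr

end Trotter

/-! ## Plane waves on the register -/

section Modes

open Matrix

variable {q : ℕ} {Ω : ℝ}

/-- A plane wave with a constant spinor. -/
def mode (Ω : ℝ) (p : Fin 3 → ℤ) (c : SpinIdx → ℂ) (x : Space) : SpinIdx → ℂ :=
  planeWave Ω p x • c

/-- The symbol `α · k_p` of the kinetic term. -/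
def kineticSymbol (Ω : ℝ) (p : Fin 3 → ℤ) : Matrix SpinIdx SpinIdx ℂ :=
  ∑ i, ((2 * Real.pi * (p i : ℝ) / Ω : ℝ) : ℂ) • diracAlpha i

/-- The `ℓ¹` size of a momentum label. -/
def size (p : Fin 3 → ℤ) : ℝ := ∑ i, |(p i : ℝ)|

theorem size_nonneg (p : Fin 3 → ℤ) : 0 ≤ size p := Finset.sum_nonneg fun _ _ => abs_nonneg _

theorem abs_le_size (p : Fin 3 → ℤ) (i : Fin 3) : |(p i : ℝ)| ≤ size p :=
  Finset.single_le_sum (f := fun i => |(p i : ℝ)|) (fun _ _ => abs_nonneg _) (Finset.mem_univ i)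

theorem norm_planeWave (p : Fin 3 → ℤ) (x : Space) : ‖planeWave Ω p x‖ = 1 := by
  rw [planeWave, mul_comm]
  exact Complex.norm_exp_ofReal_mul_I _

theorem planeWave_node (hΩ : 0 < Ω) (p : Fin 3 → ℤ) (b : Reg q) :
    planeWave Ω p (node Ω b)
      = exp (I * ((2 * Real.pi * (∑ i, (p i : ℝ) * (gridIdx b i : ℝ)) / 2 ^ q : ℝ) : ℂ)) := by
  rw [planeWave]
  congr 3
  rw [Finset.mul_sum, Finset.sum_div]
  refine Finset.sum_congr rfl fun i _ => ?_
  rw [node]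
  field_simp

theorem sampleState_apply (f : Space → SpinIdx → ℂ) (b : Reg q) :
    (sampleState Ω q f).ofLp b
      = (((Real.sqrt (Ω / 2 ^ q)) ^ 3 : ℝ) : ℂ) * f (node Ω b) (spin b) := rfl

/-- Discrete orthogonality turns a resolved plane wave into a spike at its own momentum. The
normalizations combine to `n^{-3/2} (Ω/n)^{3/2} n³ = Ω^{3/2}`. Exactness of the kinetic term and of
interpolation on such waves both follow from this formula. -/
theorem fourier_sampleState_mode (hΩ : 0 < Ω) (b₀ : Reg q) (c : SpinIdx → ℂ) (b : Reg q) :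
    (fourierMatrix q *ᵥ (sampleState Ω q (mode Ω (gridIdx b₀) c)).ofLp) b
      = if gridIdx b = gridIdx b₀ then (((Real.sqrt Ω) ^ 3 : ℝ) : ℂ) * c (spin b) else 0 := by
  have hn : (0 : ℝ) < Real.sqrt (2 ^ q) := by positivity
  have h : ∀ b', fourierMatrix q b b' * (sampleState Ω q (mode Ω (gridIdx b₀) c)).ofLp b'
      = ((((Real.sqrt Ω) ^ 3 : ℝ) : ℂ) * c (spin b) * (((2 : ℂ) ^ q) ^ 3)⁻¹)
        * (if spin b' = spin b then exp (I * ((2 * Real.pi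
          * (∑ i, ((gridIdx b₀ i - gridIdx b i : ℤ) : ℝ) * (gridIdx b' i : ℝ)) / 2 ^ q : ℝ) : ℂ))
          else 0) := by
    intro b'
    rw [sampleState_apply, fourierMatrix_apply, mode, Pi.smul_apply, smul_eq_mul,
      planeWave_node hΩ]
    by_cases h1 : spin b' = spin b
    · rw [if_pos h1.symm, if_pos h1, h1]
      have e1 : exp (I * ((2 * Real.pi
          * (∑ i, ((gridIdx b₀ i - gridIdx b i : ℤ) : ℝ) * (gridIdx b' i : ℝ)) / 2 ^ q : ℝ) : ℂ))
          = exp (-(I * ((2 * Real.pi * (∑ i, (gridIdx b i : ℝ) * (gridIdx b' i : ℝ)) / 2 ^ q : ℝ)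
            : ℂ)))
            * exp (I * ((2 * Real.pi * (∑ i, (gridIdx b₀ i : ℝ) * (gridIdx b' i : ℝ)) / 2 ^ q : ℝ)
            : ℂ)) := by
        rw [← Complex.exp_add]
        congr 1
        push_cast
        simp only [sub_mul, Finset.sum_sub_distrib]
        ring
      have e2 : (((Real.sqrt (2 ^ q)) ^ 3)⁻¹ : ℝ) * (Real.sqrt (Ω / 2 ^ q)) ^ 3
          = (Real.sqrt Ω) ^ 3 * ((2 ^ q) ^ 3)⁻¹ := by
        rw [Real.sqrt_div hΩ.le, div_pow]
        have : ((2 : ℝ) ^ q) ^ 3 = (Real.sqrt (2 ^ q)) ^ 3 * (Real.sqrt (2 ^ q)) ^ 3 := by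
          rw [← mul_pow, Real.mul_self_sqrt (by positivity)]
        rw [this]
        field_simp
      have e3 : ((((Real.sqrt (2 ^ q)) ^ 3)⁻¹ : ℝ) : ℂ) * (((Real.sqrt (Ω / 2 ^ q)) ^ 3 : ℝ) : ℂ)
          = (((Real.sqrt Ω) ^ 3 : ℝ) : ℂ) * (((2 : ℂ) ^ q) ^ 3)⁻¹ := by
        rw [← Complex.ofReal_mul, e2]; push_cast; rfl
      rw [e1]
      linear_combination (exp (-(I * ((2 * Real.pi
          * (∑ i, (gridIdx b i : ℝ) * (gridIdx b' i : ℝ)) / 2 ^ q : ℝ) : ℂ)))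
            * exp (I * ((2 * Real.pi * (∑ i, (gridIdx b₀ i : ℝ) * (gridIdx b' i : ℝ)) / 2 ^ q : ℝ)
            : ℂ)) * c (spin b)) * e3
    · rw [if_neg h1, if_neg (fun h => h1 h.symm)]; simp
  simp only [mulVec, dotProduct, h]
  rw [← Finset.mul_sum, sum_reg_character _ _ (fun i => abs_gridIdx_sub_lt b₀ b i)]
  have h0 : ((fun i => gridIdx b₀ i - gridIdx b i) = 0) ↔ gridIdx b = gridIdx b₀ := by
    simp only [funext_iff, Pi.zero_apply, sub_eq_zero, eq_comm]
  simp only [h0]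
  split_ifs
  · field_simp
  · simp

/-- On resolved momenta the kinetic term acts exactly. -/
theorem hamTerm_zero_sample_mode (hΩ : 0 < Ω) (m e : ℝ) (φ : Space → ℝ) (A : Space → Fin 3 → ℝ)
    (b₀ : Reg q) (c : SpinIdx → ℂ) :
    act (hamTerm Ω m e φ A q 0) (sampleState Ω q (mode Ω (gridIdx b₀) c))
      = sampleState Ω q (mode Ω (gridIdx b₀) (kineticSymbol Ω (gridIdx b₀) *ᵥ c)) := by
  have h : localMatrix (fun b => ∑ i, (waveVec Ω b i : ℂ) • diracAlpha i)
      *ᵥ (fourierMatrix q *ᵥ (sampleState Ω q (mode Ω (gridIdx b₀) c)).ofLp)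
      = fourierMatrix q *ᵥ
        (sampleState Ω q (mode Ω (gridIdx b₀) (kineticSymbol Ω (gridIdx b₀) *ᵥ c))).ofLp := by
    funext b
    rw [localMatrix_mulVec, fourier_sampleState_mode hΩ]
    simp only [fourier_sampleState_mode hΩ, gridIdx_withSpin, spin_withSpin]
    by_cases hb : gridIdx b = gridIdx b₀
    · simp only [hb, if_true]
      have : (∑ i, (waveVec Ω b i : ℂ) • diracAlpha i) = kineticSymbol Ω (gridIdx b₀) := by
        simp only [waveVec, hb, kineticSymbol]
      rw [this, mulVec, dotProduct, Finset.mul_sum]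
      exact Finset.sum_congr rfl fun a _ => by ring
    · simp [hb]
  rw [act, hamTerm_zero, mul_assoc, ← mulVec_mulVec, ← mulVec_mulVec, h, mulVec_mulVec]
  have hu := mem_unitaryGroup_iff'.1 (fourierMatrix_mem_unitary q)
  rw [star_eq_conjTranspose] at hu
  rw [hu, one_mulVec]

/-- On resolved momenta trigonometric interpolation is exact. -/
theorem interpolant_sample_mode (hΩ : 0 < Ω) (b₀ : Reg q) (c : SpinIdx → ℂ) (x : Space) :
    interpolant Ω (sampleState Ω q (mode Ω (gridIdx b₀) c)) x = mode Ω (gridIdx b₀) c x := by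
  classical
  funext a
  have hs : (0 : ℝ) < Real.sqrt Ω := Real.sqrt_pos.2 hΩ
  simp only [interpolant, act, fourier_sampleState_mode hΩ, mode, Pi.smul_apply, smul_eq_mul]
  rw [Finset.sum_eq_single (withSpin b₀ a)]
  · simp only [spin_withSpin, gridIdx_withSpin, if_true]
    have : (((Real.sqrt Ω) ^ 3 : ℝ) : ℂ) ≠ 0 := by exact_mod_cast (by positivity)
    rw [Complex.ofReal_inv]
    field_simp
  · intro b _ hb
    by_cases h1 : spin b = a
    · by_cases h2 : gridIdx b = gridIdx b₀
      · exact absurd (spin_gridIdx_injective (by simp [h1]) (by simp [h2])) hb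
      · simp [h2]
    · simp [h1]
  · simp

/-! ### Size bounds for unresolved plane waves -/

theorem sqrt_pow_three_sq {x : ℝ} (hx : 0 ≤ x) : (Real.sqrt x ^ 3) ^ 2 = x ^ 3 := by
  rw [← pow_mul, mul_comm 3 2, pow_mul, Real.sq_sqrt hx]

theorem sqrt_card_reg : Real.sqrt (Fintype.card (Reg q)) = 2 * Real.sqrt (2 ^ q) ^ 3 := by
  rw [card_reg]
  push_cast
  have h : (4 : ℝ) * (2 ^ q) ^ 3 = (2 * Real.sqrt (2 ^ q) ^ 3) ^ 2 := by
    rw [mul_pow, sqrt_pow_three_sq (by positivity)]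
    norm_num
  rw [h, Real.sqrt_sq (by positivity)]

/-- There are `4n³` amplitudes, each at most `(Ω/n)^{3/2} K`, so the powers of `n` cancel. -/
theorem norm_sampleState_le (hΩ : 0 < Ω) {f : Space → SpinIdx → ℂ} {K : ℝ}
    (hf : ∀ x a, ‖f x a‖ ≤ K) : ‖sampleState Ω q f‖ ≤ 2 * Real.sqrt Ω ^ 3 * K := by
  have hK : 0 ≤ K := (norm_nonneg _).trans (hf 0 (0, 0))
  have hn : (0 : ℝ) < Real.sqrt (2 ^ q) := by positivity
  rw [EuclideanSpace.norm_eq]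
  have h1 : ∑ b, ‖(sampleState Ω q f).ofLp b‖ ^ 2
      ≤ Fintype.card (Reg q) * (Real.sqrt (Ω / 2 ^ q) ^ 3 * K) ^ 2 := by
    rw [← nsmul_eq_mul, ← Finset.card_univ]
    refine Finset.sum_le_card_nsmul _ _ _ fun b _ => ?_
    rw [sampleState_apply, norm_mul, Complex.norm_real, Real.norm_of_nonneg (by positivity)]
    gcongr
    exact hf _ _
  refine (Real.sqrt_le_sqrt h1).trans ?_
  rw [Real.sqrt_mul (by positivity), Real.sqrt_sq (by positivity), sqrt_card_reg,
    Real.sqrt_div hΩ.le, div_pow]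
  apply le_of_eq
  field_simp

/-- A crude sum over all amplitudes. The factor `n³` does no harm: the bound is applied to momenta
with `n ≤ 2 size p`, whose coefficients decay exponentially. -/
theorem norm_interpolant_le (hΩ : 0 < Ω) (v : QState q) (x : Space) (a : SpinIdx) :
    ‖interpolant Ω v x a‖ ≤ (Real.sqrt Ω ^ 3)⁻¹ * (4 * (2 ^ q) ^ 3 * ‖v‖) := by
  classical
  rw [interpolant, norm_mul, Complex.norm_real, Real.norm_of_nonneg (by positivity)]
  gcongr
  refine (norm_sum_le _ _).trans ?_
  have h : ∀ b ∈ Finset.univ, ‖if spin b = a then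
      (act (fourierMatrix q) v) b * planeWave Ω (gridIdx b) x else 0‖ ≤ ‖v‖ := by
    intro b _
    split_ifs
    · rw [norm_mul, norm_planeWave, mul_one,
        ← norm_act_of_unitary (fourierMatrix_mem_unitary q) v]
      exact PiLp.norm_apply_le _ _
    · simp
  refine (Finset.sum_le_card_nsmul _ _ _ h).trans ?_
  rw [Finset.card_univ, card_reg, nsmul_eq_mul]
  push_cast
  exact le_rfl

theorem norm_diracAlpha_apply_le (i : Fin 3) (a a' : SpinIdx) : ‖diracAlpha i a a'‖ ≤ 1 := by
  obtain ⟨a, b⟩ := a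
  obtain ⟨c, d⟩ := a'
  fin_cases i <;> fin_cases a <;> fin_cases b <;> fin_cases c <;> fin_cases d <;>
    simp [diracAlpha, pauli]

theorem norm_kineticSymbol_mulVec_le (hΩ : 0 < Ω) (p : Fin 3 → ℤ) {c : SpinIdx → ℂ} {K : ℝ}
    (hc : ∀ a, ‖c a‖ ≤ K) (a : SpinIdx) :
    ‖(kineticSymbol Ω p *ᵥ c) a‖ ≤ 8 * Real.pi / Ω * size p * K := by
  have hK : 0 ≤ K := (norm_nonneg _).trans (hc (0, 0))
  have hent : ∀ a', ‖kineticSymbol Ω p a a'‖ ≤ 2 * Real.pi / Ω * size p := by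
    intro a'
    rw [kineticSymbol, Matrix.sum_apply, size, Finset.mul_sum]
    refine (norm_sum_le _ _).trans (Finset.sum_le_sum fun i _ => ?_)
    rw [Matrix.smul_apply, smul_eq_mul, norm_mul, Complex.norm_real, Real.norm_eq_abs, abs_div,
      abs_mul, abs_of_pos hΩ, abs_of_pos Real.two_pi_pos]
    calc 2 * Real.pi * |(p i : ℝ)| / Ω * ‖diracAlpha i a a'‖
        ≤ 2 * Real.pi * |(p i : ℝ)| / Ω * 1 := by
          gcongr; exact norm_diracAlpha_apply_le i a a'
      _ = _ := by ring
  have hs := size_nonneg p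
  have h : ∀ a' ∈ Finset.univ, ‖kineticSymbol Ω p a a' * c a'‖ ≤ 2 * Real.pi / Ω * size p * K := by
    intro a' _
    rw [norm_mul]
    exact mul_le_mul (hent a') (hc a') (norm_nonneg _) (by positivity)
  refine (norm_sum_le _ _).trans ((Finset.sum_le_card_nsmul _ _ _ h).trans ?_)
  rw [Finset.card_univ, Fintype.card_prod, Fintype.card_fin, nsmul_eq_mul]
  apply le_of_eq
  push_cast
  ring

/-- The defect of the discrete kinetic term on an unresolved plane wave. -/
theorem norm_kinetic_defect_le (hΩ : 0 < Ω) (m e : ℝ) (φ : Space → ℝ) (A : Space → Fin 3 → ℝ)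
    {p : Fin 3 → ℤ} (hp : (2 : ℝ) ^ q ≤ 2 * size p) {c : SpinIdx → ℂ} {K : ℝ}
    (hc : ∀ a, ‖c a‖ ≤ K) :
    ‖sampleState Ω q (mode Ω p (kineticSymbol Ω p *ᵥ c))
        - act (hamTerm Ω m e φ A q 0) (sampleState Ω q (mode Ω p c))‖
      ≤ 28 * Real.pi / Ω * Real.sqrt Ω ^ 3 * size p * K := by
  have hK : 0 ≤ K := (norm_nonneg _).trans (hc (0, 0))
  have hm : ∀ {c : SpinIdx → ℂ} {K : ℝ}, (∀ a, ‖c a‖ ≤ K) → ∀ x a, ‖mode Ω p c x a‖ ≤ K := by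
    intro c K hc x a
    rw [mode, Pi.smul_apply, smul_eq_mul, norm_mul, norm_planeWave, one_mul]
    exact hc a
  refine (norm_sub_le _ _).trans ?_
  have h1 := norm_sampleState_le (q := q) hΩ (hm (norm_kineticSymbol_mulVec_le hΩ p hc))
  have h2 := norm_sampleState_le (q := q) hΩ (hm hc)
  have h3 := norm_act_le (hamTerm Ω m e φ A q 0) (sampleState Ω q (mode Ω p c))
  have h4 := norm_hamTerm_zero_le (q := q) Ω m e φ A hΩ
  have h5 := h3.trans (mul_le_mul h4 h2 (norm_nonneg _) (by positivity))
  have h6 : 3 * (Real.pi / Ω * 2 ^ q) * (2 * Real.sqrt Ω ^ 3 * K)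
      ≤ 3 * (Real.pi / Ω * (2 * size p)) * (2 * Real.sqrt Ω ^ 3 * K) := by gcongr
  -- The constant is `28 = 16 + 12`: the exact symbol contributes `2 · 8` and the discrete kinetic
  -- term `3 · 2 · 2`.
  refine (add_le_add h1 (h5.trans h6)).trans (le_of_eq ?_)
  ring

/-- The interpolation error of an unresolved plane wave. -/
theorem norm_interpolation_defect_le (hΩ : 0 < Ω) {p : Fin 3 → ℤ}
    (hp : (2 : ℝ) ^ q ≤ 2 * size p) {c : SpinIdx → ℂ} {K : ℝ} (hc : ∀ a, ‖c a‖ ≤ K) (x : Space)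
    (a : SpinIdx) :
    ‖interpolant Ω (sampleState Ω q (mode Ω p c)) x a - mode Ω p c x a‖
      ≤ (64 * size p ^ 3 + 1) * K := by
  have hK : 0 ≤ K := (norm_nonneg _).trans (hc (0, 0))
  have hs : (0 : ℝ) < Real.sqrt Ω := Real.sqrt_pos.2 hΩ
  have hm : ∀ x a, ‖mode Ω p c x a‖ ≤ K := by
    intro x a
    rw [mode, Pi.smul_apply, smul_eq_mul, norm_mul, norm_planeWave, one_mul]
    exact hc a
  refine (norm_sub_le _ _).trans ?_
  have h1 := norm_interpolant_le hΩ (sampleState Ω q (mode Ω p c)) x a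
  have h2 := norm_sampleState_le (q := q) hΩ hm
  have hs0 := size_nonneg p
  have h3 : (Real.sqrt Ω ^ 3)⁻¹ * (4 * (2 ^ q) ^ 3 * ‖sampleState Ω q (mode Ω p c)‖)
      ≤ (Real.sqrt Ω ^ 3)⁻¹ * (4 * (2 * size p) ^ 3 * (2 * Real.sqrt Ω ^ 3 * K)) := by gcongr
  refine (add_le_add (h1.trans h3) (hm x a)).trans (le_of_eq ?_)
  field_simp
  ring

end Modes

/-! ## Plane waves on the cell -/

section Cell

open MeasureTheory

variable {Ω : ℝ}

theorem integral_character (hΩ : 0 < Ω) (d : ℤ) :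
    ∫ x in Set.Ico (-(Ω / 2)) (Ω / 2), exp (I * ((2 * Real.pi * (d : ℝ) / Ω * x : ℝ) : ℂ))
      = if d = 0 then (Ω : ℂ) else 0 := by
  rw [integral_Ico_eq_integral_Ioo, ← integral_Ioc_eq_integral_Ioo,
    ← intervalIntegral.integral_of_le (by linarith)]
  split_ifs with h
  · subst h; simp
  · have hc : (I * (2 * Real.pi * d / Ω : ℂ)) ≠ 0 := by
      have : (d : ℂ) ≠ 0 := by exact_mod_cast h
      have h1 : (Ω : ℂ) ≠ 0 := by exact_mod_cast hΩ.ne'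
      have h2 : (Real.pi : ℂ) ≠ 0 := by exact_mod_cast Real.pi_ne_zero
      simp [*]
    have h1 : (Ω : ℂ) ≠ 0 := by exact_mod_cast hΩ.ne'
    have e : ∀ x : ℝ, exp (I * ((2 * Real.pi * (d : ℝ) / Ω * x : ℝ) : ℂ))
        = exp ((I * (2 * Real.pi * d / Ω : ℂ)) * x) := by
      intro x; congr 1; push_cast; ring
    simp only [e]
    rw [integral_exp_mul_complex hc]
    have : exp (I * (2 * Real.pi * d / Ω : ℂ) * ((Ω / 2 : ℝ) : ℂ))
        = exp (I * (2 * Real.pi * d / Ω : ℂ) * ((-(Ω / 2) : ℝ) : ℂ)) := by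
      rw [Complex.exp_eq_exp_iff_exists_int]
      refine ⟨d, ?_⟩
      push_cast
      field_simp
      ring
    rw [this, sub_self, zero_div]

theorem planeWave_eq_prod (p : Fin 3 → ℤ) (x : Space) :
    planeWave Ω p x = ∏ i, exp (I * ((2 * Real.pi * (p i : ℝ) / Ω * x i : ℝ) : ℂ)) := by
  rw [planeWave, ← Complex.exp_sum, Complex.ofReal_sum, Finset.mul_sum]

theorem volume_restrict_cell : (volume : Measure Space).restrict (cell Ω)
    = Measure.pi fun _ => volume.restrict (Set.Ico (-(Ω / 2)) (Ω / 2)) := by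
  rw [cell, volume_pi, Measure.restrict_pi_pi]

theorem integral_planeWave (hΩ : 0 < Ω) (p : Fin 3 → ℤ) :
    ∫ x in cell Ω, planeWave Ω p x = if p = 0 then ((Ω ^ 3 : ℝ) : ℂ) else 0 := by
  rw [volume_restrict_cell]
  simp only [planeWave_eq_prod]
  rw [integral_fintype_prod_eq_prod (𝕜 := ℂ)
    (fun i (y : ℝ) => exp (I * ((2 * Real.pi * (p i : ℝ) / Ω * y : ℝ) : ℂ)))]
  simp only [integral_character hΩ]
  split_ifs with h0
  · subst h0; simp
  · obtain ⟨i, hi⟩ := Function.ne_iff.1 h0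
    exact Finset.prod_eq_zero (Finset.mem_univ i) (if_neg hi)

theorem continuous_planeWave (p : Fin 3 → ℤ) : Continuous (planeWave Ω p) := by
  unfold planeWave
  fun_prop

theorem measurableSet_cell : MeasurableSet (cell Ω) :=
  MeasurableSet.univ_pi fun _ => measurableSet_Ico

theorem integrableOn_cell {E : Type} [NormedAddCommGroup E] {f : Space → E} (hf : Continuous f) :
    IntegrableOn f (cell Ω) := by
  refine IntegrableOn.mono_set (t := Set.Icc (fun _ => -(Ω / 2)) (fun _ => Ω / 2))
    (hf.continuousOn.integrableOn_compact isCompact_Icc) ?_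
  intro x hx
  rw [cell, Set.mem_univ_pi] at hx
  exact ⟨fun i => (hx i).1, fun i => (hx i).2.le⟩

theorem volume_cell (hΩ : 0 < Ω) : volume (cell Ω) = ENNReal.ofReal (Ω ^ 3) := by
  rw [cell, volume_pi_pi]
  simp only [Real.volume_Ico]
  rw [Finset.prod_const, ENNReal.ofReal_pow hΩ.le]
  simp

theorem planeWave_mul_conj (p p' : Fin 3 → ℤ) (x : Space) :
    planeWave Ω p x * (starRingEnd ℂ) (planeWave Ω p' x) = planeWave Ω (p - p') x := by
  rw [planeWave, planeWave, planeWave, ← Complex.exp_conj, ← Complex.exp_add]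
  congr 1
  rw [map_mul, Complex.conj_I, Complex.conj_ofReal, neg_mul, ← sub_eq_add_neg, ← mul_sub,
    ← Complex.ofReal_sub, ← Finset.sum_sub_distrib]
  congr 2
  congr 1
  funext i
  rw [Pi.sub_apply]
  push_cast
  ring

/-- Parseval's identity for trigonometric polynomials. -/
theorem integral_norm_sq_trigPoly (hΩ : 0 < Ω) {ι : Type} (s : Finset ι) (p : ι → Fin 3 → ℤ)
    (hp : ∀ b ∈ s, ∀ b' ∈ s, p b = p b' → b = b') (z : ι → ℂ) :
    ∫ x in cell Ω, ‖∑ b ∈ s, z b * planeWave Ω (p b) x‖ ^ 2 = Ω ^ 3 * ∑ b ∈ s, ‖z b‖ ^ 2 := by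
  classical
  have h1 : ∀ x, (((‖∑ b ∈ s, z b * planeWave Ω (p b) x‖ ^ 2 : ℝ)) : ℂ)
      = ∑ b ∈ s, ∑ b' ∈ s, (z b * (starRingEnd ℂ) (z b')) * planeWave Ω (p b - p b') x := by
    intro x
    rw [Complex.ofReal_pow, ← Complex.mul_conj', map_sum, Finset.sum_mul_sum]
    refine Finset.sum_congr rfl fun b _ => Finset.sum_congr rfl fun b' _ => ?_
    rw [map_mul, mul_mul_mul_comm, planeWave_mul_conj]
  have hint : ∀ b b', IntegrableOn
      (fun x => (z b * (starRingEnd ℂ) (z b')) * planeWave Ω (p b - p b') x) (cell Ω) := fun b b' =>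
    integrableOn_cell (continuous_const.mul (continuous_planeWave _))
  apply Complex.ofReal_injective
  rw [← integral_complex_ofReal]
  simp only [h1]
  rw [integral_finsetSum _ (fun b _ => integrable_finsetSum _ fun b' _ => hint b b')]
  rw [Complex.ofReal_mul, Complex.ofReal_sum, Finset.mul_sum]
  refine Finset.sum_congr rfl fun b hb => ?_
  rw [integral_finsetSum _ (fun b' _ => hint b b')]
  simp only [integral_const_mul, integral_planeWave hΩ, sub_eq_zero]
  rw [Finset.sum_eq_single_of_mem b hb]
  · rw [if_pos rfl, Complex.mul_conj']
    push_cast; ring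
  · intro b' hb' hne
    rw [if_neg (fun h => hne (hp b hb b' hb' h).symm), mul_zero]

theorem continuous_interpolant {q : ℕ} (v : QState q) : Continuous (interpolant Ω v) := by
  classical
  refine continuous_pi fun a => ?_
  unfold interpolant
  refine continuous_const.mul (continuous_finsetSum _ fun b _ => ?_)
  split_ifs
  · exact continuous_const.mul (continuous_planeWave _)
  · exact continuous_const

/-- Trigonometric interpolation is isometric. -/
theorem cellNorm_interpolant (hΩ : 0 < Ω) {q : ℕ} (v : QState q) :
    cellNorm Ω (interpolant Ω v) = ‖v‖ := by
  classical
  have hs : (0 : ℝ) < Real.sqrt Ω := Real.sqrt_pos.2 hΩ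
  rw [← norm_act_of_unitary (fourierMatrix_mem_unitary q) v, cellNorm, EuclideanSpace.norm_eq]
  congr 1
  set w := act (fourierMatrix q) v with hw
  rw [integral_finsetSum]
  · have h : ∀ a, ∫ x in cell Ω, ‖interpolant Ω v x a‖ ^ 2
        = ∑ b : Reg q, if spin b = a then ‖w b‖ ^ 2 else 0 := by
      intro a
      have e : ∀ x, ‖interpolant Ω v x a‖ ^ 2
          = (Ω ^ 3)⁻¹ * ‖∑ b ∈ Finset.univ.filter (fun b : Reg q => spin b = a),
            w b * planeWave Ω (gridIdx b) x‖ ^ 2 := by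
        intro x
        rw [Finset.sum_filter, interpolant, norm_mul, mul_pow, Complex.norm_real,
          Real.norm_of_nonneg (by positivity), inv_pow, sqrt_pow_three_sq hΩ.le]
      simp only [e]
      rw [integral_const_mul, integral_norm_sq_trigPoly hΩ, Finset.sum_filter]
      · field_simp
      · intro b hb b' hb' h
        rw [Finset.mem_filter] at hb hb'
        exact spin_gridIdx_injective (hb.2.trans hb'.2.symm) h
    simp only [h]
    rw [Finset.sum_comm]
    simp
  · intro a _
    exact integrableOn_cell (((continuous_pi_iff.1 (continuous_interpolant v) a).norm).pow 2)

/-! ### `L²` estimates for continuous fields on the cell -/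

theorem memLp_cell {f : Space → EuclideanSpace ℂ SpinIdx} (hf : Continuous f) :
    MemLp f 2 (volume.restrict (cell Ω)) := by
  rw [memLp_two_iff_integrable_sq_norm hf.aestronglyMeasurable]
  exact integrableOn_cell (hf.norm.pow 2)

/-- Gives access to Minkowski's inequality for `cellNorm`; the fibre has to carry the Euclidean norm
for the two notions to coincide. -/
theorem cellNorm_eq_eLpNorm {f : Space → EuclideanSpace ℂ SpinIdx} (hf : Continuous f) :
    cellNorm Ω (fun x => (f x).ofLp) = (eLpNorm f 2 (volume.restrict (cell Ω))).toReal := by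
  rw [(memLp_cell hf).eLpNorm_eq_integral_rpow_norm (by norm_num) (by norm_num), cellNorm,
    Real.sqrt_eq_rpow, ENNReal.toReal_ofReal (by positivity)]
  norm_num [EuclideanSpace.norm_sq_eq]

theorem cellNorm_add_le {f g : Space → SpinIdx → ℂ} (hf : Continuous f) (hg : Continuous g) :
    cellNorm Ω (f + g) ≤ cellNorm Ω f + cellNorm Ω g := by
  have hf' : Continuous fun x => (WithLp.toLp 2 (f x) : EuclideanSpace ℂ SpinIdx) := by fun_prop
  have hg' : Continuous fun x => (WithLp.toLp 2 (g x) : EuclideanSpace ℂ SpinIdx) := by fun_prop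
  have ef := cellNorm_eq_eLpNorm (Ω := Ω) hf'
  have eg := cellNorm_eq_eLpNorm (Ω := Ω) hg'
  have efg := cellNorm_eq_eLpNorm (Ω := Ω) (hf'.add hg')
  have mf := (memLp_cell (Ω := Ω) hf')
  have mg := (memLp_cell (Ω := Ω) hg')
  have h := ENNReal.toReal_mono (ENNReal.add_ne_top.2 ⟨mf.eLpNorm_ne_top, mg.eLpNorm_ne_top⟩)
    (eLpNorm_add_le mf.1 mg.1 (by norm_num))
  rw [ENNReal.toReal_add mf.eLpNorm_ne_top mg.eLpNorm_ne_top] at h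
  rw [← ef, ← eg] at h
  refine le_trans (le_of_eq ?_) h
  exact efg

theorem cellNorm_le_of_bound (hΩ : 0 < Ω) {f : Space → SpinIdx → ℂ} (hf : Continuous f) {K : ℝ}
    (h : ∀ x a, ‖f x a‖ ≤ K) : cellNorm Ω f ≤ 2 * Real.sqrt Ω ^ 3 * K := by
  have hK : 0 ≤ K := (norm_nonneg _).trans (h 0 (0, 0))
  rw [cellNorm]
  refine Real.sqrt_le_iff.2 ⟨by positivity, ?_⟩
  have h1 : ∫ x in cell Ω, ∑ a, ‖f x a‖ ^ 2 ≤ ∫ x in cell Ω, (4 * K ^ 2 : ℝ) := by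
    refine setIntegral_mono_on (integrableOn_cell (by fun_prop)) (integrableOn_cell (by fun_prop))
      measurableSet_cell fun x _ => ?_
    have : ∀ a ∈ Finset.univ, ‖f x a‖ ^ 2 ≤ K ^ 2 := fun a _ => by gcongr; exact h x a
    refine (Finset.sum_le_card_nsmul _ _ _ this).trans (le_of_eq ?_)
    rw [Finset.card_univ, Fintype.card_prod, Fintype.card_fin, nsmul_eq_mul]
    norm_num
  refine h1.trans (le_of_eq ?_)
  rw [setIntegral_const, measureReal_def, volume_cell hΩ, ENNReal.toReal_ofReal (by positivity),
    smul_eq_mul]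
  rw [← sqrt_pow_three_sq hΩ.le]
  ring

end Cell

/-! ## Exponentially decaying Fourier series -/

section Tails

theorem summable_prod_pi {f : ℤ → ℝ} (h0 : ∀ x, 0 ≤ f x) (hf : Summable f) (n : ℕ) :
    Summable fun p : Fin n → ℤ => ∏ i, f (p i) := by
  induction n with
  | zero => exact Summable.of_finite
  | succ n ih =>
    rw [← (Fin.consEquiv fun _ => ℤ).summable_iff]
    have := hf.mul_of_nonneg ih h0 (fun p => Finset.prod_nonneg fun i _ => h0 _)
    convert this using 2 with x
    simp [Fin.prod_univ_succ, Fin.consEquiv]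

theorem summable_exp_neg_abs {δ : ℝ} (hδ : 0 < δ) :
    Summable fun x : ℤ => Real.exp (-(δ * |(x : ℝ)|)) := by
  have h : Summable fun n : ℕ => Real.exp (-(δ * n)) := by
    have := Real.summable_exp_nat_mul_iff.2 (neg_lt_zero.2 hδ)
    refine this.congr fun n => ?_
    congr 1; ring
  refine Summable.of_nat_of_neg ?_ ?_
  · simpa using h
  · simpa using h

/-- The weight that dominates polynomially growing symbols against exponential decay. -/
def decayWeight (δ : ℝ) (p : Fin 3 → ℤ) : ℝ := (1 + size p) ^ 3 * Real.exp (-(δ * size p))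

theorem decayWeight_nonneg (δ : ℝ) (p : Fin 3 → ℤ) : 0 ≤ decayWeight δ p := by
  have := size_nonneg p
  unfold decayWeight
  positivity

/-- From `1 + s ≤ (6/δ + 1) e^{δs/6}`, the cube of the polynomial weight consumes half of the
exponential decay. The other half is a product of three summable one-dimensional series. -/
theorem summable_decayWeight {δ : ℝ} (hδ : 0 < δ) : Summable (decayWeight δ) := by
  have h := (summable_prod_pi (fun x => (Real.exp_pos _).le)
    (summable_exp_neg_abs (half_pos hδ)) 3).mul_left ((6 / δ + 1) ^ 3)
  refine Summable.of_nonneg_of_le (decayWeight_nonneg δ) (fun p => ?_) h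
  have hs := size_nonneg p
  have e : ∏ i, Real.exp (-(δ / 2 * |(p i : ℝ)|)) = Real.exp (-(δ / 2 * size p)) := by
    rw [← Real.exp_sum, size, Finset.mul_sum, Finset.sum_neg_distrib]
  rw [e, decayWeight]
  have h1 : 1 + size p ≤ (6 / δ + 1) * Real.exp (δ / 6 * size p) := by
    have h2 := Real.add_one_le_exp (δ / 6 * size p)
    have h3 : size p = 6 / δ * (δ / 6 * size p) := by field_simp
    have h4 : (0 : ℝ) < 6 / δ := by positivity
    have h5 : 6 / δ * (δ / 6 * size p) ≤ 6 / δ * Real.exp (δ / 6 * size p) := by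
      gcongr; linarith
    have h6 : 1 ≤ Real.exp (δ / 6 * size p) := Real.one_le_exp (by positivity)
    nlinarith
  have h7 : (1 + size p) ^ 3 ≤ ((6 / δ + 1) * Real.exp (δ / 6 * size p)) ^ 3 := by gcongr
  have h8 : Real.exp (-(δ * size p))
      = Real.exp (-(δ / 2 * size p)) * Real.exp (-(δ / 2 * size p)) := by
    rw [← Real.exp_add]; congr 1; ring
  have h9 : Real.exp (δ / 6 * size p) ^ 3 * Real.exp (-(δ / 2 * size p)) = 1 := by
    rw [← Real.exp_nat_mul, ← Real.exp_add, Real.exp_eq_one_iff]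
    push_cast; ring
  calc (1 + size p) ^ 3 * Real.exp (-(δ * size p))
      ≤ ((6 / δ + 1) * Real.exp (δ / 6 * size p)) ^ 3 * Real.exp (-(δ * size p)) := by gcongr
    _ = (6 / δ + 1) ^ 3 * (Real.exp (δ / 6 * size p) ^ 3 * Real.exp (-(δ / 2 * size p)))
        * Real.exp (-(δ / 2 * size p)) := by rw [h8]; ring
    _ = _ := by rw [h9, mul_one]

/-- A series supported on unresolved momenta with exponentially decaying terms is exponentially
small in the number of grid points. -/
theorem norm_le_of_hasSum_tail {E : Type} [NormedAddCommGroup E] {q : ℕ} {ρ B : ℝ} (hρ : 0 < ρ)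
    (hB : 0 ≤ B) {g : (Fin 3 → ℤ) → E} {G : E} (hg : HasSum g G)
    (h0 : ∀ b : Reg q, g (gridIdx b) = 0)
    (h1 : ∀ p, (2 : ℝ) ^ q ≤ 2 * size p → ‖g p‖ ≤ B * decayWeight ρ p) :
    ‖G‖ ≤ B * Real.exp (-(ρ / 4 * 2 ^ q)) * ∑' p, decayWeight (ρ / 2) p := by
  have hs := (summable_decayWeight (half_pos hρ)).hasSum.mul_left
    (B * Real.exp (-(ρ / 4 * 2 ^ q)))
  refine hg.norm_le_of_bounded hs fun p => ?_
  have hw := decayWeight_nonneg (ρ / 2) p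
  by_cases hp : ∃ b : Reg q, gridIdx b = p
  · obtain ⟨b, rfl⟩ := hp
    rw [h0, norm_zero]
    positivity
  · push Not at hp
    have h2 := two_pow_le_of_not_grid hp
    refine (h1 p h2).trans ?_
    rw [mul_assoc]
    refine mul_le_mul_of_nonneg_left ?_ hB
    have hsz := size_nonneg p
    -- Half of the exponent pays for smallness, as `ρ/2 · size p ≥ ρ/4 · 2^q` off the grid, and the
    -- other half keeps the series summable.
    rw [decayWeight, decayWeight, mul_left_comm, ← Real.exp_add]
    gcongr
    have : (2 : ℝ) ^ q ≤ 2 * size p := h2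
    nlinarith

end Tails

/-! ## Sampling analytic fields -/

section Analytic

open Matrix

variable {Ω ρ M : ℝ} {q : ℕ}

theorem hasSum_sampleState {F : (Fin 3 → ℤ) → Space → SpinIdx → ℂ} {f : Space → SpinIdx → ℂ}
    (h : ∀ x, HasSum (fun p => F p x) (f x)) :
    HasSum (fun p => sampleState Ω q (F p)) (sampleState Ω q f) := by
  have h1 : HasSum (fun p => (sampleState Ω q (F p)).ofLp) (sampleState Ω q f).ofLp := by
    rw [Pi.hasSum]
    intro b
    simp only [sampleState_apply]
    exact (Pi.hasSum.1 (h (node Ω b)) (spin b)).mul_left _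
  exact h1.mapL (PiLp.continuousLinearEquiv 2 ℂ (fun _ : Reg q => ℂ)).symm.toContinuousLinearMap

theorem hasSum_act {ι : Type} (U : Matrix (Reg q) (Reg q) ℂ) {g : ι → QState q} {G : QState q}
    (h : HasSum g G) : HasSum (fun p => act U (g p)) (act U G) :=
  h.mapL (Matrix.toEuclideanCLM (n := Reg q) (𝕜 := ℂ) U)

theorem hasSum_interpolant {ι : Type} {g : ι → QState q} {G : QState q}
    (h : HasSum g G) (x : Space) (a : SpinIdx) :
    HasSum (fun p => interpolant Ω (g p) x a) (interpolant Ω G x a) := by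
  classical
  unfold interpolant
  refine HasSum.mul_left _ (hasSum_sum fun b _ => ?_)
  split_ifs
  · refine HasSum.mul_right _ ?_
    exact (hasSum_act (fourierMatrix q) h).mapL (EuclideanSpace.proj b : QState q →L[ℂ] ℂ)
  · exact hasSum_zero

theorem coeff_bound_nonneg {c : (Fin 3 → ℤ) → SpinIdx → ℂ}
    (hc : ∀ p a, ‖c p a‖ ≤ M * Real.exp (-(ρ * size p))) : 0 ≤ M := by
  have := (norm_nonneg _).trans (hc 0 (0, 0))
  exact nonneg_of_mul_nonneg_left this (Real.exp_pos _)

/-- The error of trigonometric interpolation of an analytic field. -/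
theorem norm_interpolant_sampleState_sub_le (hΩ : 0 < Ω) (hρ : 0 < ρ) {f : Space → SpinIdx → ℂ}
    (hf : AnalyticPeriodic Ω ρ M f) (x : Space) (a : SpinIdx) :
    ‖interpolant Ω (sampleState Ω q f) x a - f x a‖
      ≤ 65 * M * Real.exp (-(ρ / 4 * 2 ^ q)) * ∑' p, decayWeight (ρ / 2) p := by
  obtain ⟨c, hc, hs⟩ := hf
  have hM := coeff_bound_nonneg hc
  have h1 := hasSum_interpolant (Ω := Ω)
    (hasSum_sampleState (Ω := Ω) (q := q) (F := fun p => mode Ω p (c p)) hs) x a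
  have h2 := h1.sub (Pi.hasSum.1 (hs x) a)
  refine norm_le_of_hasSum_tail (q := q) hρ (by positivity) h2 (fun b => ?_) fun p hp => ?_
  · rw [interpolant_sample_mode hΩ]
    simp [mode]
  · refine (norm_interpolation_defect_le hΩ hp (hc p) x a).trans ?_
    have hsz := size_nonneg p
    rw [decayWeight]
    have : 64 * size p ^ 3 + 1 ≤ 65 * (1 + size p) ^ 3 := by
      have h3 : size p ^ 3 ≤ (1 + size p) ^ 3 := by gcongr; linarith
      have h4 : 1 ≤ (1 + size p) ^ 3 := one_le_pow₀ (by linarith)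
      linarith
    have h5 : 0 ≤ M * Real.exp (-(ρ * size p)) := by positivity
    calc _ ≤ (65 * (1 + size p) ^ 3) * (M * Real.exp (-(ρ * size p))) := by
          exact mul_le_mul_of_nonneg_right this h5
      _ = _ := by ring

theorem planeWave_line (p : Fin 3 → ℤ) (x : Space) (i : Fin 3) (s : ℝ) :
    planeWave Ω p (x + s • Pi.single i 1)
      = planeWave Ω p x * exp (I * ((2 * Real.pi * (p i : ℝ) / Ω : ℝ) : ℂ) * s) := by
  rw [planeWave, planeWave, ← Complex.exp_add]
  congr 1
  rw [mul_assoc, ← mul_add, ← Complex.ofReal_mul, ← Complex.ofReal_add]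
  congr 2
  have : ∀ j, 2 * Real.pi * (p j : ℝ) / Ω * (x + s • (Pi.single i 1 : Space)) j
      = 2 * Real.pi * (p j : ℝ) / Ω * x j + if j = i then 2 * Real.pi * (p j : ℝ) / Ω * s else 0 := by
    intro j
    rw [Pi.add_apply, Pi.smul_apply, Pi.single_apply]
    split_ifs <;> simp [mul_add]
  simp only [this, Finset.sum_add_distrib]
  simp

/-- Termwise differentiation of an exponentially decaying Fourier series. -/
theorem hasSum_fderiv (hΩ : 0 < Ω) (hρ : 0 < ρ) {f : Space → SpinIdx → ℂ}
    {c : (Fin 3 → ℤ) → SpinIdx → ℂ} (hc : ∀ p a, ‖c p a‖ ≤ M * Real.exp (-(ρ * size p)))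
    (hs : ∀ x, HasSum (fun p => planeWave Ω p x • c p) (f x)) (hf : Differentiable ℝ f)
    (x : Space) (i : Fin 3) :
    HasSum (fun p => (I * ((2 * Real.pi * (p i : ℝ) / Ω : ℝ) : ℂ)) • planeWave Ω p x • c p)
      (fderiv ℝ f x (Pi.single i 1)) := by
  have hM := coeff_bound_nonneg hc
  set k : (Fin 3 → ℤ) → ℂ := fun p => I * ((2 * Real.pi * (p i : ℝ) / Ω : ℝ) : ℂ) with hk
  let g : (Fin 3 → ℤ) → ℝ → SpinIdx → ℂ := fun p s => planeWave Ω p (x + s • Pi.single i 1) • c p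
  let g' : (Fin 3 → ℤ) → ℝ → SpinIdx → ℂ := fun p s => k p • g p s
  let u : (Fin 3 → ℤ) → ℝ := fun p => 2 * Real.pi / Ω * M * decayWeight ρ p
  have hu : Summable u := (summable_decayWeight hρ).mul_left _
  have hd : ∀ p s, HasDerivAt (g p) (g' p s) s := by
    intro p s
    have h1 : HasDerivAt (fun s : ℝ => exp (k p * s)) (exp (k p * s) * k p) s := by
      have := ((hasDerivAt_id s).ofReal_comp.const_mul (k p)).cexp
      simpa using this
    have h2 := (h1.const_mul (planeWave Ω p x)).smul_const (c p)
    have e : g p = fun s : ℝ => (planeWave Ω p x * exp (k p * s)) • c p := by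
      funext s; simp only [g, planeWave_line, hk]
    simp only [g', e]
    refine h2.congr_deriv ?_
    rw [smul_smul]
    congr 1; ring
  have hb : ∀ p s, ‖g' p s‖ ≤ u p := by
    intro p s
    have hsz := size_nonneg p
    simp only [g', g, norm_smul, norm_planeWave, one_mul]
    have h1 : ‖k p‖ ≤ 2 * Real.pi / Ω * size p := by
      rw [hk]
      simp only [norm_mul, Complex.norm_I, one_mul, Complex.norm_real, Real.norm_eq_abs]
      rw [abs_div, abs_mul, abs_of_pos hΩ, abs_of_pos Real.two_pi_pos]
      have := abs_le_size p i
      calc 2 * Real.pi * |(p i : ℝ)| / Ω ≤ 2 * Real.pi * size p / Ω := by gcongr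
        _ = _ := by ring
    have h2 : ‖c p‖ ≤ M * Real.exp (-(ρ * size p)) :=
      (pi_norm_le_iff_of_nonneg (by positivity)).2 (hc p)
    refine (mul_le_mul h1 h2 (norm_nonneg _) (by positivity)).trans ?_
    have h3 : size p ≤ (1 + size p) ^ 3 := by
      have : 1 + size p ≤ (1 + size p) ^ 3 := le_self_pow₀ (by linarith) (by norm_num)
      linarith
    have : 0 ≤ 2 * Real.pi / Ω * M * Real.exp (-(ρ * size p)) := by positivity
    simp only [u, decayWeight]
    nlinarith
  have hsum : ∀ s, HasSum (fun p => g p s) (f (x + s • Pi.single i 1)) := fun s => hs _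
  -- On a coordinate line the series depends on one real variable, and its differentiated terms have
  -- a summable majorant. Differentiability of `f` serves only to identify the resulting line
  -- derivative with `fderiv`.
  have h1 := hasDerivAt_tsum (y₀ := 0) hu hd hb (hsum 0).summable 0
  have e1 : (fun s => ∑' p, g p s) = fun s : ℝ => f (x + s • Pi.single i 1) :=
    funext fun s => (hsum s).tsum_eq
  rw [e1] at h1
  have h2 : HasDerivAt (fun s : ℝ => f (x + s • Pi.single i 1))
      (fderiv ℝ f x (Pi.single i 1)) 0 := by
    have h3 : HasDerivAt (fun s : ℝ => x + s • (Pi.single i 1 : Space)) (Pi.single i 1) 0 := by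
      simpa using ((hasDerivAt_id (0 : ℝ)).smul_const (Pi.single i 1 : Space)).const_add x
    have h4 : HasFDerivAt f (fderiv ℝ f x) (x + (0 : ℝ) • (Pi.single i 1 : Space)) := by
      simpa using (hf x).hasFDerivAt
    exact h4.comp_hasDerivAt (0 : ℝ) h3
  have h3 : HasSum (fun p => g' p 0) (∑' p, g' p 0) :=
    (Summable.of_norm_bounded hu fun p => hb p 0).hasSum
  rw [h1.unique h2] at h3
  simp only [g', g, zero_smul, add_zero] at h3
  exact h3

/-- The kinetic term `-i α · ∇`. -/
def kineticField (f : Space → SpinIdx → ℂ) (x : Space) : SpinIdx → ℂ :=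
  ∑ i, (diracAlpha i).mulVec ((-I) • fderiv ℝ f x (Pi.single i 1))

theorem hasSum_kineticField (hΩ : 0 < Ω) (hρ : 0 < ρ) {f : Space → SpinIdx → ℂ}
    {c : (Fin 3 → ℤ) → SpinIdx → ℂ} (hc : ∀ p a, ‖c p a‖ ≤ M * Real.exp (-(ρ * size p)))
    (hs : ∀ x, HasSum (fun p => planeWave Ω p x • c p) (f x)) (hf : Differentiable ℝ f)
    (x : Space) :
    HasSum (fun p => mode Ω p (kineticSymbol Ω p *ᵥ c p) x) (kineticField f x) := by
  have h : ∀ i, HasSum (fun p => (diracAlpha i).mulVec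
      ((-I) • (I * ((2 * Real.pi * (p i : ℝ) / Ω : ℝ) : ℂ)) • planeWave Ω p x • c p))
      ((diracAlpha i).mulVec ((-I) • fderiv ℝ f x (Pi.single i 1))) := fun i =>
    ((hasSum_fderiv hΩ hρ hc hs hf x i).const_smul (-I)).mapL
      (LinearMap.toContinuousLinearMap (diracAlpha i).mulVecLin)
  have h2 := hasSum_sum fun i (_ : i ∈ Finset.univ) => h i
  have e : (fun p => mode Ω p (kineticSymbol Ω p *ᵥ c p) x) = fun p => ∑ i, (diracAlpha i).mulVec
      ((-I) • (I * ((2 * Real.pi * (p i : ℝ) / Ω : ℝ) : ℂ)) • planeWave Ω p x • c p) := by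
    funext p
    rw [mode, kineticSymbol, sum_mulVec, Finset.smul_sum]
    refine Finset.sum_congr rfl fun i _ => ?_
    rw [smul_mulVec, mulVec_smul, mulVec_smul, mulVec_smul, smul_smul, smul_smul, smul_smul]
    congr 1
    linear_combination (planeWave Ω p x * ((2 * Real.pi * (p i : ℝ) / Ω : ℝ) : ℂ)) * I_mul_I
  rw [e]
  exact h2

/-- The consistency error of the discrete kinetic term on an analytic field. -/
theorem norm_kinetic_consistency_le (hΩ : 0 < Ω) (hρ : 0 < ρ) (m e : ℝ) (φ : Space → ℝ)
    (A : Space → Fin 3 → ℝ) {f : Space → SpinIdx → ℂ} (hf : AnalyticPeriodic Ω ρ M f)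
    (hd : Differentiable ℝ f) :
    ‖sampleState Ω q (kineticField f) - act (hamTerm Ω m e φ A q 0) (sampleState Ω q f)‖
      ≤ 28 * Real.pi / Ω * Real.sqrt Ω ^ 3 * M * Real.exp (-(ρ / 4 * 2 ^ q))
        * ∑' p, decayWeight (ρ / 2) p := by
  obtain ⟨c, hc, hs⟩ := hf
  have hM := coeff_bound_nonneg hc
  have h1 := hasSum_sampleState (Ω := Ω) (q := q) (hasSum_kineticField hΩ hρ hc hs hd)
  have h2 := hasSum_act (hamTerm Ω m e φ A q 0)
    (hasSum_sampleState (Ω := Ω) (q := q) (F := fun p => mode Ω p (c p)) hs)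
  refine norm_le_of_hasSum_tail (q := q) hρ (by positivity) (h1.sub h2) (fun b => ?_)
    fun p hp => ?_
  · rw [hamTerm_zero_sample_mode hΩ, sub_self]
  · refine (norm_kinetic_defect_le hΩ m e φ A hp (hc p)).trans ?_
    have hsz := size_nonneg p
    rw [decayWeight]
    have h3 : size p ≤ (1 + size p) ^ 3 := by
      have : 1 + size p ≤ (1 + size p) ^ 3 := le_self_pow₀ (by linarith) (by norm_num)
      linarith
    have : 0 ≤ 28 * Real.pi / Ω * Real.sqrt Ω ^ 3 * M * Real.exp (-(ρ * size p)) := by positivity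
    have h4 := mul_le_mul_of_nonneg_right h3 this
    change 28 * Real.pi / Ω * Real.sqrt Ω ^ 3 * size p * (M * Real.exp (-(ρ * size p))) ≤ _
    linarith

end Analytic

/-! ## Comparison with the discrete evolution -/

section Duhamel

open Matrix

variable {q : ℕ}

/-- Duhamel's estimate for an approximate solution of a discrete Schrödinger equation. -/
theorem norm_propagator_sub_le {H : Matrix (Reg q) (Reg q) ℂ} (hH : H.IsHermitian)
    (v d : ℝ → QState q) (T δ : ℝ)
    (hv : ∀ t ∈ Set.uIcc 0 T, ∀ b, HasDerivWithinAt (fun s => (v s).ofLp b)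
      ((-I) * ((act H (v t)).ofLp b + (d t).ofLp b)) (Set.uIcc 0 T) t)
    (hd : ∀ t ∈ Set.uIcc 0 T, ‖d t‖ ≤ δ) :
    ‖act (propagator H T) (v 0) - v T‖ ≤ δ * |T| := by
  set V := (hH.eigenvectorUnitary : Matrix (Reg q) (Reg q) ℂ) with hV
  have hVV : V * Vᴴ = 1 := mem_unitaryGroup_iff.1 hH.eigenvectorUnitary.2
  have hVV' : Vᴴ * V = 1 := mem_unitaryGroup_iff'.1 hH.eigenvectorUnitary.2
  have hVu : Vᴴ ∈ unitaryGroup (Reg q) ℂ := Unitary.star_mem hH.eigenvectorUnitary.2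
  set μ := hH.eigenvalues with hμ
  have hcomm : Vᴴ * H = diagonal (fun b => (μ b : ℂ)) * Vᴴ := by
    have h := hH.spectral_theorem
    rw [Unitary.conjStarAlgAut_apply, star_eq_conjTranspose] at h
    conv_lhs => rw [h]
    rw [← hV, mul_assoc, ← mul_assoc, hVV', one_mul]
    rfl
  -- Interaction picture: `X t` is `Vᴴ e^{itH}`, unitary and diagonal in the eigenbasis up to `Vᴴ`.
  -- The derivative of `X t` applied to `v t` contains the source alone, so the mean value
  -- inequality finishes the estimate.
  let X : ℝ → Matrix (Reg q) (Reg q) ℂ := fun t => phaseMatrix (fun b => t * μ b) * Vᴴ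
  have hX : ∀ t, X t ∈ unitaryGroup (Reg q) ℂ := fun t =>
    mul_mem (phaseMatrix_mem_unitary _) hVu
  have hXapply : ∀ t (y : QState q) b,
      (act (X t) y).ofLp b = exp (I * ((t * μ b : ℝ) : ℂ)) * (Vᴴ *ᵥ y.ofLp) b := by
    intro t y b
    simp only [act, X, phaseMatrix]
    rw [← mulVec_mulVec, mulVec_diagonal]
  let w : ℝ → QState q := fun t => act (X t) (v t)
  have hw : ∀ t ∈ Set.uIcc 0 T,
      HasDerivWithinAt w (-I • act (X t) (d t)) (Set.uIcc 0 T) t := by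
    intro t ht
    have hy : ∀ b, HasDerivWithinAt (fun s => (Vᴴ *ᵥ (v s).ofLp) b)
        ((Vᴴ *ᵥ (fun b' => (-I) * ((act H (v t)).ofLp b' + (d t).ofLp b'))) b)
        (Set.uIcc 0 T) t := by
      intro b
      simp only [mulVec, dotProduct]
      exact HasDerivWithinAt.fun_sum fun b' _ => (hv t ht b').const_mul _
    have hc : ∀ b, HasDerivWithinAt (fun s => (w s).ofLp b)
        ((-I • act (X t) (d t)).ofLp b) (Set.uIcc 0 T) t := by
      intro b
      simp only [w, hXapply]
      have he : HasDerivWithinAt (fun s : ℝ => exp (I * ((s * μ b : ℝ) : ℂ)))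
          (exp (I * ((t * μ b : ℝ) : ℂ)) * (I * μ b)) (Set.uIcc 0 T) t := by
        have h1 : HasDerivAt (fun s : ℝ => I * ((s * μ b : ℝ) : ℂ)) (I * μ b) t := by
          have := (((hasDerivAt_id t).mul_const (μ b)).ofReal_comp).const_mul I
          simpa using this
        exact h1.cexp.hasDerivWithinAt
      refine (he.mul (hy b)).congr_deriv ?_
      have e1 : (fun b' => (-I) * ((act H (v t)).ofLp b' + (d t).ofLp b'))
          = (-I) • (H *ᵥ (v t).ofLp + (d t).ofLp) := by
        funext b'; simp [act]
      rw [e1, mulVec_smul, mulVec_add, mulVec_mulVec, hcomm, ← mulVec_mulVec, Pi.smul_apply,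
        Pi.add_apply, mulVec_diagonal, PiLp.smul_apply, hXapply, smul_eq_mul, smul_eq_mul]
      ring
    have := hasDerivWithinAt_pi.2 hc
    exact (PiLp.continuousLinearEquiv 2 ℝ (fun _ : Reg q => ℂ)).symm.toContinuousLinearMap.hasFDerivAt.comp_hasDerivWithinAt t this
  have hbound : ∀ t ∈ Set.uIcc 0 T, ‖-I • act (X t) (d t)‖ ≤ δ := by
    intro t ht
    rw [norm_smul, norm_neg, Complex.norm_I, one_mul, norm_act_of_unitary (hX t)]
    exact hd t ht
  have hmv := Convex.norm_image_sub_le_of_norm_hasDerivWithin_le hw hbound (convex_uIcc 0 T)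
    Set.left_mem_uIcc Set.right_mem_uIcc
  rw [sub_zero, Real.norm_eq_abs] at hmv
  have h0 : w 0 = act (X T) (act (propagator H T) (v 0)) := by
    have e : X T * propagator H T = X 0 := by
      rw [propagator_eq_conj hH]
      simp only [X, ← hV, ← hμ]
      calc phaseMatrix (fun b => T * μ b) * Vᴴ * (V * phaseMatrix (fun b => -T * μ b) * Vᴴ)
          = phaseMatrix (fun b => T * μ b) * (Vᴴ * V) * phaseMatrix (fun b => -T * μ b) * Vᴴ := by
            simp only [mul_assoc]
        _ = phaseMatrix (fun b => 0 * μ b) * Vᴴ := by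
            rw [hVV', mul_one, ← phaseMatrix_add]
            congr 2
            funext b
            simp
    rw [← act_mul, e]
  rw [norm_sub_rev, ← norm_act_of_unitary (hX T), act_sub, ← h0]
  exact hmv

variable {Ω ρ M m e T : ℝ} {φ : Space → ℝ} {A : Space → Fin 3 → ℝ} {ψ : ℝ → Space → SpinIdx → ℂ}

/-- The discretized Hamiltonian applied to samples of a differentiable field. -/
theorem sample_diracHamiltonian (f : Space → SpinIdx → ℂ) :
    sampleState Ω q (diracHamiltonian m e φ A f)
      = act (∑ j, hamTerm Ω m e φ A q j) (sampleState Ω q f)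
        + (sampleState Ω q (kineticField f)
          - act (hamTerm Ω m e φ A q 0) (sampleState Ω q f)) := by
  have hsplit : act (∑ j, hamTerm Ω m e φ A q j) (sampleState Ω q f)
      = act (hamTerm Ω m e φ A q 0) (sampleState Ω q f)
        + act (hamTerm Ω m e φ A q 1) (sampleState Ω q f)
        + act (hamTerm Ω m e φ A q 2) (sampleState Ω q f)
        + act (hamTerm Ω m e φ A q 3) (sampleState Ω q f) := by
    simp only [act, Fin.sum_univ_four, add_mulVec, WithLp.toLp_add]
  -- Mass and potentials act pointwise and hence commute with sampling; only the kinetic defect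
  -- survives.
  rw [hsplit, hamTerm_one, hamTerm_two, hamTerm_three]
  ext b
  simp only [PiLp.add_apply, PiLp.sub_apply, act, mulVec_diagonal, localMatrix_mulVec,
    sampleState_apply, node_congr Ω (gridIdx_withSpin b _), spin_withSpin]
  have hA : ∑ a, (∑ i, ((e * A (node Ω b) i : ℝ) : ℂ) • diracAlpha i) (spin b) a
        * ((((Real.sqrt (Ω / 2 ^ q)) ^ 3 : ℝ) : ℂ) * f (node Ω b) a)
      = (((Real.sqrt (Ω / 2 ^ q)) ^ 3 : ℝ) : ℂ)
        * (∑ i, ((e * A (node Ω b) i : ℝ) : ℂ) • (diracAlpha i *ᵥ f (node Ω b))) (spin b) := by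
    simp only [← smul_mulVec, ← sum_mulVec]
    rw [mulVec, dotProduct, Finset.mul_sum]
    exact Finset.sum_congr rfl fun a _ => by ring
  have hβ : (diracBeta *ᵥ f (node Ω b)) (spin b)
      = (-1) ^ (b (Sum.inl 0) : ℕ) * f (node Ω b) (spin b) := by
    rw [diracBeta_eq_diagonal, mulVec_diagonal]
    rfl
  rw [hA]
  simp only [diracHamiltonian, kineticField, Pi.add_apply, Pi.sub_apply, Pi.smul_apply,
    mulVec_add, mulVec_smul, Finset.sum_add_distrib, hβ, smul_eq_mul]
  push_cast
  ring

/-- Sampled solutions of the Dirac equation follow the discretized evolution. -/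
theorem IsDiracSolution.norm_propagator_sub_le (hΩ : 0 < Ω) (hρ : 0 < ρ)
    (h : IsDiracSolution Ω m e φ A ρ M T ψ) :
    ‖act (propagator (∑ j, hamTerm Ω m e φ A q j) T) (sampleState Ω q (ψ 0))
        - sampleState Ω q (ψ T)‖
      ≤ 28 * Real.pi / Ω * Real.sqrt Ω ^ 3 * M * Real.exp (-(ρ / 4 * 2 ^ q))
        * (∑' p, decayWeight (ρ / 2) p) * |T| := by
  have hS : (∑ j, hamTerm Ω m e φ A q j).IsHermitian := by
    simp only [IsHermitian, conjTranspose_sum, fun j => (hamTerm_isHermitian (q := q) Ω m e φ A j).eq]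
  refine DiracSim.norm_propagator_sub_le hS (fun t => sampleState Ω q (ψ t))
    (fun t => sampleState Ω q (kineticField (ψ t))
      - act (hamTerm Ω m e φ A q 0) (sampleState Ω q (ψ t))) T _ ?_ ?_
  · intro t ht b
    have h1 := hasDerivWithinAt_pi.1 (h.equation t ht (node Ω b)) (spin b)
    have h2 := h1.const_mul (((Real.sqrt (Ω / 2 ^ q)) ^ 3 : ℝ) : ℂ)
    refine h2.congr_deriv ?_
    rw [← PiLp.add_apply, ← sample_diracHamiltonian, sampleState_apply, Pi.smul_apply, smul_eq_mul]
    ring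
  · intro t ht
    exact norm_kinetic_consistency_le hΩ hρ m e φ A (h.analytic t ht) (h.differentiable t ht)

/-- The interpolation error of a solution is small in `L²`. -/
theorem IsDiracSolution.cellNorm_interpolant_sub_le (hΩ : 0 < Ω) (hρ : 0 < ρ)
    (h : IsDiracSolution Ω m e φ A ρ M T ψ) {t : ℝ} (ht : t ∈ Set.uIcc 0 T) :
    cellNorm Ω (interpolant Ω (sampleState Ω q (ψ t)) - ψ t)
      ≤ 130 * Real.sqrt Ω ^ 3 * M * Real.exp (-(ρ / 4 * 2 ^ q))
        * ∑' p, decayWeight (ρ / 2) p := by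
  have hc := (h.differentiable t ht).continuous
  refine (cellNorm_le_of_bound hΩ ((continuous_interpolant _).sub hc)
    (norm_interpolant_sampleState_sub_le hΩ hρ (h.analytic t ht))).trans (le_of_eq ?_)
  ring

theorem cellNorm_sub_comm (f g : Space → SpinIdx → ℂ) : cellNorm Ω (f - g) = cellNorm Ω (g - f) := by
  unfold cellNorm
  simp only [Pi.sub_apply, norm_sub_rev]

/-- The samples of a normalized solution have almost unit length. -/
theorem IsDiracSolution.abs_norm_sampleState_sub_one_le (hΩ : 0 < Ω) (hρ : 0 < ρ)
    (h : IsDiracSolution Ω m e φ A ρ M T ψ) :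
    |‖sampleState Ω q (ψ 0)‖ - 1|
      ≤ 130 * Real.sqrt Ω ^ 3 * M * Real.exp (-(ρ / 4 * 2 ^ q))
        * ∑' p, decayWeight (ρ / 2) p := by
  have hc := (h.differentiable 0 Set.left_mem_uIcc).continuous
  have hi := continuous_interpolant (Ω := Ω) (sampleState Ω q (ψ 0))
  refine le_trans ?_ (h.cellNorm_interpolant_sub_le (q := q) hΩ hρ Set.left_mem_uIcc)
  -- Interpolation is isometric, so the sample norm is an `L²` norm and can be compared with the
  -- norm `1` of the field by the triangle inequality in both directions.
  have h1 := cellNorm_add_le (Ω := Ω) (hi.sub hc) hc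
  have h2 := cellNorm_add_le (Ω := Ω) (hc.sub hi) hi
  rw [sub_add_cancel, cellNorm_interpolant hΩ, h.normalized] at h1 h2
  rw [cellNorm_sub_comm] at h2
  rw [abs_le]
  constructor <;> linarith

end Duhamel

/-! ## Choice of the parameters -/

section Parameters

theorem log_two_le_log {x : ℝ} (hx : 0 ≤ x) : Real.log 2 ≤ Real.log (2 + x) :=
  Real.log_le_log (by norm_num) (by linarith)

/-- A logarithmic number of grid points makes the discretization error negligible. -/
theorem exists_grid_size {ρ κ K c : ℝ} (hρ : 0 < ρ) (hκ : 0 < κ) (hK : 0 < K) (hc : 0 < c) :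
    ∃ B : ℝ, 0 < B ∧ ∀ T ε : ℝ, κ ≤ |T| → 0 < ε → ∃ q : ℕ,
      (2 : ℝ) ^ q ≤ B * Real.log (2 + |T| / ε) ∧
      K * Real.exp (-(ρ / 4 * 2 ^ q)) * (1 + |T|) ≤ c * ε := by
  have hl2 : 0 < Real.log 2 := Real.log_pos (by norm_num)
  set K' := K * (1 + 1 / κ) / c with hK'
  have hK'0 : 0 < K' := by positivity
  -- The first summand makes the exponential beat `K' (2 + |T|/ε)`; the second guarantees `B ℓ ≥ 1`,
  -- which is needed to find a power of two nearby.
  set B := 4 / ρ * (1 + |Real.log K'| / Real.log 2) + 1 / Real.log 2 with hB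
  have hB0 : 0 < B := by positivity
  refine ⟨2 * B, by positivity, fun T ε hT hε => ?_⟩
  have hT0 : 0 < |T| := hκ.trans_le hT
  set ℓ := Real.log (2 + |T| / ε) with hℓ
  have hℓ2 : Real.log 2 ≤ ℓ := log_two_le_log (by positivity)
  have hx : 1 ≤ B * ℓ := by
    have h1 : 1 / Real.log 2 ≤ B := by
      rw [hB]; linarith [show 0 ≤ 4 / ρ * (1 + |Real.log K'| / Real.log 2) by positivity]
    calc (1 : ℝ) = 1 / Real.log 2 * Real.log 2 := by field_simp
      _ ≤ B * ℓ := by gcongr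
  obtain ⟨n, hn1, hn2⟩ := exists_nat_pow_near hx (by norm_num : (1 : ℝ) < 2)
  -- Here `2^n ≤ B ℓ < 2^{n+1}`. Rounding up secures the decay and costs the factor `2` in the
  -- constant.
  refine ⟨n + 1, by rw [pow_succ]; linarith, ?_⟩
  have h1 : ℓ + Real.log K' ≤ ρ / 4 * (B * ℓ) := by
    have h2 : |Real.log K'| ≤ |Real.log K'| / Real.log 2 * ℓ := by
      rw [div_mul_eq_mul_div, le_div_iff₀ hl2]
      gcongr
    have h3 : ρ / 4 * (B * ℓ) = ℓ + |Real.log K'| / Real.log 2 * ℓ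
        + ρ / 4 * (1 / Real.log 2) * ℓ := by
      rw [hB]; field_simp
    have h4 : 0 ≤ ρ / 4 * (1 / Real.log 2) * ℓ := by
      have := hl2.trans_le hℓ2
      positivity
    have := le_abs_self (Real.log K')
    linarith
  have h2 : Real.exp (-(ρ / 4 * 2 ^ (n + 1))) ≤ (K' * (2 + |T| / ε))⁻¹ := by
    rw [← Real.exp_log (show 0 < K' * (2 + |T| / ε) by positivity), ← Real.exp_neg,
      Real.log_mul hK'0.ne' (by positivity)]
    gcongr
    have : ρ / 4 * (B * ℓ) ≤ ρ / 4 * 2 ^ (n + 1) := by gcongr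
    linarith
  have h3 : 1 + |T| ≤ (1 + 1 / κ) * |T| := by
    have : 1 ≤ 1 / κ * |T| := by rw [one_div_mul_eq_div, one_le_div hκ]; exact hT
    linarith
  have h4 : |T| ≤ ε * (2 + |T| / ε) := by
    have : ε * (2 + |T| / ε) = 2 * ε + |T| := by field_simp
    linarith
  calc K * Real.exp (-(ρ / 4 * 2 ^ (n + 1))) * (1 + |T|)
      ≤ K * (K' * (2 + |T| / ε))⁻¹ * ((1 + 1 / κ) * (ε * (2 + |T| / ε))) := by
        gcongr
        exact h3.trans (by gcongr)
    _ = c * ε := by rw [hK']; field_simp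

/-- The number of time steps of a product formula of order `2k`. -/
theorem exists_steps {τ ε : ℝ} (hτ : 0 < τ) (hε : 0 < ε) (k : ℕ) :
    ∃ r : ℕ, 0 < r ∧ τ ≤ r ∧ r * (6 * (τ / r) ^ (2 * k + 3)) ≤ ε / 4 ∧
      (r : ℝ) ≤ 1 + τ * (1 + 24 * (τ / ε)) ^ (1 / (2 * ((k + 1 : ℕ) : ℝ))) := by
  set z := 1 + 24 * (τ / ε) with hz
  have hz1 : 1 ≤ z := by rw [hz]; linarith [show 0 ≤ 24 * (τ / ε) by positivity]
  set x : ℝ := 1 / (2 * ((k + 1 : ℕ) : ℝ)) with hx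
  have hx0 : 0 < x := by positivity
  have hzx : 1 ≤ z ^ x := Real.one_le_rpow hz1 hx0.le
  have hX : 0 < τ * z ^ x := by positivity
  -- The accuracy condition reads `r^{2k+2} ≥ τ^{2k+2} · 24τ/ε`. Enlarging `24τ/ε` to `z ≥ 1` also
  -- ensures `r ≥ τ`, the range in which the local error bound is valid.
  refine ⟨⌈τ * z ^ x⌉₊, Nat.ceil_pos.2 hX, ?_, ?_, ?_⟩
  · exact (le_mul_of_one_le_right hτ.le hzx).trans (Nat.le_ceil _)
  · have hr := Nat.le_ceil (τ * z ^ x)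
    set r : ℝ := (⌈τ * z ^ x⌉₊ : ℝ) with hrdef
    have hr0 : 0 < r := hX.trans_le hr
    have hpow : τ ^ (2 * k + 2) * z ≤ r ^ (2 * k + 2) := by
      have h1 : (z ^ x) ^ (2 * k + 2) = z := by
        rw [← Real.rpow_natCast, ← Real.rpow_mul (by linarith)]
        have : x * ((2 * k + 2 : ℕ) : ℝ) = 1 := by
          rw [hx]; push_cast; field_simp
        rw [this, Real.rpow_one]
      calc τ ^ (2 * k + 2) * z = (τ * z ^ x) ^ (2 * k + 2) := by rw [mul_pow, h1]
        _ ≤ _ := by gcongr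
    have h2 : 24 * τ ^ (2 * k + 3) ≤ ε * r ^ (2 * k + 2) := by
      have h3 : 24 * (τ / ε) ≤ z := by rw [hz]; linarith
      calc 24 * τ ^ (2 * k + 3) = ε * (τ ^ (2 * k + 2) * (24 * (τ / ε))) := by field_simp; ring
        _ ≤ ε * (τ ^ (2 * k + 2) * z) := by gcongr
        _ ≤ _ := by gcongr
    rw [div_pow, pow_succ r]
    have h4 : r * (6 * (τ ^ (2 * k + 3) / (r ^ (2 * k + 2) * r)))
        = 24 * τ ^ (2 * k + 3) / (4 * r ^ (2 * k + 2)) := by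
      field_simp; ring
    rw [h4, div_le_iff₀ (by positivity)]
    linarith
  · have := Nat.ceil_lt_add_one hX.le
    linarith

theorem costScale_eq {V T ε : ℝ} (hV : 0 < V) (hT : 0 < |T|) (hε : 0 < ε) (k : ℕ) :
    costScale k V T ε = 25 ^ k * (V * |T|) * (V * |T| / ε) ^ (1 / (2 * (k : ℝ))) := by
  rw [costScale, Real.rpow_add hV, Real.rpow_add hT, Real.rpow_one, Real.rpow_one,
    Real.div_rpow (by positivity) hε.le, Real.mul_rpow hV.le hT.le, pow_mul]
  norm_num
  ring

variable {κ V T ε : ℝ}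

theorem kappa_sq_le (hκ : 0 < κ) (hV : κ ≤ V) (hT : κ ≤ |T|) : κ ^ 2 ≤ V * |T| := by
  rw [pow_two]; gcongr; linarith

theorem kappa_cube_le (hκ : 0 < κ) (hV : κ ≤ V) (hT : κ ≤ |T|) (hε : 0 < ε) (hε' : ε ≤ 1 / κ) :
    κ ^ 3 ≤ V * |T| / ε := by
  have h := kappa_sq_le hκ hV hT
  rw [le_div_iff₀ hε]
  calc κ ^ 3 * ε ≤ κ ^ 3 * (1 / κ) := by gcongr
    _ = κ ^ 2 := by field_simp
    _ ≤ _ := h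

/-- The logarithm of the precision is controlled by the cost scale. -/
theorem exists_log_le (hκ : 0 < κ) : ∃ K : ℝ, 0 < K ∧ ∀ (V T ε : ℝ) (k : ℕ), κ ≤ V → κ ≤ |T| →
    0 < ε → ε ≤ 1 / κ → 1 ≤ k →
    Real.log (2 + |T| / ε) ≤ K * Real.log (2 + costScale k V T ε) ^ 2 := by
  have hl2 : 0 < Real.log 2 := Real.log_pos (by norm_num)
  -- A lower bound for `y^x` that holds for every exponent `0 < x ≤ 1`, hence for every order.
  set κ₁ := min 1 (κ ^ 3) with hκ₁
  have hκ₁0 : 0 < κ₁ := lt_min one_pos (by positivity)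
  set K₁ := 1 / (κ ^ 2 * κ₁) with hK₁
  have hK₁0 : 0 < K₁ := by positivity
  set K₂ := 2 / κ ^ 3 + 1 / κ with hK₂
  have hK₂0 : 0 < K₂ := by positivity
  refine ⟨|Real.log K₂| / Real.log 2 ^ 2 + 2 * (|Real.log K₁| / Real.log 2 + 1) ^ 2, by positivity,
    fun V T ε k hV hT hε hε' hk => ?_⟩
  have hV0 : 0 < V := hκ.trans_le hV
  have hT0 : 0 < |T| := hκ.trans_le hT
  have hk0 : (0 : ℝ) < k := by exact_mod_cast hk
  rw [costScale_eq hV0 hT0 hε]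
  have hP := kappa_sq_le hκ hV hT
  have hy := kappa_cube_le hκ hV hT hε hε'
  have hyV : |T| / ε ≤ 1 / κ * (V * |T| / ε) := by
    rw [mul_div_assoc, ← mul_assoc]
    refine le_mul_of_one_le_left (by positivity) ?_
    rw [one_div_mul_eq_div, one_le_div hκ]; exact hV
  set P := V * |T| with hPdef
  set y := P / ε with hydef
  have hP0 : 0 < P := by positivity
  have hy0 : 0 < y := by positivity
  set x : ℝ := 1 / (2 * (k : ℝ)) with hx
  have hx0 : 0 < x := by positivity
  have hx1 : x ≤ 1 := by
    rw [hx, div_le_one (by positivity)]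
    have : (1 : ℝ) ≤ k := by exact_mod_cast hk
    linarith
  have hyx : κ₁ ≤ y ^ x := by
    calc κ₁ = κ₁ ^ (1 : ℝ) := (Real.rpow_one _).symm
      _ ≤ κ₁ ^ x := Real.rpow_le_rpow_of_exponent_ge hκ₁0 (min_le_left _ _) hx1
      _ ≤ y ^ x := Real.rpow_le_rpow hκ₁0.le ((min_le_right _ _).trans hy) hx0.le
  set g := 25 ^ k * P * y ^ x with hg
  have hg0 : 0 < g := by positivity
  set G := Real.log (2 + g) with hG
  have hG2 : Real.log 2 ≤ G := log_two_le_log hg0.le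
  set s := Real.log (K₁ * g) with hs
  -- The factor `25^k ≥ e^k` of the cost scale makes the order itself logarithmic in `g`.
  have hks : (k : ℝ) ≤ s := by
    rw [hs, Real.le_log_iff_exp_le (by positivity)]
    have h1 : Real.exp k ≤ 25 ^ k := by
      rw [← Real.exp_one_pow k]
      gcongr
      exact Real.exp_one_lt_d9.le.trans (by norm_num)
    calc Real.exp k ≤ 25 ^ k := h1
      _ = K₁ * (25 ^ k * κ ^ 2 * κ₁) := by rw [hK₁]; field_simp
      _ ≤ K₁ * g := by rw [hg]; gcongr
  -- Undoing the root `y^{1/2k}` multiplies the logarithm by `2k ≤ 2s`. This is the origin of the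
  -- square and makes the estimate uniform in `k`.
  have hlogy : Real.log y ≤ 2 * s ^ 2 := by
    have h1 : y ^ x ≤ K₁ * g := by
      have h25 : (1 : ℝ) ≤ 25 ^ k := one_le_pow₀ (by norm_num)
      have h3 : 1 ≤ K₁ * (25 ^ k * P) := by
        have h4 : K₁ * (1 * (κ ^ 2 * κ₁)) = 1 := by rw [hK₁]; field_simp
        calc (1 : ℝ) = K₁ * (1 * (κ ^ 2 * κ₁)) := h4.symm
          _ ≤ K₁ * (25 ^ k * (κ ^ 2 * 1)) := by gcongr; exact min_le_left _ _
          _ ≤ _ := by rw [mul_one]; gcongr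
      calc y ^ x ≤ K₁ * (25 ^ k * P) * y ^ x := le_mul_of_one_le_left (by positivity) h3
        _ = K₁ * g := by rw [hg]; ring
    have h2 := Real.log_le_log (by positivity) h1
    rw [Real.log_rpow hy0, hx, one_div, inv_mul_le_iff₀ (by positivity)] at h2
    nlinarith
  have hsG : s ≤ (|Real.log K₁| / Real.log 2 + 1) * G := by
    rw [hs, Real.log_mul hK₁0.ne' hg0.ne']
    have h1 : Real.log g ≤ G := Real.log_le_log hg0 (by linarith)
    have h2 : |Real.log K₁| ≤ |Real.log K₁| / Real.log 2 * G := by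
      rw [div_mul_eq_mul_div, le_div_iff₀ hl2]
      gcongr
    have := le_abs_self (Real.log K₁)
    linarith
  have hfin : Real.log (2 + |T| / ε) ≤ Real.log K₂ + Real.log y := by
    rw [← Real.log_mul hK₂0.ne' hy0.ne']
    refine Real.log_le_log (by positivity) ?_
    have h1 : 2 ≤ 2 / κ ^ 3 * y := by
      rw [div_mul_eq_mul_div, le_div_iff₀ (by positivity)]; gcongr
    rw [hK₂, add_mul]
    exact add_le_add h1 hyV
  have h3 : Real.log K₂ ≤ |Real.log K₂| / Real.log 2 ^ 2 * G ^ 2 := by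
    refine (le_abs_self _).trans ?_
    rw [div_mul_eq_mul_div, le_div_iff₀ (by positivity)]
    gcongr
  have h4 : s ^ 2 ≤ ((|Real.log K₁| / Real.log 2 + 1) * G) ^ 2 := by
    have : 0 ≤ s := hk0.le.trans hks
    gcongr
  rw [add_mul]
  rw [mul_pow] at h4
  linarith

/-- The number of exponentials is controlled by the cost scale. -/
theorem steps_mul_le (hκ : 0 < κ) (hV : κ ≤ V) (hT : κ ≤ |T|) (hε : 0 < ε) (hε' : ε ≤ 1 / κ)
    {a : ℝ} (ha : 1 ≤ a) (k : ℕ) {r : ℝ}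
    (hr : r ≤ 1 + 3 ^ k * (a * V) * |T|
      * (1 + 24 * (3 ^ k * (a * V) * |T| / ε)) ^ (1 / (2 * ((k + 1 : ℕ) : ℝ)))) :
    r * (8 * 5 ^ k) ≤ 24 * (1 + 1 / κ ^ 2) * (24 + 1 / κ ^ 3) * a ^ 2
      * costScale (k + 1) V T ε := by
  have hV0 : 0 < V := hκ.trans_le hV
  have hT0 : 0 < |T| := hκ.trans_le hT
  rw [costScale_eq hV0 hT0 hε]
  have hP := kappa_sq_le hκ hV hT
  have hy := kappa_cube_le hκ hV hT hε hε'
  have e1 : 3 ^ k * (a * V) * |T| = 3 ^ k * a * (V * |T|) := by ring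
  rw [e1, mul_div_assoc] at hr
  set P := V * |T| with hPdef
  set y := P / ε with hydef
  have hP0 : 0 < P := by positivity
  have hy0 : 0 < y := by positivity
  have ha0 : 0 < a := one_pos.trans_le ha
  set x : ℝ := 1 / (2 * ((k + 1 : ℕ) : ℝ)) with hx
  have hx0 : 0 < x := by positivity
  have hx1 : x ≤ 1 := by
    rw [hx, div_le_one (by positivity)]
    push_cast
    have : (0 : ℝ) ≤ k := k.cast_nonneg
    linarith
  set K := 24 + 1 / κ ^ 3 with hK
  have hK1 : 1 ≤ K := by
    have : 0 < 1 / κ ^ 3 := by positivity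
    linarith
  have h3k : (1 : ℝ) ≤ 3 ^ k := one_le_pow₀ (by norm_num)
  have hb : 1 + 24 * (3 ^ k * a * y) ≤ K * (3 ^ k * (a * y)) := by
    have h1 : 1 ≤ 1 / κ ^ 3 * (3 ^ k * (a * y)) := by
      calc (1 : ℝ) = 1 / κ ^ 3 * (1 * (1 * κ ^ 3)) := by field_simp
        _ ≤ _ := by gcongr
    rw [hK, add_mul]; linarith
  have hpow : (1 + 24 * (3 ^ k * a * y)) ^ x ≤ K * (3 * (a * y ^ x)) := by
    have hid : ∀ z : ℝ, 1 ≤ z → z ^ x ≤ z := fun z hz => by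
      calc z ^ x ≤ z ^ (1 : ℝ) := Real.rpow_le_rpow_of_exponent_le hz hx1
        _ = z := Real.rpow_one z
    -- The exponent `k/(2(k+1))` is less than `1`, so under the root the stretch factor `3^k` stays
    -- bounded.
    have h3 : ((3 : ℝ) ^ k) ^ x ≤ 3 := by
      rw [← Real.rpow_natCast, ← Real.rpow_mul (by norm_num)]
      calc (3 : ℝ) ^ ((k : ℝ) * x) ≤ 3 ^ (1 : ℝ) := by
            apply Real.rpow_le_rpow_of_exponent_le (by norm_num)
            rw [hx, mul_one_div, div_le_one (by positivity)]
            push_cast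
            have : (0 : ℝ) ≤ k := k.cast_nonneg
            linarith
        _ = 3 := Real.rpow_one 3
    calc (1 + 24 * (3 ^ k * a * y)) ^ x ≤ (K * (3 ^ k * (a * y))) ^ x :=
          Real.rpow_le_rpow (by positivity) hb hx0.le
      _ = K ^ x * (((3 : ℝ) ^ k) ^ x * (a ^ x * y ^ x)) := by
          rw [Real.mul_rpow (by positivity) (by positivity),
            Real.mul_rpow (by positivity) (by positivity),
            Real.mul_rpow (by positivity) (by positivity)]
      _ ≤ _ := by
          gcongr
          · exact hid K hK1
          · exact hid a ha
  set X := 3 ^ k * a * P * (1 + 24 * (3 ^ k * a * y)) ^ x with hX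
  have hone : 1 ≤ 1 / κ ^ 2 * X := by
    have h1 : (1 : ℝ) ≤ (1 + 24 * (3 ^ k * a * y)) ^ x :=
      Real.one_le_rpow (by linarith [show 0 ≤ 24 * (3 ^ k * a * y) by positivity]) hx0.le
    calc (1 : ℝ) = 1 / κ ^ 2 * (1 * 1 * κ ^ 2 * 1) := by field_simp
      _ ≤ 1 / κ ^ 2 * X := by rw [hX]; gcongr
  have hXle : X ≤ 3 ^ k * a * P * (K * (3 * (a * y ^ x))) := by rw [hX]; gcongr
  have hr2 : r ≤ (1 + 1 / κ ^ 2) * (3 ^ k * a * P * (K * (3 * (a * y ^ x)))) := by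
    calc r ≤ (1 + 1 / κ ^ 2) * X := by linarith
      _ ≤ _ := by gcongr
  -- The stretching of time and the number of factors together grow like `15^k`, within the `5^{2k}`
  -- allowance of the cost scale.
  have h15 : (3 : ℝ) ^ k * 5 ^ k ≤ 25 ^ (k + 1) := by
    rw [← mul_pow]
    calc ((3 : ℝ) * 5) ^ k ≤ 25 ^ k := by gcongr; norm_num
      _ ≤ 25 ^ (k + 1) := pow_le_pow_right₀ (by norm_num) (by omega)
  calc r * (8 * 5 ^ k)
      ≤ (1 + 1 / κ ^ 2) * (3 ^ k * a * P * (K * (3 * (a * y ^ x)))) * (8 * 5 ^ k) := by gcongr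
    _ = 24 * (1 + 1 / κ ^ 2) * K * a ^ 2 * (3 ^ k * 5 ^ k * P * y ^ x) := by ring
    _ ≤ 24 * (1 + 1 / κ ^ 2) * K * a ^ 2 * (25 ^ (k + 1) * P * y ^ x) := by gcongr

end Parameters

/-! ### Assembly of circuits and error estimates -/

theorem length_freeMonoid_pow {α : Type} (c : FreeMonoid α) (n : ℕ) :
    (c ^ n).length = n * c.length := by
  induction n with
  | zero => simp
  | succ n ih => rw [pow_succ, FreeMonoid.length_mul, ih]; ring

section Assembly

open Matrix
open scoped Matrix.Norms.L2Operator

variable {Ω m e : ℝ} {φ : Space → ℝ} {A : Space → Fin 3 → ℝ} {q : ℕ}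

/-- The sum of the norms of the four terms. -/
theorem sum_norm_hamTerm_le (hΩ : 0 < Ω) (hφ : ∀ x, |φ x| ≤ scalarMax φ)
    (hA : ∀ x, Real.sqrt (∑ i, A x i ^ 2) ≤ vectorMax A) :
    ∑ j, ‖hamTerm Ω m e φ A q j‖
      ≤ 3 * (Real.pi / Ω * 2 ^ q) + |m| + 3 * |e| * (scalarMax φ + vectorMax A) := by
  rw [Fin.sum_univ_four]
  have h0 := norm_hamTerm_zero_le (q := q) Ω m e φ A hΩ
  have h1 := norm_hamTerm_one_le (q := q) Ω m e φ A
  have h2 := norm_hamTerm_two_le (q := q) Ω m e (A := A) hφ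
  have h3 := norm_hamTerm_three_le (q := q) Ω m e (φ := φ) hA
  have h4 : 0 ≤ |e| * scalarMax φ := mul_nonneg (abs_nonneg _) ((abs_nonneg _).trans (hφ 0))
  linarith

/-- The mass term is a sign on a single spinor qubit and needs one gate. The other three are
Hermitian and are covered by the general synthesis. -/
theorem exists_circuits (Ω m e : ℝ) (φ : Space → ℝ) (A : Space → Fin 3 → ℝ) (q : ℕ) :
    ∃ W : Fin 4 → ℝ → Circuit q,
      (∀ j s, circuitMatrix (W j s) = propagator (hamTerm Ω m e φ A q j) s) ∧
      (∀ j s, (W j s).length ≤ 19 * (4 * (2 ^ q) ^ 3) ^ 4) ∧ ∀ s, (W 1 s).length ≤ 1 := by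
  have h : ∀ (j : Fin 4) (s : ℝ), ∃ c : Circuit q,
      circuitMatrix c = propagator (hamTerm Ω m e φ A q j) s ∧
      c.length ≤ 19 * (4 * (2 ^ q) ^ 3) ^ 4 ∧ (j = 1 → c.length ≤ 1) := by
    intro j s
    by_cases hj : j = 1
    · subst hj
      obtain ⟨-, c, hc, hl⟩ := implementable_mass (q := q) Ω m e φ A s
      refine ⟨c, hc, hl.trans ?_, fun _ => hl⟩
      exact Nat.succ_le_of_lt (by positivity)
    · obtain ⟨-, c, hc, hl⟩ := implementable_propagator (hamTerm_isHermitian (q := q) Ω m e φ A j) s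
      exact ⟨c, hc, hl, fun h => absurd h hj⟩
  choose W h1 h2 h3 using h
  exact ⟨W, h1, h2, fun s => h3 1 s rfl⟩

/-- Accuracy of a circuit for the discretized evolution on encoded solutions. -/
theorem IsDiracSolution.circuit_accuracy {ρ M T κ ε : ℝ} (hΩ : 0 < Ω) (hρ : 0 < ρ)
    {ψ : ℝ → Space → SpinIdx → ℂ} (h : IsDiracSolution Ω m e φ A ρ M T ψ) (hκ : 0 < κ)
    (hε : ε ≤ 1 / κ)
    (hq : ((28 * Real.pi / Ω + 130) * Real.sqrt Ω ^ 3 * |M| * (∑' p, decayWeight (ρ / 2) p) + 1)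
      * Real.exp (-(ρ / 4 * 2 ^ q)) * (1 + |T|) ≤ min (1 / 4) (κ / 2) * ε)
    {U : Matrix (Reg q) (Reg q) ℂ} (hU : U ∈ unitaryGroup (Reg q) ℂ)
    (hUT : ∀ v : QState q,
      ‖act U v - act (propagator (∑ j, hamTerm Ω m e φ A q j) T) v‖ ≤ ε / 4 * ‖v‖) :
    ‖act U (initialState Ω q (ψ 0))‖ = 1 ∧
      ‖act U (initialState Ω q (ψ 0)) - sampleState Ω q (ψ T)‖ ≤ ε ∧
      cellNorm Ω (interpolant Ω (act U (initialState Ω q (ψ 0))) - ψ T) ≤ ε := by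
  set D := ∑' p, decayWeight (ρ / 2) p with hD
  have hD0 : 0 ≤ D := tsum_nonneg (decayWeight_nonneg _)
  set E := Real.exp (-(ρ / 4 * 2 ^ q)) with hE
  have hE0 : 0 < E := Real.exp_pos _
  have hT0 := abs_nonneg T
  have hM := le_abs_self M
  have hpi := Real.pi_pos
  set S := Real.sqrt Ω ^ 3 with hS
  have hS0 : 0 ≤ S := by positivity
  -- The sign of `ε` is implicit in `hq`, whose left-hand side is nonnegative.
  have hε0 : 0 ≤ ε := by
    by_contra hneg
    have h1 : 0 < min (1 / 4) (κ / 2) := lt_min (by norm_num) (by positivity)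
    have h2 : min (1 / 4) (κ / 2) * ε < 0 := mul_neg_of_pos_of_neg h1 (not_le.1 hneg)
    have h3 : 0 ≤ ((28 * Real.pi / Ω + 130) * S * |M| * D + 1) * E * (1 + |T|) := by positivity
    linarith
  -- The minimum has two purposes: a quarter of `ε` is reserved for the discretization, and with `ε
  -- ≤ 1/κ` the same quantity is at most `1/2`, so the sampled initial state is nonzero and can be
  -- normalized.
  have hc1 : min (1 / 4) (κ / 2) * ε ≤ ε / 4 := by
    have := mul_le_mul_of_nonneg_right (min_le_left (1 / 4) (κ / 2)) hε0
    linarith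
  have hc2 : min (1 / 4) (κ / 2) * ε ≤ 1 / 2 := by
    have h1 := mul_le_mul_of_nonneg_right (min_le_right (1 / 4) (κ / 2)) hε0
    have h2 : κ / 2 * ε ≤ κ / 2 * (1 / κ) := by gcongr
    have h3 : κ / 2 * (1 / κ) = 1 / 2 := by field_simp
    linarith
  have hη : 130 * S * M * E * D + 28 * Real.pi / Ω * S * M * E * D * |T|
      ≤ min (1 / 4) (κ / 2) * ε := by
    refine le_trans ?_ hq
    have h1 : 130 * S * M * E * D ≤ 130 * S * |M| * E * D := by gcongr
    have h2 : 28 * Real.pi / Ω * S * M * E * D * |T|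
        ≤ 28 * Real.pi / Ω * S * |M| * E * D * |T| := by gcongr
    have h3 : 0 ≤ 130 * S * |M| * E * D * |T| := by positivity
    have h4 : 0 ≤ 28 * Real.pi / Ω * S * |M| * E * D := by positivity
    have h5 : 0 ≤ E * (1 + |T|) := by positivity
    calc _ ≤ 130 * S * |M| * E * D + 28 * Real.pi / Ω * S * |M| * E * D * |T|
          + 130 * S * |M| * E * D * |T| + 28 * Real.pi / Ω * S * |M| * E * D + E * (1 + |T|) := by
          linarith
      _ = _ := by ring
  have hev := h.norm_propagator_sub_le (q := q) hΩ hρ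
  have hnorm := h.abs_norm_sampleState_sub_one_le (q := q) hΩ hρ
  have hint := h.cellNorm_interpolant_sub_le (q := q) hΩ hρ Set.right_mem_uIcc
  rw [← hS, ← hE, ← hD] at hev hnorm hint
  have hev0 := (norm_nonneg _).trans hev
  have hint0 := (abs_nonneg _).trans hnorm
  set v₀ := sampleState Ω q (ψ 0) with hv₀
  set u := initialState Ω q (ψ 0) with hu
  set Z := propagator (∑ j, hamTerm Ω m e φ A q j) T with hZ
  have hv0 : 0 < ‖v₀‖ := by
    have := (abs_le.1 hnorm).1
    linarith
  have hu1 : ‖u‖ = 1 := by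
    rw [hu, initialState, norm_smul, Complex.norm_real, norm_inv, norm_norm,
      inv_mul_cancel₀ hv0.ne']
  have huv : ‖u - v₀‖ ≤ 130 * S * M * E * D := by
    refine le_trans (le_of_eq ?_) hnorm
    have e1 : u - v₀ = ((‖v₀‖⁻¹ - 1 : ℝ) : ℂ) • v₀ := by
      rw [hu, initialState, Complex.ofReal_sub, sub_smul, Complex.ofReal_one, one_smul]
    rw [e1, norm_smul, Complex.norm_real, Real.norm_eq_abs, ← abs_of_pos hv0, ← abs_mul,
      abs_of_pos hv0, sub_mul, inv_mul_cancel₀ hv0.ne', one_mul, abs_sub_comm]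
  have hHerm : (∑ j, hamTerm Ω m e φ A q j).IsHermitian := by
    simp only [IsHermitian, conjTranspose_sum,
      fun j => (hamTerm_isHermitian (q := q) Ω m e φ A j).eq]
  have hZu := propagator_mem_unitary hHerm T
  -- The error budget is `ε/4` for the circuit and `ε/4` for normalization and discrete evolution
  -- together. The interpolation of `ψ T` will take at most another `ε/4`.
  have hmain : ‖act U u - sampleState Ω q (ψ T)‖ ≤ ε / 2 := by
    have h1 := hUT u
    rw [hu1, mul_one] at h1
    have h2 : ‖act Z u - act Z v₀‖ ≤ 130 * S * M * E * D := by
      rw [← act_sub, norm_act_of_unitary hZu]; exact huv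
    calc ‖act U u - sampleState Ω q (ψ T)‖
        = ‖(act U u - act Z u) + (act Z u - act Z v₀) + (act Z v₀ - sampleState Ω q (ψ T))‖ := by
          congr 1; abel
      _ ≤ ‖act U u - act Z u‖ + ‖act Z u - act Z v₀‖ + ‖act Z v₀ - sampleState Ω q (ψ T)‖ :=
          norm_add₃_le
      _ ≤ ε / 2 := by linarith
  refine ⟨by rw [norm_act_of_unitary hU, hu1], by linarith, ?_⟩
  have hc := (h.differentiable T Set.right_mem_uIcc).continuous
  have hadd := cellNorm_add_le (Ω := Ω)
    (continuous_interpolant (Ω := Ω) (act U u - sampleState Ω q (ψ T)))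
    ((continuous_interpolant (Ω := Ω) (sampleState Ω q (ψ T))).sub hc)
  have e2 : interpolant Ω (act U u - sampleState Ω q (ψ T))
      = interpolant Ω (act U u) - interpolant Ω (sampleState Ω q (ψ T)) := by
    classical
    funext x a
    simp only [interpolant, Pi.sub_apply, act_sub, PiLp.sub_apply, sub_mul, ← mul_sub,
      ← Finset.sum_sub_distrib]
    congr 1
    refine Finset.sum_congr rfl fun b _ => ?_
    split_ifs <;> simp
  rw [cellNorm_interpolant hΩ, e2, sub_add_sub_cancel] at hadd
  linarith

end Assembly

end DiracSim

end

open DiracSim in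
theorem mainTheorem1 (Ω m e ρ M κ : ℝ) (hΩ : 0 < Ω) (hρ : 0 < ρ) (hκ : 0 < κ) :
    ∃ (C : ℝ) (a : ℕ), 0 < C ∧
      ∀ (φ : Space → ℝ) (A : Space → Fin 3 → ℝ) (k : ℕ) (T ε : ℝ),
        Continuous φ → Periodic3 Ω φ → Continuous A → Periodic3 Ω A →
        1 ≤ k → κ ≤ scalarMax φ + vectorMax A → κ ≤ |T| → 0 < ε → ε ≤ 1 / κ →
        ∃ (q r : ℕ) (W : Fin 4 → ℝ → Circuit q) (circ : Circuit q),
          -- the number of grid points per direction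
          (2 : ℝ) ^ q ≤ C * Real.log (2 + |T| / ε) ∧
          -- circuits for the four exponentials, and their gate counts
          (∀ j s, circuitMatrix (W j s) = propagator (hamTerm Ω m e φ A q j) s) ∧
          (∀ j s, ((W j s).length : ℝ) ≤ C * Real.log (2 + |T| / ε) ^ a) ∧
          (∀ s, (W 1 s).length ≤ 1) ∧
          -- the circuit is the product formula of order `2k` with `r` time steps
          0 < r ∧ circ = suzuki W k (T / r) ^ r ∧
          -- its gate count
          (circ.length : ℝ) ≤
            C * costScale k (scalarMax φ + vectorMax A) T ε *
              Real.log (2 + costScale k (scalarMax φ + vectorMax A) T ε) ^ a ∧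
          -- it approximates the evolution generated by the discretized Hamiltonian
          (∀ v : QState q,
            ‖act (circuitMatrix circ) v - act (propagator (∑ j, hamTerm Ω m e φ A q j) T) v‖
              ≤ ε * ‖v‖) ∧
          -- it maps the encoded initial state to a normalized state approximating `ψ(T)`
          ∀ ψ : ℝ → Space → SpinIdx → ℂ, IsDiracSolution Ω m e φ A ρ M T ψ →
            ‖act (circuitMatrix circ) (initialState Ω q (ψ 0))‖ = 1 ∧
            ‖act (circuitMatrix circ) (initialState Ω q (ψ 0)) - sampleState Ω q (ψ T)‖ ≤ ε ∧
            cellNorm Ω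
              (interpolant Ω (act (circuitMatrix circ) (initialState Ω q (ψ 0))) - ψ T) ≤ ε := by
  have hl2 : 0 < Real.log 2 := Real.log_pos (by norm_num)
  have hpi := Real.pi_pos
  set K₀ := (28 * Real.pi / Ω + 130) * Real.sqrt Ω ^ 3 * |M| * (∑' p, decayWeight (ρ / 2) p) + 1
    with hK₀
  have hK₀0 : 0 < K₀ := by
    have : 0 ≤ ∑' p, decayWeight (ρ / 2) p := tsum_nonneg (decayWeight_nonneg _)
    positivity
  obtain ⟨B, hB, hgrid⟩ := exists_grid_size hρ hκ hK₀0
    (lt_min (by norm_num : (0 : ℝ) < 1 / 4) (half_pos hκ))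
  obtain ⟨K₁, hK₁, hlog⟩ := exists_log_le hκ
  -- With this constant `c ℓ V` dominates the sum of the norms of the four terms; the bounds `V ≥ κ`
  -- and `ℓ ≥ log 2` convert each contribution into a multiple of `ℓ V`. The last summand ensures `c
  -- ℓ ≥ 1`, as `steps_mul_le` requires.
  set c := 3 * Real.pi * B / (Ω * κ) + |m| / (κ * Real.log 2) + 3 * |e| / Real.log 2
    + 1 / Real.log 2 with hc
  have hc0 : 0 < c := by positivity
  -- The constant is `4864 = 19 · 4⁴`, from the synthesis cost `19 (4n³)⁴` with `n ≤ B ℓ`.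
  set L := 4864 * B ^ 12 with hL
  have hL0 : 0 < L := by positivity
  set F := 24 * (1 + 1 / κ ^ 2) * (24 + 1 / κ ^ 3) * c ^ 2 with hF
  have hF0 : 0 < F := by positivity
  -- The exponent is `28 = 2 · (2 + 12)`: the step count brings `ℓ²`, each exponential brings `ℓ¹²`,
  -- and `ℓ` is at most `K₁ log²(2 + g)`. The middle constant pads the power `12` of a single
  -- exponential to the common exponent by means of `ℓ ≥ log 2`.
  refine ⟨B + L / Real.log 2 ^ 16 + F * L * K₁ ^ 14, 28, by positivity, ?_⟩
  intro φ A k T ε hφc hφp hAc hAp hk hV hT hε hε'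
  obtain ⟨k, rfl⟩ : ∃ k', k = k' + 1 := ⟨k - 1, by omega⟩
  have hφ := abs_le_scalarMax hΩ hφc hφp
  have hA := sqrt_le_vectorMax hΩ hAc hAp
  obtain ⟨q, hq1, hq2⟩ := hgrid T ε hT hε
  set V := scalarMax φ + vectorMax A with hVdef
  have hV0 : 0 < V := hκ.trans_le hV
  have hT0 : 0 < |T| := hκ.trans_le hT
  have hlog := hlog V T ε (k + 1) hV hT hε hε' (by omega)
  have hℓ2 : Real.log 2 ≤ Real.log (2 + |T| / ε) := log_two_le_log (by positivity)
  set ℓ := Real.log (2 + |T| / ε) with hℓ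
  have hℓ0 : 0 < ℓ := hl2.trans_le hℓ2
  have ha : 1 ≤ c * ℓ := by
    have h1 : 1 / Real.log 2 ≤ c := by
      rw [hc]
      linarith [show 0 ≤ 3 * Real.pi * B / (Ω * κ) + |m| / (κ * Real.log 2)
        + 3 * |e| / Real.log 2 by positivity]
    calc (1 : ℝ) = 1 / Real.log 2 * Real.log 2 := by field_simp
      _ ≤ c * ℓ := by gcongr
  have hΛ : ∑ j, Norm.norm (self := Matrix.instL2OpNormedAddCommGroup.toNorm)
      (hamTerm Ω m e φ A q j) ≤ c * ℓ * V := by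
    refine (sum_norm_hamTerm_le hΩ hφ hA).trans ?_
    rw [← hVdef]
    have h1 : 3 * (Real.pi / Ω * 2 ^ q) ≤ 3 * Real.pi * B / (Ω * κ) * ℓ * V := by
      calc 3 * (Real.pi / Ω * 2 ^ q) ≤ 3 * (Real.pi / Ω * (B * ℓ)) := by gcongr
        _ = 3 * Real.pi * B / (Ω * κ) * ℓ * κ := by field_simp
        _ ≤ _ := by gcongr
    have h2 : |m| ≤ |m| / (κ * Real.log 2) * ℓ * V := by
      calc |m| = |m| / (κ * Real.log 2) * Real.log 2 * κ := by field_simp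
        _ ≤ _ := by gcongr
    have h3 : 3 * |e| * V ≤ 3 * |e| / Real.log 2 * ℓ * V := by
      calc 3 * |e| * V = 3 * |e| / Real.log 2 * Real.log 2 * V := by field_simp
        _ ≤ _ := by gcongr
    have h4 : 0 ≤ 1 / Real.log 2 * ℓ * V := by positivity
    calc _ ≤ 3 * Real.pi * B / (Ω * κ) * ℓ * V + |m| / (κ * Real.log 2) * ℓ * V
          + 3 * |e| / Real.log 2 * ℓ * V + 1 / Real.log 2 * ℓ * V := by linarith
      _ = _ := by rw [hc]; ring
  obtain ⟨r, hr0, hr1, hr2, hr3⟩ := exists_steps (τ := 3 ^ k * (c * ℓ * V) * |T|) (by positivity)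
    hε k
  obtain ⟨W, hW1, hW2, hW3⟩ := exists_circuits Ω m e φ A q
  set N := 19 * (4 * (2 ^ q) ^ 3) ^ 4 with hN
  have hNℓ : (N : ℝ) ≤ L * ℓ ^ 12 := by
    have h1 : (N : ℝ) = 4864 * ((2 : ℝ) ^ q) ^ 12 := by rw [hN]; push_cast; ring
    have h2 : ((2 : ℝ) ^ q) ^ 12 ≤ (B * ℓ) ^ 12 := by gcongr
    rw [h1, hL]
    rw [mul_pow] at h2
    linarith
  have hg0 : 0 < costScale (k + 1) V T ε := by
    rw [costScale_eq hV0 hT0 hε]; positivity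
  set g := costScale (k + 1) V T ε with hg
  have hG0 : 0 < Real.log (2 + g) := hl2.trans_le (log_two_le_log hg0.le)
  have hmat : circuitMatrix (suzuki W (k + 1) (T / r) ^ r)
      = suzuki (fun j => propagator (hamTerm Ω m e φ A q j)) (k + 1) (T / r) ^ r := by
    have h1 := map_suzuki (FreeMonoid.lift (Gate.matrix (q := q))) W (k + 1) (T / r)
    rw [circuitMatrix, map_pow, h1]
    congr 2
    funext j s
    exact hW1 j s
  have hU : circuitMatrix (suzuki W (k + 1) (T / r) ^ r) ∈ Matrix.unitaryGroup (Reg q) ℂ := by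
    rw [hmat]
    exact pow_mem (suzuki_mem_unitary _
      (fun j t => propagator_mem_unitary (hamTerm_isHermitian Ω m e φ A j) t) _ _) _
  have herr : ∀ v : QState q, ‖act (circuitMatrix (suzuki W (k + 1) (T / r) ^ r)) v
      - act (propagator (∑ j, hamTerm Ω m e φ A q j) T) v‖ ≤ ε / 4 * ‖v‖ := by
    intro v
    rw [← act_sub_left, hmat]
    refine (norm_act_le _ v).trans ?_
    refine mul_le_mul_of_nonneg_right ?_ (norm_nonneg v)
    exact (norm_suzuki_pow_sub_propagator_le (hamTerm Ω m e φ A q)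
      (hamTerm_isHermitian Ω m e φ A) (c * ℓ * V) T hΛ k hr0 hr1).trans hr2
  refine ⟨q, r, W, suzuki W (k + 1) (T / r) ^ r, ?_, hW1, ?_, hW3, hr0, rfl, ?_, ?_, ?_⟩
  · refine hq1.trans ?_
    gcongr
    linarith [show 0 ≤ L / Real.log 2 ^ 16 + F * L * K₁ ^ 14 by positivity]
  · intro j s
    calc ((W j s).length : ℝ) ≤ N := by exact_mod_cast hW2 j s
      _ ≤ L * ℓ ^ 12 := hNℓ
      _ = L / Real.log 2 ^ 16 * (ℓ ^ 12 * Real.log 2 ^ 16) := by field_simp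
      _ ≤ L / Real.log 2 ^ 16 * (ℓ ^ 12 * ℓ ^ 16) := by gcongr
      _ = L / Real.log 2 ^ 16 * ℓ ^ 28 := by ring
      _ ≤ _ := by
        gcongr
        linarith [show 0 ≤ F * L * K₁ ^ 14 by positivity]
  · have h1 := steps_mul_le hκ hV hT hε hε' ha k hr3
    have h2 : (((suzuki W (k + 1) (T / r) ^ r).length : ℕ) : ℝ) ≤ r * (8 * 5 ^ k) * N := by
      rw [length_freeMonoid_pow]
      have := Nat.mul_le_mul_left r (length_suzuki_le W N hW2 k (T / r))
      have h3 : ((r * (suzuki W (k + 1) (T / r)).length : ℕ) : ℝ)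
          ≤ ((r * (8 * 5 ^ k * N) : ℕ) : ℝ) := by exact_mod_cast this
      refine h3.trans (le_of_eq ?_)
      push_cast
      ring
    calc _ ≤ (r : ℝ) * (8 * 5 ^ k) * (N : ℝ) := h2
      _ ≤ (24 * (1 + 1 / κ ^ 2) * (24 + 1 / κ ^ 3) * (c * ℓ) ^ 2 * g) * (L * ℓ ^ 12) := by
          gcongr
      _ = F * L * g * ℓ ^ 14 := by rw [hF]; ring
      _ ≤ F * L * g * (K₁ * Real.log (2 + g) ^ 2) ^ 14 := by gcongr
      _ = F * L * K₁ ^ 14 * g * Real.log (2 + g) ^ 28 := by ring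
      _ ≤ _ := by
        gcongr
        linarith [show 0 ≤ L / Real.log 2 ^ 16 by positivity]
  · intro v
    refine (herr v).trans ?_
    gcongr
    linarith
  · intro ψ hψ
    exact hψ.circuit_accuracy hΩ hρ hκ hε' hq2 hU herr
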